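/- Let $n\ge 2$, $p\in\mathbb R$ with $p<-n$ or $p\ge 0$, and $k\ge 1$ an integer. For a convex body $K\subset\mathbb R^n$ with $0\in\operatorname{int}K$ let $N(x)$ be the (a.e. unique) outer unit normal at $x\in\partial K$, and let $H_j$ be the $j$-th normalized elementary symmetric function of the generalized principal curvatures, which exist a.e. on $\partial K$ ($H_0=1$). Let $\binom{\alpha}{j}$ be the generalized binomial coefficient and, for $i=(i_1,\dots,i_{n-1})\in\mathbb Z_{\ge 0}^{n-1}$, put $c(n,p,i)=\binom{n/(n+p)}{i_1+\dots+i_{n-1}}\frac{(i_1+\dots+i_{n-1})!}{i_1!\cdots i_{n-1}!}$. Define $$\mathcal W^p_{m,k}(K)=\int_{\partial K}\langle x,N(x)\rangle^{m-k+\frac{n(1-p)}{n+p}}H_{n-1}^{\frac p{n+p}}\sum_{i_1+2i_2+\dots+(n-1)i_{n-1}=m}c(n,p,i)\prod_{j=1}^{n-1}\binom{n-1}{j}^{i_j}H_j^{i_j}\,d\mathcal H^{n-1},$$ $$\mathcal V^p_k(K)=\sum_{m=0}^k\binom{\frac{n(1-p)}{n+p}}{k-m}\mathcal W^p_{m,k}(K),\qquad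 F_m(p)=\sum_{i_1+2i_2+\dots+(n-1)i_{n-1}=m}c(n,p,i)\prod_{j=1}^{n-1}\binom{n-1}{j}^{i_j}.$$ Let $\mathcal D$ be the set of convex bodies with $0$ in the interior for which the integrals defining $\mathcal W^p_{m,k}(K)$, $0\le m\le k$, converge absolutely, with the Hausdorff metric. Then: 1. If $p\ne 0$ or $k\le n$, then $\mathcal V^p_k$ is neither lower nor upper semicontinuous on $\mathcal D$. (In the remaining case $p=0$, $k>n$, one has $\mathcal V^0_k(K)=0$ for every $K$.) 2. Every polytope $P$ with $0\in\operatorname{int}P$ lies in $\mathcal D$, with $\mathcal V^p_k(P)=\mathcal H^{n-1}(\partial P)$ if $p=0$ and $k=1$, and $\mathcal V^p_k(P)=0$ otherwise. There are such polytopes converging to the Euclidean unit ball $B^n_2$, and $B^n_2\in\mathcal D$ with $\mathcal V^p_k(B^n_2)=\binom{n\frac{n-p}{n+p}}{k}\mathcal H^{n-1}(S^{n-1})$. 3. Let $B^n_\infty=[-1,1]^n$, $K_l=(1-\frac1l)B^n_\infty+\frac1l B^n_2$ for $l\ge1$, and $S^{n-1}_+=\{\xi\in S^{n-1}:\xi_1,\dots,\xi_n\ge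 0\}$. Then $K_l\to B^n_\infty$. If $p\ne 0$, then $K_l\in\mathcal D$ for all $l\ge 1$, and, as $l\to\infty$, $\mathcal V^p_k(K_l)$ and $$2^n\sum_{m=0}^k l^{\,m-\frac{n(n-1)}{n+p}}\binom{\frac{n(1-p)}{n+p}}{k-m}F_m(p)\int_{S^{n-1}_+}\Big(\sum_{i=1}^n\xi_i\Big)^{m-k+\frac{n(1-p)}{n+p}}d\mathcal H^{n-1}(\xi)$$ converge to the same limit in $[-\infty,\infty]$. If $p<-n$, then $\mathcal V^p_k(K_l)\to-\infty$ for odd $k$ and $\mathcal V^p_k(K_l)\to+\infty$ for even $k$. If $p>0$ and $k=\frac{n(n-1)}{n+p}$, then $$\mathcal V^p_k(K_l)\to 2^nF_k(p)\int_{S^{n-1}_+}\Big(\sum_{i=1}^n\xi_i\Big)^{\frac{n(1-p)}{n+p}}d\mathcal H^{n-1}(\xi)>0.$$ -/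

import Mathlib

open MeasureTheory Filter Topology

noncomputable section

namespace LpSteiner

/-- `u` is an outer unit normal vector of `K` at the point `x`. -/
def IsOuterUnitNormal {n : ℕ} (K : ConvexBody (EuclideanSpace ℝ (Fin n)))
    (x u : EuclideanSpace ℝ (Fin n)) : Prop :=
  ‖u‖ = 1 ∧ ∀ y ∈ K, inner ℝ (y - x) u ≤ 0

open Classical in
/-- The outer unit normal `N(x)` of `K` at `x`. It is unique at almost every boundary point; at
the other boundary points some outer unit normal is chosen. -/
def outerNormal {n : ℕ} (K : ConvexBody (EuclideanSpace ℝ (Fin n)))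
    (x : EuclideanSpace ℝ (Fin n)) : EuclideanSpace ℝ (Fin n) :=
  if h : ∃ u, IsOuterUnitNormal K x u then h.choose else 0

/-- `κ` lists the (generalized) principal curvatures of `∂K` at `x`, with multiplicity: there is an
orthonormal basis `v` of the tangent hyperplane `N(x)ᗮ` (the principal directions) such that the
boundary has the second order expansion
`⟨x - y, N(x)⟩ = (1/2) ∑ i, κ i * ⟨y - x, v i⟩ ^ 2 + o(‖y - x‖ ^ 2)` as `y → x` in `∂K`. -/
def HasPrincipalCurvatures {n : ℕ} (K : ConvexBody (EuclideanSpace ℝ (Fin n)))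
    (x : EuclideanSpace ℝ (Fin n)) (κ : Fin (n - 1) → ℝ) : Prop :=
  IsOuterUnitNormal K x (outerNormal K x) ∧
  ∃ v : Fin (n - 1) → EuclideanSpace ℝ (Fin n),
    Orthonormal ℝ v ∧ (∀ i, inner ℝ (v i) (outerNormal K x) = 0) ∧
    (fun y => inner ℝ (x - y) (outerNormal K x)
        - (1 / 2 : ℝ) * ∑ i, κ i * (inner ℝ (y - x) (v i)) ^ 2)
      =o[𝓝[frontier (K : Set (EuclideanSpace ℝ (Fin n)))] x] (fun y => ‖y - x‖ ^ 2)

open Classical in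
/-- The principal curvatures of `∂K` at `x`. They exist at almost every boundary point, and are
unique there up to their order; where they do not exist the value is `0`. -/
def principalCurvature {n : ℕ} (K : ConvexBody (EuclideanSpace ℝ (Fin n)))
    (x : EuclideanSpace ℝ (Fin n)) : Fin (n - 1) → ℝ :=
  if h : ∃ κ, HasPrincipalCurvatures K x κ then h.choose else 0

/-- The normalized `j`-th elementary symmetric function `H_j` of the principal curvatures. -/
def H {n : ℕ} (K : ConvexBody (EuclideanSpace ℝ (Fin n))) (j : ℕ)
    (x : EuclideanSpace ℝ (Fin n)) : ℝ :=
  ((n - 1).choose j : ℝ)⁻¹ *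
    ∑ s ∈ (Finset.univ : Finset (Fin (n - 1))).powersetCard j, ∏ i ∈ s, principalCurvature K x i

/-- The sequences `i_1, …, i_{n-1} ≥ 0` with `i_1 + 2 i_2 + … + (n-1) i_{n-1} = m`
(`i_{j+1}` is stored at the index `j`). -/
def indices (n m : ℕ) : Finset (Fin (n - 1) → ℕ) :=
  (Fintype.piFinset fun _ => Finset.range (m + 1)).filter
    fun i => ∑ j : Fin (n - 1), ((j : ℕ) + 1) * i j = m

/-- The coefficient `c(n,p,i) = binom(n/(n+p), i_1+…+i_{n-1}) * multinomial(i_1, …, i_{n-1})`. -/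
def c (n : ℕ) (p : ℝ) (i : Fin (n - 1) → ℕ) : ℝ :=
  Ring.choose ((n : ℝ) / (n + p)) (∑ j, i j) * (Nat.multinomial Finset.univ i : ℝ)

/-- The integrand of the `L_p` Steiner coefficient `W^p_{m,k}(K)`. -/
def integrandW {n : ℕ} (p : ℝ) (m k : ℕ) (K : ConvexBody (EuclideanSpace ℝ (Fin n)))
    (x : EuclideanSpace ℝ (Fin n)) : ℝ :=
  (inner ℝ x (outerNormal K x)) ^ ((m : ℝ) - k + n * (1 - p) / (n + p))
    * (H K (n - 1) x) ^ (p / (n + p))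
    * ∑ i ∈ indices n m, c n p i *
        ∏ j : Fin (n - 1), ((n - 1).choose ((j : ℕ) + 1) : ℝ) ^ i j * (H K ((j : ℕ) + 1) x) ^ i j

/-- The `L_p` Steiner coefficient `W^p_{m,k}(K)`. The measure `μHE[n - 1]` is the
`(n-1)`-dimensional Hausdorff measure in the usual (Euclidean) normalization. -/
def W {n : ℕ} (p : ℝ) (m k : ℕ) (K : ConvexBody (EuclideanSpace ℝ (Fin n))) : ℝ :=
  ∫ x in frontier (K : Set (EuclideanSpace ℝ (Fin n))), integrandW p m k K x ∂μHE[n - 1]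

/-- The `L_p`-Steiner quermassintegral `V^p_k(K)`. -/
def V {n : ℕ} (p : ℝ) (k : ℕ) (K : ConvexBody (EuclideanSpace ℝ (Fin n))) : ℝ :=
  ∑ m ∈ Finset.range (k + 1),
    Ring.choose ((n : ℝ) * (1 - p) / (n + p)) (k - m) * W p m k K

/-- The convex bodies with the origin in their interior for which `V^p_k` is well defined: all the
integrals that enter its definition converge absolutely. -/
def domainV (n : ℕ) (p : ℝ) (k : ℕ) : Set (ConvexBody (EuclideanSpace ℝ (Fin n))) :=
  {K | 0 ∈ interior (K : Set (EuclideanSpace ℝ (Fin n))) ∧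
    ∀ m ≤ k, IntegrableOn (integrandW p m k K)
      (frontier (K : Set (EuclideanSpace ℝ (Fin n)))) μHE[n - 1]}

/-- Polytopes: convex bodies that are intersections of finitely many closed half-spaces. -/
def IsPolytope {n : ℕ} (K : ConvexBody (EuclideanSpace ℝ (Fin n))) : Prop :=
  ∃ s : Finset (EuclideanSpace ℝ (Fin n) × ℝ),
    (K : Set (EuclideanSpace ℝ (Fin n))) = {x | ∀ q ∈ s, inner ℝ q.1 x ≤ q.2}

/-- The Euclidean unit ball `B^n_2`. -/
def unitBall (n : ℕ) : ConvexBody (EuclideanSpace ℝ (Fin n)) where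
  carrier := Metric.closedBall 0 1
  convex' := convex_closedBall 0 1
  isCompact' := isCompact_closedBall 0 1
  nonempty' := ⟨0, by simp⟩

/-- The cube `B^n_∞`. -/
def cube (n : ℕ) : ConvexBody (EuclideanSpace ℝ (Fin n)) where
  carrier := {x | ∀ i, |x i| ≤ 1}
  convex' := by
    intro x hx y hy a b ha hb hab i
    have h1 := abs_le.1 (hx i)
    have h2 := abs_le.1 (hy i)
    simp only [PiLp.add_apply, PiLp.smul_apply, smul_eq_mul]
    rw [abs_le]
    constructor <;> nlinarith
  isCompact' := by
    refine Metric.isCompact_of_isClosed_isBounded ?_ ?_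
    · have : {x : EuclideanSpace ℝ (Fin n) | ∀ i, |x i| ≤ 1} = ⋂ i, {x | |x i| ≤ 1} := by
        ext x; simp
      rw [this]
      exact isClosed_iInter fun i => isClosed_le (by fun_prop) continuous_const
    · refine (Metric.isBounded_iff_subset_closedBall 0).2 ⟨√n, fun x hx => ?_⟩
      rw [mem_closedBall_zero_iff, EuclideanSpace.norm_eq]
      refine Real.sqrt_le_sqrt ?_
      calc ∑ i, ‖x i‖ ^ 2 ≤ ∑ _i : Fin n, (1 : ℝ) := Finset.sum_le_sum fun i _ => by
            rw [Real.norm_eq_abs]; exact pow_le_one₀ (abs_nonneg _) (hx i)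
        _ = n := by simp
  nonempty' := ⟨0, by simp⟩

/-- The rounded cube `K_l = (1 - 1/l) B^n_∞ + (1/l) B^n_2`. -/
def roundedCube (n l : ℕ) : ConvexBody (EuclideanSpace ℝ (Fin n)) :=
  (1 - 1 / (l : ℝ)) • cube n + (1 / (l : ℝ)) • unitBall n

/-- The part `S^{n-1}_+` of the unit sphere in the positive orthant. -/
def positiveSphere (n : ℕ) : Set (EuclideanSpace ℝ (Fin n)) :=
  {ξ | ‖ξ‖ = 1 ∧ ∀ i, 0 ≤ ξ i}

/-- `F_m(p)`, the sum over `i_1 + 2 i_2 + … + (n-1) i_{n-1} = m` of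
`c(n,p,i) ∏ j, binom(n-1,j) ^ i_j`. -/
def F (n : ℕ) (p : ℝ) (m : ℕ) : ℝ :=
  ∑ i ∈ indices n m, c n p i * ∏ j : Fin (n - 1), ((n - 1).choose ((j : ℕ) + 1) : ℝ) ^ i j

/-- The expression
`2^n ∑ m ≤ k, l^(m - n(n-1)/(n+p)) binom(n(1-p)/(n+p), k-m) F_m(p) ∫_{S_+} (∑ ξ_i)^(m-k+n(1-p)/(n+p))`
that describes the behaviour of `V^p_k(K_l)` as `l → ∞`. -/
def cubeAsymptotics (n : ℕ) (p : ℝ) (k l : ℕ) : ℝ :=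
  2 ^ n * ∑ m ∈ Finset.range (k + 1),
    (l : ℝ) ^ ((m : ℝ) - n * (n - 1) / (n + p))
      * Ring.choose ((n : ℝ) * (1 - p) / (n + p)) (k - m) * F n p m
      * ∫ ξ in positiveSphere n, (∑ i, ξ i) ^ ((m : ℝ) - k + n * (1 - p) / (n + p)) ∂μHE[n - 1]

end LpSteiner

end

namespace LpSteiner

/-! ### Binomial identities behind the coefficients `F`. -/

section Algebra

/-! The integrand of `W` depends only on the support height and the principal curvatures, so every
claim reduces to bodies whose curvatures are explicit: polytopes, the ball, rounded cubes, and a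
cylinder with its roundings. Since `principalCurvature` is defined by choice, such curvatures must
first be shown to be forced: on the tangent hyperplane the quadratic form of the second order
expansion is a limit along boundary curves (`HasExpansion.unique`), and this determines the
curvatures when all but at most one of them agree (`exists_principalCurvature_eq`).

Almost every boundary point of a polytope lies inside a facet, where all curvatures vanish. The
integrand is then zero unless `p = 0` and `m = 0`. On the unit ball the integrand is the constant
`F_m(p)`. The generating function `(1 + t)^(n(n-1)/(n+p))` gives `F_m(p) = binom(n(n-1)/(n+p), m)`,
and Vandermonde's identity sums these values.

Semicontinuity for `p ≠ 0`: `V` vanishes on polytopes, and also on the cylinder, whose Gauss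
curvature is zero almost everywhere and enters with a positive exponent. Rounding the cylinder at
scale `r` creates a rim with one curvature `1/r` and the others bounded. The highest power of `1/r`
in the density carries the nonzero coefficient `binom(n/(n+p), k)`, so the density has a fixed sign
and size at least `C/r` on a piece of area comparable to `r`. Hence `V` of the rounded cylinders
stays away from `0`, with a fixed sign. This violates one semicontinuity at the cylinder, and
polytopes converging to a single rounded cylinder violate the other.

For `p = 0` the density is `h e_k + e_{k-1}`, with `h` the support height and `e_j` the elementary
symmetric functions of the curvatures; it is nonnegative on these bodies. The same rim violates
upper semicontinuity at the cylinder. Lower semicontinuity fails at the ball, where `V` is `binom(n,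
k)` times the area, while on approximating polytopes it is `0` or the surface area. If `k > n`, both
`e_k` and `e_{k-1}` are zero.

For rounded cubes and `p ≠ 0` only the `2^n` spherical corners contribute, since through every other
boundary point passes a boundary segment. Scaling turns `V` into a sum of powers of `l` with
convergent coefficients, whose limit is decided by the last nonzero coefficient
(`exists_tendsto_powerSum`). -/

theorem choose_eq_prod (a : ℝ) (k : ℕ) :
    Ring.choose a k = (k.factorial : ℝ)⁻¹ * ∏ j ∈ Finset.range k, (a - j) := by
  rw [Ring.choose_eq_smul, smul_eq_mul, ← descPochhammer_eval_eq_prod_range, ← descPochhammer_map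
    (Int.castRingHom ℝ), Polynomial.eval_map, ← Polynomial.eval₂_smulOneHom_eq_smeval]
  congr 2
  exact Subsingleton.elim _ _

theorem choose_ne_zero {a : ℝ} {k : ℕ} (h : ∀ j < k, a ≠ j) : Ring.choose a k ≠ 0 := by
  rw [choose_eq_prod]
  refine mul_ne_zero (by positivity) (Finset.prod_ne_zero_iff.2 fun j hj => ?_)
  exact sub_ne_zero.2 (h j (Finset.mem_range.1 hj))

theorem neg_one_pow_mul_choose_pos {a : ℝ} (ha : a < 0) (k : ℕ) :
    0 < (-1) ^ k * Ring.choose a k := by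
  have h : (-1 : ℝ) ^ k = ∏ _j ∈ Finset.range k, (-1 : ℝ) := by simp
  rw [choose_eq_prod, mul_left_comm, h, ← Finset.prod_mul_distrib]
  refine mul_pos (by positivity) (Finset.prod_pos fun j _ => ?_)
  have : (0 : ℝ) ≤ j := j.cast_nonneg
  linarith

theorem choose_natCast_real (N k : ℕ) : Ring.choose (N : ℝ) k = (N.choose k : ℝ) :=
  Ring.choose_natCast N k

/-- The polynomial `x ↦ binom(x, k)`. -/
noncomputable def choosePoly (k : ℕ) : Polynomial ℝ :=
  Polynomial.C ((k.factorial : ℝ)⁻¹) * ∏ j ∈ Finset.range k, (Polynomial.X - Polynomial.C (j : ℝ))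

theorem eval_choosePoly (a : ℝ) (k : ℕ) : (choosePoly k).eval a = Ring.choose a k := by
  rw [choose_eq_prod, choosePoly, Polynomial.eval_mul, Polynomial.eval_C, Polynomial.eval_prod]
  simp

theorem mem_indices {n m : ℕ} {i : Fin (n - 1) → ℕ} :
    i ∈ indices n m ↔ ∑ j : Fin (n - 1), ((j : ℕ) + 1) * i j = m := by
  simp only [indices, Finset.mem_filter, Fintype.mem_piFinset, Finset.mem_range,
    and_iff_right_iff_imp]
  intro h j
  have h1 : ((j : ℕ) + 1) * i j ≤ m := h ▸ Finset.single_le_sum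
    (f := fun j : Fin (n - 1) => ((j : ℕ) + 1) * i j) (fun _ _ => Nat.zero_le _) (Finset.mem_univ j)
  nlinarith [Nat.zero_le (i j), Nat.zero_le (j : ℕ)]

theorem sum_le_of_mem_indices {n m : ℕ} {i : Fin (n - 1) → ℕ} (h : i ∈ indices n m) :
    ∑ j, i j ≤ m := by
  rw [← mem_indices.1 h]
  exact Finset.sum_le_sum fun j _ => by nlinarith [Nat.zero_le (i j), Nat.zero_le (j : ℕ)]

/-- The sum `∑ binom(a, |i|) multinomial(i) ∏ e_j ^ i_j` over the sequences `i` of weight `m`: the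
coefficient of `t ^ m` in `(1 + ∑ j, e_j t ^ j) ^ a`. -/
noncomputable def powCoeff (n m : ℕ) (a : ℝ) (e : ℕ → ℝ) : ℝ :=
  ∑ i ∈ indices n m, Ring.choose a (∑ j, i j) * (Nat.multinomial Finset.univ i : ℝ) *
    ∏ j : Fin (n - 1), e ((j : ℕ) + 1) ^ i j

/-- For natural exponents this is the binomial followed by the multinomial expansion. Real exponents
are reached from here, because the identity needed for them is polynomial in the exponent. -/
theorem powCoeff_natCast (n m N : ℕ) (e : ℕ → ℝ) :
    powCoeff n m N e = ((1 + ∑ j : Fin (n - 1), Polynomial.C (e ((j : ℕ) + 1)) *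
      Polynomial.X ^ ((j : ℕ) + 1)) ^ N).coeff m := by
  classical
  have h1 : ∀ q : ℕ, ((∑ j : Fin (n - 1), Polynomial.C (e ((j : ℕ) + 1)) *
      Polynomial.X ^ ((j : ℕ) + 1)) ^ q).coeff m = ∑ i ∈ (indices n m).filter (fun i => ∑ j, i j = q),
      (Nat.multinomial Finset.univ i : ℝ) * ∏ j : Fin (n - 1), e ((j : ℕ) + 1) ^ i j := by
    intro q
    rw [Finset.sum_pow_eq_sum_piAntidiag, Polynomial.finsetSum_coeff]
    have h2 : ∀ i : Fin (n - 1) → ℕ, ((Nat.multinomial Finset.univ i : Polynomial ℝ) *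
        ∏ j : Fin (n - 1), (Polynomial.C (e ((j : ℕ) + 1)) * Polynomial.X ^ ((j : ℕ) + 1)) ^ i j).coeff m
        = if ∑ j : Fin (n - 1), ((j : ℕ) + 1) * i j = m then
          (Nat.multinomial Finset.univ i : ℝ) * ∏ j : Fin (n - 1), e ((j : ℕ) + 1) ^ i j else 0 := by
      intro i
      simp only [mul_pow, Finset.prod_mul_distrib, ← pow_mul, Finset.prod_pow_eq_pow_sum,
        ← Polynomial.C_pow]
      rw [← map_prod, ← Polynomial.C_eq_natCast, ← mul_assoc, ← Polynomial.C_mul,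
        Polynomial.coeff_C_mul_X_pow]
      simp [eq_comm]
    rw [Finset.sum_congr rfl fun i _ => h2 i, ← Finset.sum_filter]
    refine Finset.sum_congr ?_ fun _ _ => rfl
    ext i
    simp [mem_indices, and_comm]
  rw [add_comm, add_pow, Polynomial.finsetSum_coeff]
  simp only [one_pow, mul_one]
  have h3 : ∀ q : ℕ, ((∑ j : Fin (n - 1), Polynomial.C (e ((j : ℕ) + 1)) *
      Polynomial.X ^ ((j : ℕ) + 1)) ^ q * (N.choose q : Polynomial ℝ)).coeff m =
      ∑ i ∈ (indices n m).filter (fun i => ∑ j, i j = q), Ring.choose (N : ℝ) (∑ j, i j) *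
        (Nat.multinomial Finset.univ i : ℝ) * ∏ j : Fin (n - 1), e ((j : ℕ) + 1) ^ i j := by
    intro q
    rw [← Polynomial.C_eq_natCast, Polynomial.coeff_mul_C, h1, Finset.sum_mul]
    refine Finset.sum_congr rfl fun i hi => ?_
    rw [(Finset.mem_filter.1 hi).2, choose_natCast_real]
    ring
  rw [Finset.sum_congr rfl fun q _ => h3 q, powCoeff]
  -- The weight condition also allows `∑ i_j > N`, but there the binomial coefficient vanishes.
  have h4 : ∑ i ∈ indices n m, Ring.choose (N : ℝ) (∑ j, i j) *
      (Nat.multinomial Finset.univ i : ℝ) * ∏ j : Fin (n - 1), e ((j : ℕ) + 1) ^ i j =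
      ∑ i ∈ (indices n m).filter (fun i => ∑ j, i j ∈ Finset.range (N + 1)),
        Ring.choose (N : ℝ) (∑ j, i j) *
      (Nat.multinomial Finset.univ i : ℝ) * ∏ j : Fin (n - 1), e ((j : ℕ) + 1) ^ i j := by
    rw [Finset.sum_filter]
    refine Finset.sum_congr rfl fun i _ => ?_
    split_ifs with h
    · rfl
    · rw [choose_natCast_real, Nat.choose_eq_zero_of_lt (by simpa using h)]
      simp
  rw [h4, ← Finset.sum_fiberwise_of_maps_to (s := (indices n m).filter
    (fun i => ∑ j, i j ∈ Finset.range (N + 1))) (t := Finset.range (N + 1)) (g := fun i => ∑ j, i j)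
    (fun i hi => (Finset.mem_filter.1 hi).2)]
  refine Finset.sum_congr rfl fun q hq => ?_
  rw [Finset.filter_filter]
  refine Finset.sum_congr ?_ fun _ _ => rfl
  ext i
  simp only [Finset.mem_filter]
  constructor
  · rintro ⟨h, -, h'⟩; exact ⟨h, h'⟩
  · rintro ⟨h, h'⟩; exact ⟨h, h' ▸ hq, h'⟩

theorem one_add_sum_choose_mul_pow (d : ℕ) :
    (1 + ∑ j : Fin d, Polynomial.C ((d.choose ((j : ℕ) + 1) : ℝ)) *
      Polynomial.X ^ ((j : ℕ) + 1)) = (1 + Polynomial.X : Polynomial ℝ) ^ d := by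
  rw [add_comm 1 Polynomial.X, add_pow, Finset.sum_range_succ',
    Fin.sum_univ_eq_sum_range (fun j => Polynomial.C ((d.choose (j + 1) : ℝ)) *
      (Polynomial.X : Polynomial ℝ) ^ (j + 1)) d, add_comm]
  simp [mul_comm]

/-- Both sides are polynomials in `a`, and at a natural number `N` both are the coefficient of `t^m`
in `(1 + t)^((n-1)N)`. -/
theorem powCoeff_choose (n m : ℕ) (a : ℝ) :
    powCoeff n m a (fun j => ((n - 1).choose j : ℝ)) = Ring.choose (((n - 1 : ℕ) : ℝ) * a) m := by
  have key : (∑ i ∈ indices n m, choosePoly (∑ j, i j) * Polynomial.C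
      ((Nat.multinomial Finset.univ i : ℝ) *
      ∏ j : Fin (n - 1), ((n - 1).choose ((j : ℕ) + 1) : ℝ) ^ i j)) =
      (choosePoly m).comp (Polynomial.C ((n - 1 : ℕ) : ℝ) * Polynomial.X) := by
    refine Polynomial.eq_of_infinite_eval_eq _ _
      (Set.Infinite.mono (s := Set.range (fun N : ℕ => (N : ℝ))) ?_
        (Set.infinite_range_of_injective Nat.cast_injective))
    rintro _ ⟨N, rfl⟩
    have h := powCoeff_natCast n m N (fun j => ((n - 1).choose j : ℝ))
    rw [one_add_sum_choose_mul_pow, ← pow_mul, Polynomial.coeff_one_add_X_pow,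
      ← choose_natCast_real] at h
    simp only [Set.mem_ofPred_eq, Polynomial.eval_finsetSum, Polynomial.eval_mul, Polynomial.eval_C,
      eval_choosePoly, Polynomial.eval_comp, Polynomial.eval_X]
    rw [← Nat.cast_mul, ← h, powCoeff]
    exact Finset.sum_congr rfl fun i _ => by ring
  have h := congrArg (Polynomial.eval a) key
  simp only [Polynomial.eval_finsetSum, Polynomial.eval_mul, Polynomial.eval_C,
      eval_choosePoly, Polynomial.eval_comp, Polynomial.eval_X] at h
  rw [← h, powCoeff]
  exact Finset.sum_congr rfl fun i _ => by ring

theorem F_eq_choose {n : ℕ} (hn : 1 ≤ n) (p : ℝ) (m : ℕ) :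
    F n p m = Ring.choose ((n : ℝ) * (n - 1) / (n + p)) m := by
  have h := powCoeff_choose n m ((n : ℝ) / (n + p))
  rw [Nat.cast_sub hn, Nat.cast_one, show ((n : ℝ) - 1) * (n / (n + p)) = n * (n - 1) / (n + p) by
    ring] at h
  rw [← h]
  rfl

/-- Vandermonde's identity for the upper entries `n(n-1)/(n+p)` and `n(1-p)/(n+p)`. The sum is the
constant density of `V` on the unit sphere. -/
theorem sum_choose_mul_F {n : ℕ} (hn : 1 ≤ n) (p : ℝ) (k : ℕ) :
    ∑ m ∈ Finset.range (k + 1), Ring.choose ((n : ℝ) * (1 - p) / (n + p)) (k - m) * F n p m =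
      Ring.choose ((n : ℝ) * (n - p) / (n + p)) k := by
  have h := Ring.add_choose_eq k (Commute.all ((n : ℝ) * (n - 1) / (n + p))
    ((n : ℝ) * (1 - p) / (n + p)))
  rw [Finset.Nat.sum_antidiagonal_eq_sum_range_succ_mk] at h
  rw [show (n : ℝ) * (n - p) / (n + p) = n * (n - 1) / (n + p) + n * (1 - p) / (n + p) by ring, h]
  exact Finset.sum_congr rfl fun m _ => by rw [F_eq_choose hn, mul_comm]

/-- Every admissible index has weight `m`, so each monomial acquires the same factor. This is how
the radius of a spherical boundary piece enters. -/
theorem powCoeff_smul (n m : ℕ) (a r : ℝ) (e : ℕ → ℝ) :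
    powCoeff n m a (fun j => r ^ j * e j) = r ^ m * powCoeff n m a e := by
  rw [powCoeff, powCoeff, Finset.mul_sum]
  refine Finset.sum_congr rfl fun i hi => ?_
  simp only [mul_pow, Finset.prod_mul_distrib, ← pow_mul]
  rw [Finset.prod_pow_eq_pow_sum, mem_indices.1 hi]
  ring

theorem powCoeff_congr {n m : ℕ} {a : ℝ} {e e' : ℕ → ℝ}
    (h : ∀ j, 1 ≤ j → j ≤ n - 1 → e j = e' j) : powCoeff n m a e = powCoeff n m a e' := by
  refine Finset.sum_congr rfl fun i _ => ?_
  congr 1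
  refine Finset.prod_congr rfl fun j _ => ?_
  rw [h _ (by omega) (by omega)]

/-- For `a = 1` only the sequences with at most one entry contribute. -/
theorem powCoeff_one (n m : ℕ) (e : ℕ → ℝ) :
    powCoeff n m 1 e = if m = 0 then 1 else if m ≤ n - 1 then e m else 0 := by
  have h := powCoeff_natCast n m 1 e
  rw [Nat.cast_one] at h
  rw [h, pow_one, Polynomial.coeff_add, Polynomial.coeff_one, Polynomial.finsetSum_coeff]
  simp only [Polynomial.coeff_C_mul, Polynomial.coeff_X_pow, mul_ite, mul_one, mul_zero]
  rcases m with _ | m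
  · simp
  · simp only [Nat.add_right_cancel_iff, Nat.add_eq_zero_iff, one_ne_zero, and_false, if_false,
      zero_add]
    split_ifs with hm
    · rw [Finset.sum_eq_single (⟨m, by omega⟩ : Fin (n - 1))]
      · simp
      · intro j _ hj
        rw [if_neg]
        rintro rfl
        exact hj rfl
      · simp
    · refine Finset.sum_eq_zero fun j _ => ?_
      rw [if_neg]
      have := j.2
      omega

theorem powCoeff_zero_right (n m : ℕ) (a : ℝ) :
    powCoeff n m a (fun _ => 0) = if m = 0 then 1 else 0 := by
  have h := powCoeff_smul n m a 0 (fun _ => 0)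
  rcases m with _ | m
  · have : indices n 0 = {0} := by
      ext i
      simp [mem_indices, funext_iff]
    simp [powCoeff, this, Nat.multinomial]
  -- Written as `0 ^ j * 0`, the zero sequence is a scaling with ratio `0`, and `0 ^ (m + 1) = 0`.
  · rw [powCoeff_congr (e' := fun j => 0 ^ j * 0) (fun j _ _ => by simp), h]
    simp

end Algebra
end LpSteiner

/-! ### Supporting hyperplanes and outer unit normals. -/

namespace LpSteiner

abbrev Euc (n : ℕ) := EuclideanSpace ℝ (Fin n)

/-- Otherwise the interior and the exterior of `s` would disconnect `T`. Applied to segments to find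
where they leave a body. -/
theorem exists_mem_frontier_of_isPreconnected {X : Type*} [TopologicalSpace X] {T s : Set X}
    (hT : IsPreconnected T) {a b : X} (ha : a ∈ T) (has : a ∈ s) (hb : b ∈ T) (hbs : b ∉ s) :
    ∃ z ∈ T, z ∈ frontier s := by
  by_contra! h
  have hcov : T ⊆ interior s ∪ (closure s)ᶜ := fun z hz => by
    by_contra hz'
    simp only [Set.mem_union, Set.mem_compl_iff, not_or, not_not] at hz'
    exact h z hz ⟨hz'.2, hz'.1⟩
  obtain ⟨z, -, hz1, hz2⟩ := hT _ _ isOpen_interior isClosed_closure.isOpen_compl hcov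
    ⟨a, ha, (hcov ha).resolve_right fun h' => h' (subset_closure has)⟩
    ⟨b, hb, (hcov hb).resolve_left fun h' => hbs (interior_subset h')⟩
  exact hz2 (subset_closure (interior_subset hz1))

section Normals

variable {n : ℕ} {K : ConvexBody (Euc n)} {x u : Euc n}

theorem mem_of_mem_frontier (hx : x ∈ frontier (K : Set (Euc n))) : x ∈ K :=
  K.isClosed.frontier_subset hx

/-- Hahn–Banach separates `x` from the interior, and the inequality passes to `K` because `K` lies
in the closure of its interior. -/
theorem exists_isOuterUnitNormal (hK : (interior (K : Set (Euc n))).Nonempty)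
    (hx : x ∈ frontier (K : Set (Euc n))) : ∃ u, IsOuterUnitNormal K x u := by
  obtain ⟨f, hf⟩ := geometric_hahn_banach_open_point K.convex.interior isOpen_interior hx.2
  set g := (InnerProductSpace.toDual ℝ (Euc n)).symm f with hg
  have hfg : ∀ y, f y = inner ℝ g y := fun y => by simp [hg]
  have hle : ∀ y ∈ K, inner ℝ g y ≤ inner ℝ g x := by
    intro y hy
    have hy' : y ∈ closure (interior (K : Set (Euc n))) := by
      rw [K.convex.closure_interior_eq_closure_of_nonempty_interior hK]
      exact subset_closure hy
    refine closure_minimal (t := {y | inner ℝ g y ≤ inner ℝ g x}) ?_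
      (isClosed_le (by fun_prop) continuous_const) hy'
    intro z hz
    have := hf z hz
    rw [hfg, hfg] at this
    exact this.le
  have hg0 : g ≠ 0 := by
    rintro h0
    obtain ⟨z, hz⟩ := hK
    have := hf z hz
    rw [hfg, hfg, h0] at this
    simp at this
  refine ⟨‖g‖⁻¹ • g, ?_, fun y hy => ?_⟩
  · rw [norm_smul, norm_inv, norm_norm, inv_mul_cancel₀ (norm_ne_zero_iff.2 hg0)]
  · rw [inner_smul_right, inner_sub_left, real_inner_comm, real_inner_comm g x]
    exact mul_nonpos_of_nonneg_of_nonpos (by positivity) (sub_nonpos.2 (hle y hy))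

theorem isOuterUnitNormal_outerNormal (hK : (interior (K : Set (Euc n))).Nonempty)
    (hx : x ∈ frontier (K : Set (Euc n))) : IsOuterUnitNormal K x (outerNormal K x) := by
  have h := exists_isOuterUnitNormal hK hx
  rw [outerNormal, dif_pos h]
  exact h.choose_spec

theorem outerNormal_eq (hu : IsOuterUnitNormal K x u)
    (huniq : ∀ w, IsOuterUnitNormal K x w → w = u) : outerNormal K x = u := by
  have h : ∃ u, IsOuterUnitNormal K x u := ⟨u, hu⟩
  rw [outerNormal, dif_pos h]
  exact huniq _ h.choose_spec

theorem IsOuterUnitNormal.inner_lt (hu : IsOuterUnitNormal K x u) {z : Euc n}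
    (hz : z ∈ interior (K : Set (Euc n))) : inner ℝ (z - x) u < 0 := by
  obtain ⟨ρ, hρ, hb⟩ := Metric.isOpen_iff.1 isOpen_interior z hz
  have hmem : z + (ρ / 2) • u ∈ Metric.ball z ρ := by
    rw [mem_ball_iff_norm, add_sub_cancel_left, norm_smul, hu.1, Real.norm_of_nonneg (by positivity)]
    linarith
  have h := hu.2 _ (interior_subset (hb hmem))
  rw [add_sub_right_comm, inner_add_left, real_inner_smul_left, real_inner_self_eq_norm_sq, hu.1] at h
  linarith

theorem IsOuterUnitNormal.mem_frontier (hu : IsOuterUnitNormal K x u) {y : Euc n}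
    (hy : y ∈ K) (hxy : inner ℝ (y - x) u = 0) : y ∈ frontier (K : Set (Euc n)) := by
  refine ⟨subset_closure hy, fun h => ?_⟩
  exact (hu.inner_lt h).ne hxy

end Normals

/-! ### Uniqueness and sign of the second order expansion of the boundary. -/

section Expansion

variable {n : ℕ} {K : ConvexBody (Euc n)} {x N : Euc n}

/-- The boundary of `K` has at `x` the second order expansion
`⟨x - y, N⟩ = (1/2) Q (y - x) + o(‖y - x‖ ^ 2)`. -/
def HasExpansion (K : ConvexBody (Euc n)) (x N : Euc n) (Q : Euc n → ℝ) : Prop :=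
  (fun y => inner ℝ (x - y) N - (1 / 2 : ℝ) * Q (y - x))
      =o[𝓝[frontier (K : Set (Euc n))] x] (fun y => ‖y - x‖ ^ 2)

/-- The point `x + t w` may lie outside `K`, so it is corrected inward along `D`, which points from
`x` to the centre of a ball inside `K`. By convexity a correction of size at most `C t` reaches the
boundary. -/
theorem exists_frontier_near (hK : (interior (K : Set (Euc n))).Nonempty)
    (hx : x ∈ K) (hN : IsOuterUnitNormal K x N) {w : Euc n}
    (hw : inner ℝ w N = 0) : ∃ D : Euc n, ∃ C > 0, inner ℝ D N < 0 ∧ ∀ᶠ t in 𝓝[>] (0 : ℝ),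
      ∃ s, 0 ≤ s ∧ s ≤ C * t ∧ x + (t • w + s • D) ∈ frontier (K : Set (Euc n)) := by
  obtain ⟨z, hz⟩ := hK
  obtain ⟨ρ, hρ, hb⟩ := Metric.isOpen_iff.1 isOpen_interior z hz
  have hC : 0 < (‖w‖ + 1) / ρ := by positivity
  refine ⟨z - x, (‖w‖ + 1) / ρ, hC, hN.inner_lt hz, ?_⟩
  set C := (‖w‖ + 1) / ρ with hCdef
  filter_upwards [Ioo_mem_nhdsGT (show (0 : ℝ) < C⁻¹ by positivity)] with t ht
  have ht1 : C * t ≤ 1 := by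
    have := mul_lt_mul_of_pos_left ht.2 hC
    rw [mul_inv_cancel₀ hC.ne'] at this
    exact this.le
  -- This is the convex combination, with weight `C * t`, of `x` and the point `z + C⁻¹ • w` of the
  -- inner ball.
  have hend : x + (t • w + (C * t) • (z - x)) ∈ K := by
    have h1 : z + C⁻¹ • w ∈ K := by
      refine interior_subset (hb ?_)
      rw [mem_ball_iff_norm, add_sub_cancel_left, norm_smul, norm_inv, Real.norm_of_nonneg hC.le,
        hCdef, inv_div, div_mul_eq_mul_div, div_lt_iff₀ (by positivity)]
      nlinarith [norm_nonneg w]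
    have h2 := K.convex hx h1 (sub_nonneg.2 ht1) (mul_nonneg hC.le ht.1.le) (by ring)
    refine (congrArg (· ∈ (K : Set (Euc n))) ?_).mp h2
    rw [smul_add, smul_smul, show C * t * C⁻¹ = t by field_simp]
    module
  by_cases h0 : x + t • w ∈ K
  · refine ⟨0, le_rfl, mul_nonneg hC.le ht.1.le, ?_⟩
    rw [zero_smul, add_zero]
    refine hN.mem_frontier h0 ?_
    rw [add_sub_cancel_left, real_inner_smul_left, hw, mul_zero]
  · have hcont : Continuous fun s : ℝ => x + (t • w + s • (z - x)) := by fun_prop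
    have hpre := (isPreconnected_Icc (a := (0 : ℝ)) (b := C * t)).image _ hcont.continuousOn
    obtain ⟨_, ⟨s, hs, rfl⟩, hfr⟩ := exists_mem_frontier_of_isPreconnected
      (s := (K : Set (Euc n))) hpre
      ⟨C * t, ⟨mul_nonneg hC.le ht.1.le, le_rfl⟩, rfl⟩ hend
      ⟨0, ⟨le_rfl, mul_nonneg hC.le ht.1.le⟩, rfl⟩ (by simpa using h0)
    exact ⟨s, hs.1, hs.2, hfr⟩

/-- Continuous functions that are homogeneous of degree `2`. -/
structure IsQuad (Q : Euc n → ℝ) : Prop where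
  continuous : Continuous Q
  smul : ∀ (t : ℝ) (d : Euc n), Q (t • d) = t ^ 2 * Q d

/-- The inward correction is a priori only `O(t)`. The expansion bounds the depth of a boundary
point below the tangent hyperplane by a multiple of the squared distance, which improves the
correction to `O(t²)`, so the curve is tangent to `w`. -/
theorem exists_tangent_curve (hK : (interior (K : Set (Euc n))).Nonempty)
    (hx : x ∈ K) (hN : IsOuterUnitNormal K x N) {Q : Euc n → ℝ} (hQ : IsQuad Q)
    (hexp : HasExpansion K x N Q) {w : Euc n} (hw : inner ℝ w N = 0) :
    ∃ d : ℝ → Euc n, Tendsto (fun t => x + d t) (𝓝[>] 0) (𝓝[frontier (K : Set (Euc n))] x) ∧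
      Tendsto (fun t => t⁻¹ • d t) (𝓝[>] 0) (𝓝 w) := by
  obtain ⟨D, C, hC, hD, hev⟩ := exists_frontier_near hK hx hN hw
  choose! s hs0 hsC hsF using fun t (ht : ∃ s, 0 ≤ s ∧ s ≤ C * t ∧
    x + (t • w + s • D) ∈ frontier (K : Set (Euc n))) => ht
  have hpos : ∀ᶠ t in 𝓝[>] (0 : ℝ), 0 < t := eventually_mem_nhdsWithin
  have hid : Tendsto (fun t : ℝ => t) (𝓝[>] 0) (𝓝 0) := tendsto_nhdsWithin_of_tendsto_nhds tendsto_id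
  have hs_lim : Tendsto s (𝓝[>] 0) (𝓝 0) := by
    refine tendsto_of_tendsto_of_tendsto_of_le_of_le' tendsto_const_nhds
      (by simpa using hid.const_mul C) (hev.mono fun t ht => hs0 t ht)
      (hev.mono fun t ht => hsC t ht)
  have hlim : Tendsto (fun t => x + (t • w + s t • D)) (𝓝[>] 0)
      (𝓝[frontier (K : Set (Euc n))] x) := by
    refine tendsto_nhdsWithin_iff.2 ⟨?_, hev.mono fun t ht => hsF t ht⟩
    have := tendsto_const_nhds (x := x) |>.add ((hid.smul_const w).add (hs_lim.smul_const D))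
    simpa using this
  refine ⟨fun t => t • w + s t • D, hlim, ?_⟩
  -- the relative height `s t / t` tends to `0`
  obtain ⟨B, hB⟩ : ∃ B, ∀ y ∈ Metric.closedBall (0 : Euc n) (‖w‖ + C * ‖D‖), |Q y| ≤ B := by
    obtain ⟨B, hB⟩ := ((isCompact_closedBall (0 : Euc n) (‖w‖ + C * ‖D‖)).image
      hQ.continuous.abs).bddAbove
    exact ⟨B, fun y hy => hB ⟨y, hy, rfl⟩⟩
  set M := ‖w‖ + C * ‖D‖ with hM
  have hbound : ∀ᶠ t in 𝓝[>] (0 : ℝ), s t * (-inner ℝ D N) ≤ (B / 2 + M ^ 2) * t ^ 2 := by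
    have h1 := hlim.eventually (hexp.bound one_pos)
    filter_upwards [h1, hpos, hev] with t ht htpos hte
    have hd : ‖t⁻¹ • (t • w + s t • D)‖ ≤ M := by
      rw [smul_add, smul_smul, inv_mul_cancel₀ htpos.ne', one_smul, smul_smul]
      refine (norm_add_le _ _).trans (add_le_add_right ?_ _)
      rw [norm_smul, norm_mul, norm_inv, Real.norm_of_nonneg htpos.le,
        Real.norm_of_nonneg (hs0 t hte)]
      refine mul_le_mul_of_nonneg_right ?_ (norm_nonneg _)
      rw [inv_mul_le_iff₀ htpos, mul_comm]
      exact hsC t hte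
    have hQd : Q (t • w + s t • D) ≤ t ^ 2 * B := by
      have h2 : t • w + s t • D = t • (t⁻¹ • (t • w + s t • D)) := by
        rw [smul_smul, mul_inv_cancel₀ htpos.ne', one_smul]
      rw [h2, hQ.smul]
      exact mul_le_mul_of_nonneg_left ((le_abs_self _).trans (hB _ (by simpa using hd)))
        (by positivity)
    have hnorm : ‖t • w + s t • D‖ ≤ M * t := by
      rw [norm_smul, norm_inv, Real.norm_of_nonneg htpos.le, inv_mul_le_iff₀ htpos] at hd
      linarith
    have hin : inner ℝ (x - (x + (t • w + s t • D))) N = s t * (-inner ℝ D N) := by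
      rw [sub_add_cancel_left, inner_neg_left, inner_add_left, real_inner_smul_left,
        real_inner_smul_left, hw]
      ring
    rw [hin, add_sub_cancel_left, one_mul, Real.norm_eq_abs, Real.norm_eq_abs,
      abs_of_nonneg (by positivity : (0 : ℝ) ≤ ‖t • w + s t • D‖ ^ 2)] at ht
    have h3 := (abs_le.1 ht).2
    have h4 : ‖t • w + s t • D‖ ^ 2 ≤ (M * t) ^ 2 := pow_le_pow_left₀ (norm_nonneg _) hnorm 2
    nlinarith
  have hratio : Tendsto (fun t => t⁻¹ * s t) (𝓝[>] 0) (𝓝 0) := by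
    have hup : Tendsto (fun t : ℝ => ((B / 2 + M ^ 2) / (-inner ℝ D N)) * t) (𝓝[>] 0) (𝓝 0) := by
      simpa using hid.const_mul ((B / 2 + M ^ 2) / (-inner ℝ D N))
    refine tendsto_of_tendsto_of_tendsto_of_le_of_le' tendsto_const_nhds hup ?_ ?_
    · filter_upwards [hpos, hev] with t ht hte
      exact mul_nonneg (inv_nonneg.2 ht.le) (hs0 t hte)
    · filter_upwards [hpos, hbound] with t ht hb
      rw [inv_mul_le_iff₀ ht, div_mul_eq_mul_div, mul_div_assoc', le_div_iff₀ (by linarith)]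
      linarith
  have hfin : Tendsto (fun t => w + (t⁻¹ * s t) • D) (𝓝[>] 0) (𝓝 w) := by
    simpa using tendsto_const_nhds (x := w) |>.add (hratio.smul_const D)
  refine hfin.congr' ?_
  filter_upwards [hpos] with t ht
  rw [smul_add, smul_smul, smul_smul, inv_mul_cancel₀ ht.ne', one_smul]

theorem HasExpansion.tendsto_of_curve {Q : Euc n → ℝ} (hQ : IsQuad Q)
    (hexp : HasExpansion K x N Q) {w : Euc n} {d : ℝ → Euc n}
    (hd : Tendsto (fun t => x + d t) (𝓝[>] 0) (𝓝[frontier (K : Set (Euc n))] x))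
    (hdw : Tendsto (fun t => t⁻¹ • d t) (𝓝[>] 0) (𝓝 w)) :
    Tendsto (fun t => (t⁻¹) ^ 2 * inner ℝ (-d t) N) (𝓝[>] 0) (𝓝 (1 / 2 * Q w)) := by
  have h1 := hexp.comp_tendsto hd
  have hpos : ∀ᶠ t in 𝓝[>] (0 : ℝ), 0 < t := eventually_mem_nhdsWithin
  simp only [Function.comp_def, sub_add_cancel_left, add_sub_cancel_left] at h1
  have h2 : Tendsto (fun t => (t⁻¹) ^ 2 * (inner ℝ (-d t) N - 1 / 2 * Q (d t))) (𝓝[>] 0)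
      (𝓝 0) := by
    have h3 : (fun t : ℝ => (t⁻¹) ^ 2 * (inner ℝ (-d t) N - 1 / 2 * Q (d t))) =o[𝓝[>] 0]
        (fun t => (t⁻¹) ^ 2 * ‖d t‖ ^ 2) := (Asymptotics.isBigO_refl _ _).mul_isLittleO h1
    have h4 : (fun t : ℝ => (t⁻¹) ^ 2 * ‖d t‖ ^ 2) =O[𝓝[>] 0] (fun _ => (1 : ℝ)) := by
      have h5 : Tendsto (fun t : ℝ => (t⁻¹) ^ 2 * ‖d t‖ ^ 2) (𝓝[>] 0) (𝓝 (‖w‖ ^ 2)) := by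
        refine (hdw.norm.pow 2).congr fun t => ?_
        rw [norm_smul, mul_pow, norm_inv, Real.norm_eq_abs, inv_pow, sq_abs, inv_pow]
      exact h5.isBigO_one ℝ
    exact (Asymptotics.isLittleO_one_iff ℝ).1 (h3.trans_isBigO h4)
  have h6 : Tendsto (fun t => 1 / 2 * Q (t⁻¹ • d t)) (𝓝[>] 0) (𝓝 (1 / 2 * Q w)) :=
    ((hQ.continuous.tendsto w).comp hdw).const_mul _
  have h7 := h2.add h6
  rw [zero_add] at h7
  refine h7.congr fun t => ?_
  rw [hQ.smul]
  ring

/-- Both values are, up to the factor `1/2`, the limit of the same quotient along one boundary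
curve. Hence any explicit expansion constrains the curvatures selected by choice in
`principalCurvature`. -/
theorem HasExpansion.unique (hK : (interior (K : Set (Euc n))).Nonempty)
    (hx : x ∈ K) (hN : IsOuterUnitNormal K x N) {Q Q' : Euc n → ℝ} (hQ : IsQuad Q)
    (hQ' : IsQuad Q') (h : HasExpansion K x N Q) (h' : HasExpansion K x N Q') {w : Euc n}
    (hw : inner ℝ w N = 0) : Q w = Q' w := by
  obtain ⟨d, h1, h2⟩ := exists_tangent_curve hK hx hN hQ h hw
  have := tendsto_nhds_unique (h.tendsto_of_curve hQ h1 h2) (h'.tendsto_of_curve hQ' h1 h2)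
  linarith

theorem HasExpansion.nonneg (hK : (interior (K : Set (Euc n))).Nonempty)
    (hx : x ∈ K) (hN : IsOuterUnitNormal K x N) {Q : Euc n → ℝ} (hQ : IsQuad Q)
    (h : HasExpansion K x N Q) {w : Euc n} (hw : inner ℝ w N = 0) : 0 ≤ Q w := by
  obtain ⟨d, h1, h2⟩ := exists_tangent_curve hK hx hN hQ h hw
  have h3 := ge_of_tendsto (h.tendsto_of_curve hQ h1 h2) (b := 0) ?_
  · linarith
  filter_upwards [(tendsto_nhdsWithin_iff.1 h1).2] with t ht
  refine mul_nonneg (by positivity) ?_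
  have := hN.2 _ (mem_of_mem_frontier ht)
  rw [add_sub_cancel_left] at this
  rw [inner_neg_left]
  linarith

end Expansion
end LpSteiner

namespace LpSteiner

/-! ### Orthonormal frames adapted to the normal. -/

section Frames

variable {n : ℕ}

theorem exists_frame (hn : 2 ≤ n) {N T : Euc n} (hN : ‖N‖ = 1) (hT : ‖T‖ = 1)
    (hTN : inner ℝ T N = 0) (i₀ : Fin (n - 1)) : ∃ v : Fin (n - 1) → Euc n, Orthonormal ℝ v ∧
      (∀ i, inner ℝ (v i) N = 0) ∧ v i₀ = T := by
  classical
  set v₀ : Option (Fin (n - 1)) → Euc n := fun o => o.elim N fun _ => T with hv₀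
  have hs : Orthonormal ℝ (({none, some i₀} : Set (Option (Fin (n - 1)))).domRestrict v₀) := by
    refine ⟨?_, ?_⟩
    · rintro ⟨i, rfl | rfl⟩
      exacts [hN, hT]
    · rintro ⟨i, rfl | rfl⟩ ⟨j, rfl | rfl⟩ hij
      · simp at hij
      · exact (real_inner_comm _ _).trans hTN
      · exact hTN
      · simp at hij
  obtain ⟨b, hb⟩ := hs.exists_orthonormalBasis_extension_of_card_eq (by simp; omega)
  refine ⟨fun i => b (some i), b.orthonormal.comp _ (Option.some_injective _), fun i => ?_, ?_⟩
  · have h := hb none (by simp)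
    simp only [v₀, Option.elim_none] at h
    rw [← h]
    exact b.orthonormal.2 (by simp)
  · exact hb (some i₀) (by simp)

theorem norm_sq_eq_sum_frame (hn : 1 ≤ n) {N : Euc n} (hN : ‖N‖ = 1) {v : Fin (n - 1) → Euc n}
    (hv : Orthonormal ℝ v) (hvN : ∀ i, inner ℝ (v i) N = 0) (d : Euc n) :
    ‖d‖ ^ 2 = inner ℝ d N ^ 2 + ∑ i, inner ℝ d (v i) ^ 2 := by
  classical
  set v₀ : Option (Fin (n - 1)) → Euc n := fun o => o.elim N v with hv₀
  have ho : Orthonormal ℝ v₀ := by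
    refine ⟨?_, ?_⟩
    · rintro (_ | i)
      · exact hN
      · exact hv.1 i
    · rintro (_ | i) (_ | j) hij
      · simp at hij
      · simpa [v₀, real_inner_comm] using hvN j
      · exact hvN i
      · exact hv.2 (by simpa using hij)
  have hs : Orthonormal ℝ ((Set.univ : Set (Option (Fin (n - 1)))).domRestrict v₀) :=
    ho.comp _ Subtype.val_injective
  obtain ⟨b, hb⟩ := hs.exists_orthonormalBasis_extension_of_card_eq (by simp; omega)
  rw [← b.sum_sq_inner_left d, Fintype.sum_option, hb none trivial]
  congr 1
  refine Finset.sum_congr rfl fun i _ => ?_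
  rw [hb (some i) trivial]
  rfl

theorem inner_sum_frame {v : Fin (n - 1) → Euc n} (hv : Orthonormal ℝ v) (f : Fin (n - 1) → ℝ)
    (i : Fin (n - 1)) : inner ℝ (∑ j, f j • v j) (v i) = f i := by
  rw [hv.inner_left_fintype]
  simp

end Frames

/-! ### Principal curvatures and their elementary symmetric functions. -/

section Curvature

variable {n : ℕ} {K : ConvexBody (Euc n)} {x : Euc n}

/-- The quadratic form with eigenvalues `κ` in the directions `v`. -/
noncomputable def diagForm (κ : Fin (n - 1) → ℝ) (v : Fin (n - 1) → Euc n) (d : Euc n) : ℝ :=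
  ∑ i, κ i * inner ℝ d (v i) ^ 2

/-- The quadratic form with eigenvalue `α` in the direction `T` and `β` in the others. -/
noncomputable def twoForm (α β : ℝ) (T : Euc n) (d : Euc n) : ℝ :=
  α * inner ℝ d T ^ 2 + β * (‖d‖ ^ 2 - inner ℝ d T ^ 2)

theorem isQuad_diagForm (κ : Fin (n - 1) → ℝ) (v : Fin (n - 1) → Euc n) :
    IsQuad (diagForm κ v) where
  continuous := by unfold diagForm; fun_prop
  smul t d := by
    simp only [diagForm, Finset.mul_sum, real_inner_smul_left]
    exact Finset.sum_congr rfl fun i _ => by ring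

theorem hasPrincipalCurvatures_iff {κ : Fin (n - 1) → ℝ} : HasPrincipalCurvatures K x κ ↔
    IsOuterUnitNormal K x (outerNormal K x) ∧ ∃ v : Fin (n - 1) → Euc n,
      Orthonormal ℝ v ∧ (∀ i, inner ℝ (v i) (outerNormal K x) = 0) ∧
      HasExpansion K x (outerNormal K x) (diagForm κ v) := Iff.rfl

theorem hasPrincipalCurvatures_principalCurvature {κ : Fin (n - 1) → ℝ}
    (h : HasPrincipalCurvatures K x κ) : HasPrincipalCurvatures K x (principalCurvature K x) := by
  have h' : ∃ κ, HasPrincipalCurvatures K x κ := ⟨κ, h⟩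
  rw [principalCurvature, dif_pos h']
  exact h'.choose_spec

theorem diagForm_sum {v : Fin (n - 1) → Euc n} (hv : Orthonormal ℝ v) (κ f : Fin (n - 1) → ℝ) :
    diagForm κ v (∑ j, f j • v j) = ∑ i, κ i * f i ^ 2 := by
  simp only [diagForm, inner_sum_frame hv]

/-- Where the boundary contains a segment, one of the principal curvatures vanishes. -/
theorem prod_principalCurvature_eq_zero (hn : 2 ≤ n) (hK : (interior (K : Set (Euc n))).Nonempty)
    (hx : x ∈ K) {y : Euc n} (hy : y ∈ K) (hyx : y ≠ x)
    (hin : inner ℝ (y - x) (outerNormal K x) = 0) : ∏ i, principalCurvature K x i = 0 := by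
  have : Nonempty (Fin (n - 1)) := ⟨⟨0, by omega⟩⟩
  by_cases hex : ∃ κ, HasPrincipalCurvatures K x κ
  swap
  · rw [principalCurvature, dif_neg hex]
    simp only [Pi.zero_apply, Finset.prod_const, Finset.card_univ, Fintype.card_fin]
    exact zero_pow (by omega)
  obtain ⟨κ₀, hκ₀⟩ := hex
  obtain ⟨hN, v, hv, hvN, hexp⟩ := hasPrincipalCurvatures_iff.1
    (hasPrincipalCurvatures_principalCurvature hκ₀)
  set κ := principalCurvature K x
  set N := outerNormal K x
  have hκ : ∀ i, 0 ≤ κ i := by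
    intro i
    have h := hexp.nonneg hK hx hN (isQuad_diagForm κ v) (hvN i)
    rw [diagForm, Finset.sum_eq_single i] at h
    · rwa [real_inner_self_eq_norm_sq, hv.1 i, one_pow, one_pow, mul_one] at h
    · intro j _ hj
      rw [hv.2 hj.symm]
      ring
    · simp
  set w := y - x with hw
  have hw0 : w ≠ 0 := sub_ne_zero.2 hyx
  -- The segment from `x` to `y` lies in the supporting hyperplane, hence in the boundary, and is a
  -- boundary curve of zero depth. So the form vanishes at `w`. As the curvatures are nonnegative,
  -- `w` would be zero if all of them were nonzero.
  have hcurve : Tendsto (fun t : ℝ => x + t • w) (𝓝[>] 0)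
      (𝓝[frontier (K : Set (Euc n))] x) := by
    refine tendsto_nhdsWithin_iff.2 ⟨?_, ?_⟩
    · have h1 : Tendsto (fun t : ℝ => x + t • w) (𝓝 0) (𝓝 (x + (0 : ℝ) • w)) :=
        Continuous.tendsto (by fun_prop) 0
      rw [zero_smul, add_zero] at h1
      exact tendsto_nhdsWithin_of_tendsto_nhds h1
    · filter_upwards [Ioo_mem_nhdsGT (zero_lt_one' ℝ)] with t ht
      refine hN.mem_frontier ?_ ?_
      · have h2 := K.convex hx hy (sub_nonneg.2 ht.2.le) ht.1.le (by ring)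
        refine (congrArg (· ∈ (K : Set (Euc n))) ?_).mp h2
        rw [hw]
        module
      · rw [add_sub_cancel_left, real_inner_smul_left, hin, mul_zero]
  have hlim : Tendsto (fun t : ℝ => t⁻¹ • (t • w)) (𝓝[>] 0) (𝓝 w) := by
    refine tendsto_const_nhds.congr' ?_
    filter_upwards [self_mem_nhdsWithin] with t ht
    rw [smul_smul, inv_mul_cancel₀ (ne_of_gt ht), one_smul]
  have hQ := hexp.tendsto_of_curve (isQuad_diagForm κ v) hcurve hlim
  have hQ0 : diagForm κ v w = 0 := by
    have h0 : Tendsto (fun t : ℝ => (t⁻¹) ^ 2 * inner ℝ (-(t • w)) N) (𝓝[>] 0) (𝓝 0) := by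
      refine tendsto_const_nhds.congr fun t => ?_
      rw [inner_neg_left, real_inner_smul_left, hin]
      ring
    have := tendsto_nhds_unique hQ h0
    linarith
  have hterm := (Finset.sum_eq_zero_iff_of_nonneg fun i _ =>
    mul_nonneg (hκ i) (sq_nonneg (inner ℝ w (v i)))).1 hQ0
  by_contra hprod
  rw [Finset.prod_eq_zero_iff] at hprod
  push Not at hprod
  have hall : ∀ i, inner ℝ w (v i) = 0 := fun i => by
    have := hterm i (Finset.mem_univ i)
    rcases mul_eq_zero.1 this with h | h
    · exact absurd h (hprod i (Finset.mem_univ i))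
    · exact pow_eq_zero_iff (two_ne_zero) |>.1 h
  have := norm_sq_eq_sum_frame (by omega) hN.1 hv hvN w
  simp only [hin, hall] at this
  simp [hw0] at this

/-- Principal curvatures with one of them `α` and the others `β`. -/
theorem exists_principalCurvature_eq (hn : 2 ≤ n) (hK : (interior (K : Set (Euc n))).Nonempty)
    (hx : x ∈ K) {T : Euc n} {α β : ℝ} (hN : IsOuterUnitNormal K x (outerNormal K x))
    (hT : ‖T‖ = 1) (hTN : inner ℝ T (outerNormal K x) = 0)
    (hexp : HasExpansion K x (outerNormal K x) fun d =>
      twoForm α β T d - β * inner ℝ d (outerNormal K x) ^ 2) :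
    ∃ i₀, principalCurvature K x = fun i => if i = i₀ then α else β := by
  classical
  set N := outerNormal K x with hNdef
  -- Subtracting `β ⟨d, N⟩²` removes the normal component of `‖d‖²` from `twoForm`. What remains is
  -- diagonal in any tangent frame containing `T`.
  have key : ∀ (v : Fin (n - 1) → Euc n), Orthonormal ℝ v → (∀ i, inner ℝ (v i) N = 0) →
      ∀ i₀, v i₀ = T → diagForm (fun i => if i = i₀ then α else β) v = fun d =>
      twoForm α β T d - β * inner ℝ d (outerNormal K x) ^ 2 := by
    intro v hv hvN i₀ hi₀
    funext d
    have h1 := norm_sq_eq_sum_frame (by omega) hN.1 hv hvN d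
    rw [twoForm, h1, diagForm, ← Finset.add_sum_erase _ _ (Finset.mem_univ i₀),
      ← Finset.add_sum_erase _ _ (Finset.mem_univ i₀), if_pos rfl, hi₀,
      Finset.sum_congr rfl (g := fun i => β * inner ℝ d (v i) ^ 2), ← Finset.mul_sum]
    · ring
    · intro i hi
      rw [if_neg (Finset.ne_of_mem_erase hi)]
  obtain ⟨v, hv, hvN, hvT⟩ := exists_frame hn hN.1 hT hTN ⟨0, by omega⟩
  have hpc : HasPrincipalCurvatures K x
      (fun i => if i = (⟨0, by omega⟩ : Fin (n - 1)) then α else β) := by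
    refine hasPrincipalCurvatures_iff.2 ⟨hN, v, hv, hvN, ?_⟩
    rw [key v hv hvN _ hvT]
    exact hexp
  obtain ⟨-, v', hv', hv'N, hexp'⟩ := hasPrincipalCurvatures_iff.1
    (hasPrincipalCurvatures_principalCurvature hpc)
  set κ := principalCurvature K x
  have hQ : IsQuad fun d => twoForm α β T d - β * inner ℝ d (outerNormal K x) ^ 2 := by
    rw [← key v hv hvN _ hvT]
    exact isQuad_diagForm _ _
  set τ : Fin (n - 1) → ℝ := fun i => inner ℝ (v' i) T with hτ
  -- Uniqueness of the form, written in the frame `v'` that belongs to the chosen curvatures `κ`;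
  -- `τ` holds the coordinates of `T` there.
  have heq : ∀ f : Fin (n - 1) → ℝ, ∑ i, κ i * f i ^ 2 =
      (α - β) * (∑ i, f i * τ i) ^ 2 + β * ∑ i, f i ^ 2 := by
    intro f
    have hwN : inner ℝ (∑ j, f j • v' j) N = 0 := by
      rw [sum_inner]
      exact Finset.sum_eq_zero fun i _ => by rw [real_inner_smul_left, hv'N, mul_zero]
    have h := hexp'.unique hK hx hN (isQuad_diagForm κ v') hQ hexp hwN
    rw [diagForm_sum hv'] at h
    have h1 := norm_sq_eq_sum_frame (by omega) hN.1 hv' hv'N (∑ j, f j • v' j)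
    simp only [inner_sum_frame hv', hwN] at h1
    rw [h, twoForm, ← hNdef, hwN, h1, sum_inner]
    simp only [real_inner_smul_left]
    ring
  have hτ1 : ∑ i, τ i ^ 2 = 1 := by
    have h1 := norm_sq_eq_sum_frame (by omega) hN.1 hv' hv'N T
    rw [hT, hTN] at h1
    simp only [hτ, real_inner_comm T]
    linarith
  have hdiag : ∀ i, κ i = (α - β) * τ i ^ 2 + β := by
    intro i
    have h := heq (Pi.single i 1)
    simpa [Pi.single_apply, Finset.sum_ite_eq] using h
  -- The form is diagonal in `v'`, so the mixed terms vanish. If `α ≠ β`, the unit vector `T` has a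
  -- single nonzero coordinate, and its index carries `α`.
  have hoff : ∀ i j, i ≠ j → (α - β) * (τ i * τ j) = 0 := by
    intro i j hij
    have h := heq (Pi.single i 1 + Pi.single j 1)
    have e1 : ∀ g : Fin (n - 1) → ℝ, ∑ l, g l * ((Pi.single i 1 + Pi.single j 1 :
        Fin (n - 1) → ℝ) l) ^ 2 = g i + g j := by
      intro g
      have : ∀ l, g l * ((Pi.single i 1 + Pi.single j 1 : Fin (n - 1) → ℝ) l) ^ 2 =
          g l * (if l = i then 1 else 0) + g l * (if l = j then 1 else 0) := by
        intro l
        by_cases h1 : l = i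
        · subst h1
          simp [hij]
        · by_cases h2 : l = j
          · subst h2
            simp [h1]
          · simp [h1, h2]
      simp only [this, Finset.sum_add_distrib]
      simp
    have e2 : ∑ l, (Pi.single i 1 + Pi.single j 1 : Fin (n - 1) → ℝ) l * τ l = τ i + τ j := by
      simp only [Pi.add_apply, add_mul, Finset.sum_add_distrib]
      simp [Pi.single_apply]
    have e3 := e1 (fun _ => 1)
    simp only [one_mul] at e3
    rw [e1, e2, e3, hdiag, hdiag] at h
    linarith
  have hex : ∃ i₀, τ i₀ ≠ 0 := by
    by_contra! hall
    simp [hall] at hτ1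
  obtain ⟨i₀, hi₀⟩ := hex
  refine ⟨i₀, funext fun i => ?_⟩
  rw [hdiag]
  by_cases hαβ : α = β
  · simp [hαβ]
  · have hz : ∀ j, j ≠ i₀ → τ j = 0 := by
      intro j hj
      have := hoff j i₀ hj
      simpa [sub_ne_zero.2 hαβ, hi₀] using this
    split_ifs with h
    · subst h
      rw [Finset.sum_eq_single i] at hτ1
      · rw [hτ1]; ring
      · intro j _ hj
        rw [hz j hj]; ring
      · simp
    · rw [hz i h]; ring

/-- The subsets avoiding `i₀` give the first term, those containing it the second. -/
theorem powersetCard_sum_prod_ite {d : ℕ} (i₀ : Fin d) (α β : ℝ) (j : ℕ) :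
    ∑ s ∈ (Finset.univ : Finset (Fin d)).powersetCard (j + 1),
      ∏ i ∈ s, (if i = i₀ then α else β) =
      β ^ (j + 1) * ((d - 1).choose (j + 1) : ℝ) + α * β ^ j * ((d - 1).choose j : ℝ) := by
  classical
  have hu : (Finset.univ : Finset (Fin d)) = insert i₀ (Finset.univ.erase i₀) := by
    rw [Finset.insert_erase (Finset.mem_univ i₀)]
  have hcard : (Finset.univ.erase i₀ : Finset (Fin d)).card = d - 1 := by
    rw [Finset.card_erase_of_mem (Finset.mem_univ i₀), Finset.card_univ, Fintype.card_fin]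
  have hprod : ∀ q, ∀ s ∈ (Finset.univ.erase i₀ : Finset (Fin d)).powersetCard q,
      ∏ i ∈ s, (if i = i₀ then α else β) = β ^ q := by
    intro q s hs
    obtain ⟨h1, h2⟩ := Finset.mem_powersetCard.1 hs
    rw [Finset.prod_congr rfl (g := fun _ => β), Finset.prod_const, h2]
    intro i hi
    rw [if_neg (Finset.ne_of_mem_erase (h1 hi))]
  rw [hu, Finset.powersetCard_succ_insert (Finset.notMem_erase _ _), Finset.sum_union]
  · rw [Finset.sum_image]
    · congr 1
      · rw [Finset.sum_congr rfl (hprod (j + 1)), Finset.sum_const, Finset.card_powersetCard, hcard,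
          nsmul_eq_mul, mul_comm]
      · rw [Finset.sum_congr rfl (g := fun _ => α * β ^ j), Finset.sum_const,
          Finset.card_powersetCard, hcard, nsmul_eq_mul, mul_comm]
        intro s hs
        rw [Finset.prod_insert, if_pos rfl, hprod j s hs]
        intro h
        exact Finset.notMem_erase i₀ _ ((Finset.mem_powersetCard.1 hs).1 h)
    · intro s hs t ht hst
      have h1 : i₀ ∉ s := fun h => Finset.notMem_erase i₀ _ ((Finset.mem_powersetCard.1 hs).1 h)
      have h2 : i₀ ∉ t := fun h => Finset.notMem_erase i₀ _ ((Finset.mem_powersetCard.1 ht).1 h)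
      rw [← Finset.erase_insert h1, ← Finset.erase_insert h2, hst]
  · rw [Finset.disjoint_left]
    intro s hs hs'
    obtain ⟨t, -, rfl⟩ := Finset.mem_image.1 hs'
    exact Finset.notMem_erase i₀ _ ((Finset.mem_powersetCard.1 hs).1 (Finset.mem_insert_self _ _))

/-- The `j`-th elementary symmetric function of `n - 1` numbers, one of them `α` and the others
`β`. -/
noncomputable def esymmTwo (n : ℕ) (α β : ℝ) : ℕ → ℝ
  | 0 => 1
  | j + 1 => β ^ (j + 1) * ((n - 2).choose (j + 1) : ℝ) + α * β ^ j * ((n - 2).choose j : ℝ)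

theorem choose_mul_H {j : ℕ} (hj : j ≤ n - 1) : ((n - 1).choose j : ℝ) * H K j x =
    ∑ s ∈ (Finset.univ : Finset (Fin (n - 1))).powersetCard j,
      ∏ i ∈ s, principalCurvature K x i := by
  rw [H, ← mul_assoc, mul_inv_cancel₀, one_mul]
  exact_mod_cast (Nat.choose_pos hj).ne'

theorem H_last : H K (n - 1) x = ∏ i, principalCurvature K x i := by
  have h : (Finset.univ : Finset (Fin (n - 1))).powersetCard (n - 1) = {Finset.univ} := by
    have := Finset.powersetCard_self (Finset.univ : Finset (Fin (n - 1)))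
    simpa using this
  have h1 := choose_mul_H (K := K) (x := x) (le_refl (n - 1))
  rw [h, Finset.sum_singleton] at h1
  simpa using h1

theorem choose_mul_H_eq_esymmTwo {α β : ℝ} {i₀ : Fin (n - 1)}
    (h : principalCurvature K x = fun i => if i = i₀ then α else β) {j : ℕ} (hj : j ≤ n - 1) :
    ((n - 1).choose j : ℝ) * H K j x = esymmTwo n α β j := by
  rw [choose_mul_H hj, h]
  rcases j with _ | j
  · simp [esymmTwo]
  · rw [powersetCard_sum_prod_ite]
    rfl

end Curvature

section Integrand

variable {n : ℕ} {K : ConvexBody (Euc n)} {x : Euc n}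

theorem integrandW_eq (p : ℝ) (m k : ℕ) : integrandW p m k K x =
    (inner ℝ x (outerNormal K x)) ^ ((m : ℝ) - k + n * (1 - p) / (n + p))
    * (H K (n - 1) x) ^ (p / (n + p)) *
      powCoeff n m (n / (n + p)) fun j => ((n - 1).choose j : ℝ) * H K j x := by
  simp only [integrandW, powCoeff, c, mul_pow]

end Integrand
end LpSteiner

namespace LpSteiner

/-! ### Hausdorff measure inside hyperplanes. -/

section Hausdorff

theorem _root_.LipschitzWith.euclideanHausdorffMeasure_image_le {X Y : Type*} [MetricSpace X]
    [MeasurableSpace X] [BorelSpace X] [MetricSpace Y] [MeasurableSpace Y] [BorelSpace Y]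
    {f : X → Y} (hf : LipschitzWith 1 f) (d : ℕ) (s : Set X) : μHE[d] (f '' s) ≤ μHE[d] s := by
  rw [Measure.euclideanHausdorffMeasure_def, Measure.euclideanHausdorffMeasure_def,
    Measure.smul_apply, Measure.smul_apply]
  have h := hf.hausdorffMeasure_image_le (d := (d : ℝ)) (Nat.cast_nonneg d) s
  rw [ENNReal.coe_one, ENNReal.one_rpow, one_mul] at h
  rw [ENNReal.smul_def, ENNReal.smul_def, smul_eq_mul, smul_eq_mul]
  exact mul_le_mul_right h _

variable {n : ℕ}

/-- An isometric parametrization of the hyperplane `⟨x, u⟩ = h`. -/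
theorem exists_hyperplane_isometry (hn : 1 ≤ n) {u : Euc n} (hu : ‖u‖ = 1) (h : ℝ) :
    ∃ ι : Euc (n - 1) →ᵃ[ℝ] Euc n, Isometry ι ∧ Set.range ι = {x | inner ℝ x u = h} := by
  have hu0 : u ≠ 0 := fun h0 => by simp [h0] at hu
  have : Fact (Module.finrank ℝ (Euc n) = (n - 1) + 1) := ⟨by simp; omega⟩
  let e := (OrthonormalBasis.fromOrthogonalSpanSingleton (𝕜 := ℝ) (n - 1) hu0).repr.symm
  let L : Euc (n - 1) →ₗᵢ[ℝ] Euc n := (ℝ ∙ u)ᗮ.subtypeₗᵢ.comp e.toLinearIsometry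
  refine ⟨L.toLinearMap.toAffineMap + AffineMap.const ℝ _ (h • u), ?_, ?_⟩
  · refine Isometry.of_dist_eq fun x y => ?_
    simp only [AffineMap.coe_add, Pi.add_apply, LinearMap.coe_toAffineMap, AffineMap.const_apply,
      dist_add_right]
    exact L.isometry.dist_eq x y
  · ext x
    simp only [Set.mem_range, AffineMap.coe_add, Pi.add_apply, LinearMap.coe_toAffineMap,
      AffineMap.const_apply, Set.mem_ofPred_eq]
    constructor
    · rintro ⟨y, rfl⟩
      have h1 : inner ℝ u (L y) = 0 :=
        Submodule.mem_orthogonal_singleton_iff_inner_right.1 (e y).2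
      rw [inner_add_left, real_inner_smul_left, real_inner_self_eq_norm_sq, hu, real_inner_comm]
      have h2 : inner ℝ u (L.toLinearMap y) = 0 := h1
      rw [h2]
      ring
    · intro hx
      have hmem : x - h • u ∈ (ℝ ∙ u)ᗮ := by
        rw [Submodule.mem_orthogonal_singleton_iff_inner_left, inner_sub_left, hx,
          real_inner_smul_left, real_inner_self_eq_norm_sq, hu]
        ring
      refine ⟨e.symm ⟨_, hmem⟩, ?_⟩
      have h3 : L.toLinearMap (e.symm ⟨_, hmem⟩) = x - h • u := by
        change ((e (e.symm ⟨_, hmem⟩) : (ℝ ∙ u)ᗮ) : Euc n) = _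
        rw [e.apply_symm_apply]
      rw [h3, sub_add_cancel]

theorem measure_hyperplane_inter (hn : 1 ≤ n) {u : Euc n} (hu : ‖u‖ = 1) (h : ℝ) :
    ∃ ι : Euc (n - 1) →ᵃ[ℝ] Euc n, Isometry ι ∧ Set.range ι = {x | inner ℝ x u = h} ∧
      ∀ s : Set (Euc n), (∀ x ∈ s, inner ℝ x u = h) → μHE[n - 1] s = volume (ι ⁻¹' s) := by
  obtain ⟨ι, h1, h2⟩ := exists_hyperplane_isometry hn hu h
  refine ⟨ι, h1, h2, fun s hs => ?_⟩
  rw [← EuclideanSpace.euclideanHausdorffMeasure_eq_volume, h1.euclideanHausdorffMeasure_preimage,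
    h2]
  congr 1
  ext x
  exact ⟨fun hx => ⟨hx, hs x hx⟩, fun hx => hx.1⟩

theorem measure_lt_top_of_subset_hyperplane (hn : 1 ≤ n) {u : Euc n} (hu : ‖u‖ = 1) {h : ℝ}
    {s : Set (Euc n)} (hs : ∀ x ∈ s, inner ℝ x u = h) (hb : Bornology.IsBounded s) :
    μHE[n - 1] s < ⊤ := by
  obtain ⟨ι, h1, h2, h3⟩ := measure_hyperplane_inter hn hu h
  rw [h3 s hs]
  exact (h1.antilipschitz.isBounded_preimage hb).measure_lt_top

/-- The points of `K` around which `K` contains a disc orthogonal to `u`. -/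
def HasDisc (K : ConvexBody (Euc n)) (u x : Euc n) : Prop :=
  ∃ ε > 0, ∀ w, inner ℝ w u = 0 → ‖w‖ < ε → x + w ∈ K

/-- Inside the hyperplane the exceptional points belong to the boundary of a convex set, which is
Lebesgue null. -/
theorem measure_not_hasDisc (hn : 1 ≤ n) (K : ConvexBody (Euc n)) {u : Euc n} (hu : ‖u‖ = 1)
    (h : ℝ) : μHE[n - 1] {x | x ∈ K ∧ inner ℝ x u = h ∧ ¬ HasDisc K u x} = 0 := by
  obtain ⟨ι, h1, h2, h3⟩ := measure_hyperplane_inter hn hu h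
  rw [h3 _ fun x hx => hx.2.1]
  refine measure_mono_null ?_ ((K.convex.affine_preimage ι).addHaar_frontier volume)
  intro y hy
  refine ⟨subset_closure hy.1, fun hint => hy.2.2 ?_⟩
  obtain ⟨ε, hε, hb⟩ := Metric.isOpen_iff.1 isOpen_interior y hint
  refine ⟨ε, hε, fun w hw hwε => ?_⟩
  have hr : ι y + w ∈ Set.range ι := by
    have hy2 := hy.2.1
    rw [h2, Set.mem_ofPred_eq, inner_add_left, hw, add_zero]
    exact hy2
  obtain ⟨z, hz⟩ := hr
  have hzb : z ∈ Metric.ball y ε := by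
    rw [Metric.mem_ball, ← h1.dist_eq, hz, dist_eq_norm, add_sub_cancel_left]
    exact hwε
  have := interior_subset (hb hzb)
  rw [Set.mem_preimage, hz] at this
  exact this

/-- A disc around `x` inside `K` would allow the segment from the interior point `z` to be prolonged
beyond `x`, and `x` would be interior. So only points without a disc remain. -/
theorem measure_frontier_inter_hyperplane (hn : 1 ≤ n) (K : ConvexBody (Euc n)) {u : Euc n}
    (hu : ‖u‖ = 1) {z : Euc n} (hz : z ∈ interior (K : Set (Euc n))) :
    μHE[n - 1] {x | x ∈ frontier (K : Set (Euc n)) ∧ inner ℝ x u = inner ℝ z u} = 0 := by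
  refine measure_mono_null ?_ (measure_not_hasDisc hn K hu (inner ℝ z u))
  rintro x ⟨hx, hxu⟩
  refine ⟨mem_of_mem_frontier hx, hxu, ?_⟩
  rintro ⟨ε, hε, hd⟩
  have hxz : 0 < ‖x - z‖ := norm_pos_iff.2 (sub_ne_zero.2 fun h => hx.2 (h ▸ hz))
  set c := ε / 2 / ‖x - z‖ with hc
  have hcpos : 0 < c := by positivity
  have hmem : x + c • (x - z) ∈ K := by
    refine hd _ ?_ ?_
    · rw [real_inner_smul_left, inner_sub_left, hxu, sub_self, mul_zero]
    · rw [norm_smul, Real.norm_of_nonneg hcpos.le, hc, div_mul_cancel₀ _ hxz.ne']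
      linarith
  refine hx.2 (K.convex.openSegment_interior_self_subset_interior hz hmem ?_)
  refine ⟨c / (1 + c), 1 / (1 + c), by positivity, by positivity, by field_simp; ring, ?_⟩
  have h1 : 1 / (1 + c) * c = 1 - 1 / (1 + c) := by field_simp; ring
  rw [show c / (1 + c) = 1 / (1 + c) * c by ring, smul_add, smul_smul, h1]
  module

end Hausdorff

/-! ### Monotonicity and finiteness of surface area. -/

section Projection

variable {n : ℕ}

/-- The nearest point projection onto a convex body. -/
theorem exists_projection (K : ConvexBody (Euc n)) : ∃ f : Euc n → Euc n, LipschitzWith 1 f ∧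
    ∀ x ∈ K, ∀ u, (∀ y ∈ K, inner ℝ (y - x) u ≤ 0) → f (x + u) = x := by
  have h : ∀ x : Euc n, ∃ v ∈ K, ∀ w ∈ K, inner ℝ (x - v) (w - v) ≤ 0 := by
    intro x
    obtain ⟨v, hv, hmin⟩ := exists_norm_eq_iInf_of_complete_convex K.nonempty
      K.isCompact.isComplete K.convex x
    exact ⟨v, hv, (norm_eq_iInf_iff_real_inner_le_zero K.convex hv).1 hmin⟩
  choose f hf hf' using h
  have key : ∀ x y, ‖f x - f y‖ ^ 2 ≤ inner ℝ (x - y) (f x - f y) := by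
    intro x y
    have h1 := hf' x _ (hf y)
    have h2 := hf' y _ (hf x)
    rw [← real_inner_self_eq_norm_sq]
    rw [← neg_sub (f x) (f y), inner_neg_right] at h1
    simp only [inner_sub_left] at *
    linarith
  refine ⟨f, LipschitzWith.of_dist_le_mul fun x y => ?_, fun x hx u hu => ?_⟩
  · rw [dist_eq_norm, dist_eq_norm, NNReal.coe_one, one_mul]
    have h1 := (key x y).trans (real_inner_le_norm _ _)
    by_contra! hlt
    nlinarith [norm_nonneg (x - y), norm_nonneg (f x - f y)]
  · have h1 := hf' (x + u) _ hx
    have h2 := hu _ (hf (x + u))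
    have h3 : ‖x - f (x + u)‖ ^ 2 ≤ 0 := by
      rw [← real_inner_self_eq_norm_sq]
      rw [add_sub_right_comm, inner_add_left] at h1
      rw [real_inner_comm, ← neg_sub x, inner_neg_right] at h2
      linarith
    have h4 : x - f (x + u) = 0 := by
      rw [← norm_eq_zero]
      nlinarith [norm_nonneg (x - f (x + u))]
    exact (sub_eq_zero.1 h4).symm

/-- The nearest point projection onto `K` does not increase distances, and the image of the boundary
of `L` covers that of `K`: the normal ray at `x` leaves `L` at a point that projects back to `x`. -/
theorem measure_frontier_mono {K L : ConvexBody (Euc n)} (hK : (interior (K : Set (Euc n))).Nonempty)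
    (h : K ≤ L) : μHE[n - 1] (frontier (K : Set (Euc n))) ≤
      μHE[n - 1] (frontier (L : Set (Euc n))) := by
  obtain ⟨f, hf, hfK⟩ := exists_projection K
  refine le_trans (measure_mono ?_) (hf.euclideanHausdorffMeasure_image_le _ _)
  intro x hx
  obtain ⟨u, hu⟩ := exists_isOuterUnitNormal hK hx
  obtain ⟨R, hR⟩ := L.isBounded.exists_norm_le
  have hR0 : 0 ≤ R := (norm_nonneg x).trans (hR x (h (mem_of_mem_frontier hx)))
  have hcont : Continuous fun t : ℝ => x + t • u := by fun_prop
  obtain ⟨_, ⟨t, ht, rfl⟩, hfr⟩ := exists_mem_frontier_of_isPreconnected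
    (s := (L : Set (Euc n))) ((isPreconnected_Icc (a := (0 : ℝ)) (b := 2 * R + 1)).image _
      hcont.continuousOn) ⟨0, ⟨le_rfl, by linarith⟩, rfl⟩
    (by simpa using h (mem_of_mem_frontier hx)) ⟨2 * R + 1, ⟨by linarith, le_rfl⟩, rfl⟩ (by
      intro hmem
      have h1 := hR _ hmem
      have h2 := norm_sub_le (x + (2 * R + 1) • u) x
      rw [add_sub_cancel_left, norm_smul, hu.1, Real.norm_of_nonneg (by linarith)] at h2
      have h3 := hR x (h (mem_of_mem_frontier hx))
      linarith)
  refine ⟨_, hfr, hfK x (mem_of_mem_frontier hx) _ fun y hy => ?_⟩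
  rw [inner_smul_right]
  exact mul_nonpos_of_nonneg_of_nonpos ht.1 (hu.2 y hy)

theorem coe_smul_cube {R : ℝ} (hR : 0 < R) :
    ((R • cube n : ConvexBody (Euc n)) : Set (Euc n)) = {x | ∀ i, |x i| ≤ R} := by
  rw [ConvexBody.coe_smul]
  ext x
  rw [Set.mem_smul_set_iff_inv_smul_mem₀ hR.ne']
  change (∀ i, |(R⁻¹ • x) i| ≤ 1) ↔ ∀ i, |x i| ≤ R
  refine forall_congr' fun i => ?_
  rw [PiLp.smul_apply, smul_eq_mul, abs_mul, abs_inv, abs_of_pos hR, inv_mul_le_iff₀ hR, mul_one]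

/-- By monotonicity a large cube suffices, and its boundary is covered by bounded pieces of finitely
many hyperplanes. -/
theorem measure_frontier_lt_top (hn : 1 ≤ n) {K : ConvexBody (Euc n)}
    (hK : (interior (K : Set (Euc n))).Nonempty) :
    μHE[n - 1] (frontier (K : Set (Euc n))) < ⊤ := by
  obtain ⟨R, hR⟩ := K.isBounded.exists_norm_le
  obtain ⟨z, hz⟩ := hK
  have hR0 : 0 ≤ R := (norm_nonneg z).trans (hR z (interior_subset hz))
  have hle : K ≤ (R + 1) • cube n := by
    intro x hx
    change x ∈ (((R + 1) • cube n : ConvexBody (Euc n)) : Set (Euc n))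
    rw [coe_smul_cube (by linarith)]
    intro i
    have h1 := PiLp.norm_apply_le x i
    have h2 := hR x hx
    rw [Real.norm_eq_abs] at h1
    linarith
  refine (measure_frontier_mono ⟨z, hz⟩ hle).trans_lt ?_
  have hsub : frontier (((R + 1) • cube n : ConvexBody (Euc n)) : Set (Euc n)) ⊆
      ⋃ q : Fin n × Bool, {x | x ∈ (R + 1) • cube n ∧
        inner ℝ x (EuclideanSpace.single q.1 1) = if q.2 then R + 1 else -(R + 1)} := by
    intro x hx
    have hxm := mem_of_mem_frontier hx
    have hxm' : x ∈ (((R + 1) • cube n : ConvexBody (Euc n)) : Set (Euc n)) := hxm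
    rw [coe_smul_cube (by linarith)] at hxm'
    by_contra hno
    simp only [Set.mem_iUnion, not_exists] at hno
    apply hx.2
    rw [coe_smul_cube (by linarith)]
    have hopen : IsOpen {x : Euc n | ∀ i, |x i| < R + 1} := by
      have : {x : Euc n | ∀ i, |x i| < R + 1} = ⋂ i, {x | |x i| < R + 1} := by ext; simp
      rw [this]
      exact isOpen_iInter_of_finite fun i => isOpen_lt (by fun_prop) continuous_const
    refine mem_interior.2 ⟨_, fun y hy i => (hy i).le, hopen, fun i => ?_⟩
    refine lt_of_le_of_ne (hxm' i) fun heq => ?_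
    rcases (abs_eq (by linarith)).1 heq with h | h
    · exact hno (i, true) ⟨hxm, by simp [EuclideanSpace.inner_single_right, h]⟩
    · exact hno (i, false) ⟨hxm, by simp [EuclideanSpace.inner_single_right, h]⟩
  refine (measure_mono hsub).trans_lt ?_
  rw [← Set.biUnion_univ]
  refine (measure_biUnion_lt_top (Set.finite_univ)) fun q _ => ?_
  exact measure_lt_top_of_subset_hyperplane hn (u := EuclideanSpace.single q.1 1) (by simp)
    (fun x hx => hx.2) (((R + 1) • cube n).isBounded.subset fun x hx => hx.1)

end Projection

/-! ### Lower bounds for measures by projection. -/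

section LowerBounds

variable {n : ℕ}

/-- The projection forgetting the coordinate `0`. -/
noncomputable def dropCoord (n : ℕ) (x : Euc n) : Euc (n - 1) :=
  WithLp.toLp 2 fun j : Fin (n - 1) => x ⟨(j : ℕ) + 1, by omega⟩

theorem lipschitz_dropCoord : LipschitzWith 1 (dropCoord n) := by
  refine LipschitzWith.of_dist_le_mul fun x y => ?_
  rw [NNReal.coe_one, one_mul, EuclideanSpace.dist_eq, EuclideanSpace.dist_eq]
  refine Real.sqrt_le_sqrt ?_
  have hinj : Function.Injective fun j : Fin (n - 1) => (⟨(j : ℕ) + 1, by omega⟩ : Fin n) := by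
    intro i j hij
    simpa [Fin.ext_iff] using hij
  calc ∑ j, dist ((dropCoord n x) j) ((dropCoord n y) j) ^ 2
      = ∑ i ∈ (Finset.univ : Finset (Fin (n - 1))).map ⟨_, hinj⟩, dist (x i) (y i) ^ 2 := by
        rw [Finset.sum_map]; rfl
    _ ≤ ∑ i, dist (x i) (y i) ^ 2 :=
        Finset.sum_le_sum_of_subset_of_nonneg (Finset.subset_univ _) fun _ _ _ => by positivity

/-- Forgetting a coordinate does not increase Hausdorff measure, so a set is at least as large as
any box in its shadow. This bounds the measures of the positive sphere and of the rim from below. -/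
theorem volume_box_le_of_subset_image {s : Set (Euc n)} (a b : Fin (n - 1) → ℝ)
    (h : ∀ y : Euc (n - 1), (∀ j, a j ≤ y j ∧ y j ≤ b j) → ∃ x ∈ s, dropCoord n x = y) :
    ∏ j, ENNReal.ofReal (b j - a j) ≤ μHE[n - 1] s := by
  have h1 := lipschitz_dropCoord.euclideanHausdorffMeasure_image_le (n - 1) s
  rw [EuclideanSpace.euclideanHausdorffMeasure_eq_volume] at h1
  refine le_trans ?_ h1
  have h2 : (volume : Measure (Euc (n - 1))) ((WithLp.ofLp : Euc (n - 1) → _) ⁻¹' (Set.Icc a b)) =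
      ∏ j, ENNReal.ofReal (b j - a j) := by
    rw [(PiLp.volume_preserving_ofLp (Fin (n - 1))).measure_preimage
      measurableSet_Icc.nullMeasurableSet, Real.volume_Icc_pi]
  rw [← h2]
  refine measure_mono fun y hy => ?_
  exact h y fun j => ⟨hy.1 j, hy.2 j⟩

end LowerBounds

/-! ### Integrals under homotheties. -/

section Homothety

open scoped Pointwise

variable {n : ℕ}

theorem setIntegral_homothety (d : ℕ) (z : Euc n) {r : ℝ} (hr : 0 < r) (s : Set (Euc n))
    (f : Euc n → ℝ) : ∫ x in (fun ξ => z + r • ξ) '' s, f x ∂μHE[d] =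
      r ^ d * ∫ ξ in s, f (z + r • ξ) ∂μHE[d] := by
  have hemb : MeasurableEmbedding (fun ξ : Euc n => z + r • ξ) :=
    ((Homeomorph.smulOfNeZero r hr.ne').trans (Homeomorph.addLeft z)).measurableEmbedding
  have hinj : Function.Injective (fun ξ : Euc n => z + r • ξ) := hemb.injective
  have hmap : (μHE[d] : Measure (Euc n)) =
      (ENNReal.ofReal r ^ d) • Measure.map (fun ξ : Euc n => z + r • ξ) μHE[d] := by
    ext t ht
    rw [Measure.smul_apply, hemb.map_apply]
    have h1 : t = (fun y => z + y) '' (r • ((fun ξ : Euc n => z + r • ξ) ⁻¹' t)) := by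
      ext x
      simp only [Set.mem_image, Set.mem_smul_set, Set.mem_preimage]
      constructor
      · intro hx
        refine ⟨x - z, ⟨r⁻¹ • (x - z), ?_, ?_⟩, by abel⟩
        · rw [smul_smul, mul_inv_cancel₀ hr.ne', one_smul, add_sub_cancel]
          exact hx
        · rw [smul_smul, mul_inv_cancel₀ hr.ne', one_smul]
      · rintro ⟨_, ⟨y, hy, rfl⟩, rfl⟩
        exact hy
    conv_lhs => rw [h1]
    rw [(isometry_add_left z).euclideanHausdorffMeasure_image,
      Measure.euclideanHausdorffMeasure_smul₀ d hr.ne', ENNReal.smul_def, smul_eq_mul, smul_eq_mul]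
    congr 1
    rw [ENNReal.coe_pow, ENNReal.ofReal, Real.toNNReal_eq_nnnorm_of_nonneg hr.le]
  conv_lhs => rw [hmap, Measure.restrict_smul, integral_smul_measure, hemb.setIntegral_map,
    Set.preimage_image_eq _ hinj]
  rw [ENNReal.toReal_pow, ENNReal.toReal_ofReal hr.le, smul_eq_mul]

end Homothety
end LpSteiner

namespace LpSteiner

/-! ### The integrand as a function of support height and curvatures. -/

section Density

variable {n : ℕ} {K : ConvexBody (Euc n)} {x : Euc n}

/-- The integrand of `W` at a point with support value `h` and principal curvatures `α, β, …, β`. -/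
noncomputable def density (n : ℕ) (p : ℝ) (m k : ℕ) (h α β : ℝ) : ℝ :=
  h ^ ((m : ℝ) - k + n * (1 - p) / (n + p)) * (α * β ^ (n - 2)) ^ (p / (n + p)) *
    powCoeff n m (n / (n + p)) (esymmTwo n α β)

theorem prod_ite_eq (i₀ : Fin (n - 1)) (α β : ℝ) :
    ∏ i, (if i = i₀ then α else β) = α * β ^ (n - 2) := by
  rw [← Finset.mul_prod_erase _ _ (Finset.mem_univ i₀), if_pos rfl,
    Finset.prod_congr rfl (g := fun _ => β), Finset.prod_const,
    Finset.card_erase_of_mem (Finset.mem_univ i₀), Finset.card_univ, Fintype.card_fin]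
  · congr 2
  · intro i hi
    rw [if_neg (Finset.ne_of_mem_erase hi)]

theorem integrandW_eq_density {α β : ℝ} {i₀ : Fin (n - 1)}
    (h : principalCurvature K x = fun i => if i = i₀ then α else β) (p : ℝ) (m k : ℕ) :
    integrandW p m k K x = density n p m k (inner ℝ x (outerNormal K x)) α β := by
  rw [integrandW_eq, H_last, h, prod_ite_eq, density]
  congr 1
  exact powCoeff_congr fun j _ hj => choose_mul_H_eq_esymmTwo h hj

theorem add_ne_zero_of_range {p : ℝ} (hn : 2 ≤ n) (hp : p < -n ∨ 0 ≤ p) : (n : ℝ) + p ≠ 0 := by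
  have : (2 : ℝ) ≤ n := by exact_mod_cast hn
  rcases hp with h | h
  · linarith
  · positivity

/-- The excluded range `-n < p < 0` is the one in which the Gauss curvature would enter with a
negative exponent. -/
theorem exponent_nonneg {p : ℝ} (hp : p < -n ∨ 0 ≤ p) : 0 ≤ p / (n + p) := by
  have : (0 : ℝ) ≤ n := n.cast_nonneg
  rcases hp with h | h
  · exact div_nonneg_of_nonpos (by linarith) (by linarith)
  · positivity

theorem exponent_ne_zero {p : ℝ} (hn : 2 ≤ n) (hp : p < -n ∨ 0 ≤ p) (hp0 : p ≠ 0) :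
    p / (n + p) ≠ 0 := div_ne_zero hp0 (add_ne_zero_of_range hn hp)

/-- The integrand vanishes where the Gauss curvature does, for `p ≠ 0`. -/
theorem integrandW_eq_zero {p : ℝ} (hn : 2 ≤ n) (hp : p < -n ∨ 0 ≤ p) (hp0 : p ≠ 0)
    (h : ∏ i, principalCurvature K x i = 0) (m k : ℕ) : integrandW p m k K x = 0 := by
  rw [integrandW_eq, H_last, h, Real.zero_rpow (exponent_ne_zero hn hp hp0)]
  ring

/-- Without curvature only `m = 0` survives in `powCoeff`, and the Gauss curvature factor `0 ^
(p/(n+p))` is nonzero only for `p = 0`, where it is `0 ^ 0 = 1`. -/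
theorem density_zero {p : ℝ} (hn : 2 ≤ n) (hp : p < -n ∨ 0 ≤ p) (m k : ℕ) (h : ℝ) :
    density n p m k h 0 0 = if p = 0 ∧ m = 0 then h ^ (1 - k : ℝ) else 0 := by
  have hn0 : (n : ℝ) ≠ 0 := by positivity
  rw [density, powCoeff_congr (e' := fun _ => 0), powCoeff_zero_right]
  · by_cases hp0 : p = 0
    · subst hp0
      by_cases hm : m = 0
      · subst hm
        simp [hn0, sub_eq_neg_add]
      · simp [hm]
    · simp [hp0, Real.zero_rpow (exponent_ne_zero hn hp hp0)]
  · intro j hj _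
    obtain ⟨j, rfl⟩ := Nat.exists_eq_add_of_le' hj
    simp [esymmTwo]

end Density

/-! ### Flat boundary pieces. -/

section Flat

variable {n : ℕ} {K : ConvexBody (Euc n)} {x u : Euc n} {h : ℝ}

theorem exists_unit_orthogonal (hn : 2 ≤ n) (u : Euc n) : ∃ T : Euc n, ‖T‖ = 1 ∧ inner ℝ T u = 0 := by
  have hfin : Module.finrank ℝ (ℝ ∙ u) < Module.finrank ℝ (Euc n) := by
    have h1 := finrank_span_le_card (R := ℝ) ({u} : Set (Euc n))
    simp only [Set.toFinset_singleton, Finset.card_singleton] at h1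
    simp only [finrank_euclideanSpace_fin]
    omega
  obtain ⟨w, hw, hw0⟩ := Submodule.exists_mem_ne_zero_of_ne_bot
    (mt (Submodule.orthogonal_eq_bot_iff (K := ℝ ∙ u)).1 fun htop => by
      rw [htop, finrank_top] at hfin
      exact lt_irrefl _ hfin)
  refine ⟨‖w‖⁻¹ • w, ?_, ?_⟩
  · rw [norm_smul, norm_inv, norm_norm, inv_mul_cancel₀ (norm_ne_zero_iff.2 hw0)]
  · rw [real_inner_smul_left, Submodule.mem_orthogonal_singleton_iff_inner_left.1 hw, mul_zero]

/-- The disc forces the component of any normal orthogonal to `u` to vanish, and the interior origin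
fixes the sign. -/
theorem flat_outerNormal (h0 : (0 : Euc n) ∈ interior (K : Set (Euc n))) (hu : ‖u‖ = 1)
    (hle : ∀ y ∈ K, inner ℝ y u ≤ h) (hxu : inner ℝ x u = h)
    (hd : HasDisc K u x) : outerNormal K x = u := by
  have hux : IsOuterUnitNormal K x u := ⟨hu, fun y hy => by
    rw [inner_sub_left, hxu]; linarith [hle y hy]⟩
  refine outerNormal_eq hux fun w hw => ?_
  obtain ⟨ε, hε, hd⟩ := hd
  set d := w - (inner ℝ w u : ℝ) • u with hddef
  have hdu : inner ℝ d u = 0 := by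
    rw [hddef, inner_sub_left, real_inner_smul_left, real_inner_self_eq_norm_sq, hu]
    ring
  have hwd : w = d + (inner ℝ w u : ℝ) • u := by rw [hddef, sub_add_cancel]
  have hd0 : d = 0 := by
    by_contra hd0
    have hdpos : 0 < ‖d‖ := norm_pos_iff.2 hd0
    have h1 := hw.2 _ (hd ((ε / 2 / ‖d‖) • d) (by rw [real_inner_smul_left, hdu, mul_zero]) (by
      rw [norm_smul, Real.norm_of_nonneg (by positivity), div_mul_cancel₀ _ hdpos.ne']
      linarith))
    rw [add_sub_cancel_left, real_inner_smul_left, hwd, inner_add_right, real_inner_smul_right,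
      hdu, mul_zero, add_zero, real_inner_self_eq_norm_sq] at h1
    have : 0 < ε / 2 / ‖d‖ * ‖d‖ ^ 2 := by positivity
    linarith
  rw [hd0, zero_add] at hwd
  have h2 := hw.inner_lt h0
  have h3 := hux.inner_lt h0
  have h4 := hw.1
  rw [zero_sub, inner_neg_left] at h2 h3
  rw [hwd, real_inner_smul_right] at h2
  rw [hwd, norm_smul, hu, mul_one, Real.norm_eq_abs, abs_of_pos (by nlinarith)] at h4
  rw [hwd, h4, one_smul]

/-- If a boundary point `y` near `x` were below the hyperplane, its central projection to the
hyperplane would lie in the disc, and `y` would lie strictly between the interior point `0` and a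
point of `K`. -/
theorem flat_frontier (h0 : (0 : Euc n) ∈ interior (K : Set (Euc n))) (hu : ‖u‖ = 1)
    (hle : ∀ y ∈ K, inner ℝ y u ≤ h) (hxu : inner ℝ x u = h)
    (hd : HasDisc K u x) : ∀ᶠ y in 𝓝[frontier (K : Set (Euc n))] x, inner ℝ y u = h := by
  have hux : IsOuterUnitNormal K x u := ⟨hu, fun y hy => by
    rw [inner_sub_left, hxu]; linarith [hle y hy]⟩
  have hpos : 0 < h := by
    have h3 := hux.inner_lt h0
    rw [zero_sub, inner_neg_left, hxu] at h3
    linarith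
  obtain ⟨ε, hε, hd⟩ := hd
  have hcont : ContinuousAt (fun y : Euc n => (h / inner ℝ y u) • y) x := by
    refine ContinuousAt.smul (ContinuousAt.div continuousAt_const
      (g := fun y : Euc n => inner ℝ y u) (by fun_prop) ?_) continuousAt_id
    rw [hxu]
    exact hpos.ne'
  have hev1 : ∀ᶠ y in 𝓝 x, ‖(h / inner ℝ y u) • y - x‖ < ε := by
    have hx1 : (h / inner ℝ x u) • x = x := by rw [hxu, div_self hpos.ne', one_smul]
    have := hcont.tendsto.eventually (Metric.ball_mem_nhds _ hε)
    rw [hx1] at this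
    simpa [dist_eq_norm] using this
  have hev2 : ∀ᶠ y in 𝓝 x, 0 < inner ℝ y u := by
    refine ContinuousAt.eventually_lt (f := fun _ => (0 : ℝ)) continuousAt_const
      (g := fun y : Euc n => inner ℝ y u) (by fun_prop) ?_
    rw [hxu]
    exact hpos
  filter_upwards [nhdsWithin_le_nhds hev1, nhdsWithin_le_nhds hev2, self_mem_nhdsWithin]
    with y h1 h2 hy
  refine le_antisymm (hle y (mem_of_mem_frontier hy)) ?_
  by_contra! hlt
  have hmem : (h / inner ℝ y u) • y ∈ K := by
    have := hd ((h / inner ℝ y u) • y - x) (by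
      rw [inner_sub_left, real_inner_smul_left, hxu, div_mul_cancel₀ _ h2.ne', sub_self]) h1
    rwa [add_sub_cancel] at this
  refine hy.2 (K.convex.openSegment_interior_self_subset_interior h0 hmem ?_)
  refine ⟨1 - inner ℝ y u / h, inner ℝ y u / h, sub_pos.2 ((div_lt_one hpos).2 hlt), by positivity,
    by ring, ?_⟩
  rw [smul_zero, zero_add, smul_smul, div_mul_div_cancel₀ hpos.ne', div_self h2.ne', one_smul]

theorem flat_principalCurvature (hn : 2 ≤ n) (h0 : (0 : Euc n) ∈ interior (K : Set (Euc n)))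
    (hu : ‖u‖ = 1) (hle : ∀ y ∈ K, inner ℝ y u ≤ h) (hx : x ∈ K) (hxu : inner ℝ x u = h)
    (hd : HasDisc K u x) : ∃ i₀, principalCurvature K x = fun i => if i = i₀ then 0 else 0 := by
  have hux : IsOuterUnitNormal K x u := ⟨hu, fun y hy => by
    rw [inner_sub_left, hxu]; linarith [hle y hy]⟩
  have hN := flat_outerNormal h0 hu hle hxu hd
  obtain ⟨T, hT, hTu⟩ := exists_unit_orthogonal hn u
  refine exists_principalCurvature_eq hn ⟨0, h0⟩ hx (by rwa [hN]) hT (by rwa [hN]) ?_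
  rw [hN]
  have hev : (fun y => inner ℝ (x - y) u - (1 / 2 : ℝ) *
      (twoForm 0 0 T (y - x) - 0 * inner ℝ (y - x) u ^ 2)) =ᶠ[𝓝[frontier (K : Set (Euc n))] x]
      fun _ => 0 := by
    filter_upwards [flat_frontier h0 hu hle hxu hd] with y hy
    rw [twoForm, inner_sub_left, hxu, hy]
    ring
  exact (Asymptotics.isLittleO_zero _ _).congr' hev.symm EventuallyEq.rfl

theorem flat_integrandW (hn : 2 ≤ n) {p : ℝ} (hp : p < -n ∨ 0 ≤ p)
    (h0 : (0 : Euc n) ∈ interior (K : Set (Euc n)))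
    (hu : ‖u‖ = 1) (hle : ∀ y ∈ K, inner ℝ y u ≤ h) (hx : x ∈ K) (hxu : inner ℝ x u = h)
    (hd : HasDisc K u x) (m k : ℕ) :
    integrandW p m k K x = if p = 0 ∧ m = 0 then h ^ (1 - k : ℝ) else 0 := by
  obtain ⟨i₀, hi₀⟩ := flat_principalCurvature hn h0 hu hle hx hxu hd
  rw [integrandW_eq_density hi₀, density_zero hn hp, flat_outerNormal h0 hu hle hxu hd, hxu]

theorem measurableSet_face (K : ConvexBody (Euc n)) (u : Euc n) (h : ℝ) :
    MeasurableSet {x | x ∈ K ∧ inner ℝ x u = h} :=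
  (K.isClosed.inter (isClosed_eq (by fun_prop) continuous_const)).measurableSet

theorem flat_ae (hn : 2 ≤ n) {p : ℝ} (hp : p < -n ∨ 0 ≤ p)
    (h0 : (0 : Euc n) ∈ interior (K : Set (Euc n)))
    (hu : ‖u‖ = 1) (hle : ∀ y ∈ K, inner ℝ y u ≤ h) (m k : ℕ) :
    ∀ᵐ x ∂(μHE[n - 1] : Measure (Euc n)).restrict {x | x ∈ K ∧ inner ℝ x u = h},
      integrandW p m k K x = if p = 0 ∧ m = 0 then h ^ (1 - k : ℝ) else 0 := by
  rw [ae_restrict_iff' (measurableSet_face K u h)]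
  have h1 := measure_not_hasDisc (by omega) K hu h
  have h2 : ∀ᵐ x ∂(μHE[n - 1] : Measure (Euc n)), ¬ (x ∈ K ∧ inner ℝ x u = h ∧ ¬ HasDisc K u x) :=
    measure_eq_zero_iff_ae_notMem.1 h1
  filter_upwards [h2] with x hx hx'
  simp only [not_and, not_not] at hx
  exact flat_integrandW hn hp h0 hu hle hx'.1 hx'.2 (hx hx'.1 hx'.2) m k

theorem flat_integrableOn (hn : 2 ≤ n) {p : ℝ} (hp : p < -n ∨ 0 ≤ p)
    (h0 : (0 : Euc n) ∈ interior (K : Set (Euc n)))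
    (hu : ‖u‖ = 1) (hle : ∀ y ∈ K, inner ℝ y u ≤ h) (m k : ℕ) :
    IntegrableOn (integrandW p m k K) {x | x ∈ K ∧ inner ℝ x u = h} μHE[n - 1] := by
  have hfin : μHE[n - 1] {x | x ∈ K ∧ inner ℝ x u = h} < ⊤ :=
    measure_lt_top_of_subset_hyperplane (by omega) hu (fun x hx => hx.2)
      (K.isBounded.subset fun x hx => hx.1)
  exact (integrableOn_const hfin.ne).congr
    ((flat_ae hn hp h0 hu hle m k).mono fun x hx => hx.symm)

end Flat

/-! ### Polytopes. -/

section Polytope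

variable {n : ℕ} {P : ConvexBody (Euc n)}

theorem IsPolytope.exists_faces (hP : IsPolytope P)
    (h0 : (0 : Euc n) ∈ interior (P : Set (Euc n))) :
    ∃ T : Finset (Euc n × ℝ), (∀ q ∈ T, ‖q.1‖ = 1 ∧ ∀ y ∈ P, inner ℝ y q.1 ≤ q.2) ∧
      frontier (P : Set (Euc n)) ⊆ ⋃ q ∈ T, {x | x ∈ P ∧ inner ℝ x q.1 = q.2} := by
  classical
  obtain ⟨s, hs⟩ := hP
  have hmem : ∀ {x}, x ∈ P ↔ ∀ q ∈ s, inner ℝ q.1 x ≤ q.2 := fun {x} => by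
    rw [← SetLike.mem_coe, hs]; rfl
  -- Constraints with zero normal hold everywhere because `0 ∈ P`; the others are normalized.
  refine ⟨(s.filter fun q => q.1 ≠ 0).image fun q => (‖q.1‖⁻¹ • q.1, ‖q.1‖⁻¹ * q.2), ?_, ?_⟩
  · intro q hq
    obtain ⟨q, hq', rfl⟩ := Finset.mem_image.1 hq
    obtain ⟨hq, hq0⟩ := Finset.mem_filter.1 hq'
    refine ⟨?_, fun y hy => ?_⟩
    · rw [norm_smul, norm_inv, norm_norm, inv_mul_cancel₀ (norm_ne_zero_iff.2 hq0)]
    · rw [real_inner_smul_right, real_inner_comm]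
      exact mul_le_mul_of_nonneg_left (hmem.1 hy q hq) (by positivity)
  · intro x hx
    by_contra hno
    simp only [Set.mem_iUnion, not_exists] at hno
    have hxP := mem_of_mem_frontier hx
    refine hx.2 (mem_interior.2 ⟨⋂ q ∈ s.filter fun q => q.1 ≠ 0, {y | inner ℝ q.1 y < q.2}, ?_, ?_,
      ?_⟩)
    · intro y hy
      refine hmem.2 fun q hq => ?_
      by_cases hq0 : q.1 = 0
      · have := hmem.1 (interior_subset h0) q hq
        rw [hq0] at this ⊢
        rw [inner_zero_left] at this ⊢
        exact this
      · simp only [Set.mem_iInter] at hy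
        exact (hy q (Finset.mem_filter.2 ⟨hq, hq0⟩)).le
    · exact isOpen_biInter_finset fun q _ => isOpen_lt (by fun_prop) continuous_const
    · simp only [Set.mem_iInter]
      intro q hq
      have hq1 := (Finset.mem_filter.1 hq).1
      refine lt_of_le_of_ne (hmem.1 hxP q hq1) fun heq => ?_
      refine hno (‖q.1‖⁻¹ • q.1, ‖q.1‖⁻¹ * q.2) (Finset.mem_image.2 ⟨q, hq, rfl⟩) ⟨hxP, ?_⟩
      rw [real_inner_smul_right, real_inner_comm, heq]

theorem IsPolytope.mem_domainV (hn : 2 ≤ n) {p : ℝ} (hp : p < -n ∨ 0 ≤ p) (k : ℕ)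
    (hP : IsPolytope P) (h0 : (0 : Euc n) ∈ interior (P : Set (Euc n))) : P ∈ domainV n p k := by
  obtain ⟨T, hT, hsub⟩ := hP.exists_faces h0
  refine ⟨h0, fun m _ => ?_⟩
  refine IntegrableOn.mono_set ?_ hsub
  rw [integrableOn_finset_iUnion]
  exact fun q hq => flat_integrableOn hn hp h0 (hT q hq).1 (hT q hq).2 m k

/-- The height varies with the face, but an existential suffices: for `p = 0` its power is either `h
^ 0`, when `k = 1`, or it is multiplied by `binom(1, k) = 0`. -/
theorem IsPolytope.ae_integrandW (hn : 2 ≤ n) {p : ℝ} (hp : p < -n ∨ 0 ≤ p) (m k : ℕ)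
    (hP : IsPolytope P) (h0 : (0 : Euc n) ∈ interior (P : Set (Euc n))) :
    ∀ᵐ x ∂(μHE[n - 1] : Measure (Euc n)).restrict (frontier (P : Set (Euc n))),
      ∃ h : ℝ, integrandW p m k P x = if p = 0 ∧ m = 0 then h ^ (1 - k : ℝ) else 0 := by
  obtain ⟨T, hT, hsub⟩ := hP.exists_faces h0
  have h : ∀ᵐ x ∂(μHE[n - 1] : Measure (Euc n)).restrict
      (⋃ q ∈ T, {x | x ∈ P ∧ inner ℝ x q.1 = q.2}), ∃ h : ℝ,
      integrandW p m k P x = if p = 0 ∧ m = 0 then h ^ (1 - k : ℝ) else 0 := by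
    rw [ae_restrict_biUnion_finset_iff]
    exact fun q hq => (flat_ae hn hp h0 (hT q hq).1 (hT q hq).2 m k).mono fun x hx => ⟨_, hx⟩
  exact ae_mono (Measure.restrict_mono hsub le_rfl) h

theorem choose_one_eq_zero {j : ℕ} (hj : 2 ≤ j) : Ring.choose (1 : ℝ) j = 0 := by
  have := choose_natCast_real 1 j
  rw [Nat.cast_one] at this
  rw [this, Nat.choose_eq_zero_of_lt (by omega), Nat.cast_zero]

theorem IsPolytope.V_eq (hn : 2 ≤ n) {p : ℝ} (hp : p < -n ∨ 0 ≤ p) {k : ℕ} (hk : 1 ≤ k)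
    (hP : IsPolytope P) (h0 : (0 : Euc n) ∈ interior (P : Set (Euc n))) :
    V p k P = if p = 0 ∧ k = 1 then
          (μHE[n - 1] : Measure (Euc n)).real (frontier (P : Set (Euc n))) else 0 := by
  have hn0 : (n : ℝ) ≠ 0 := by positivity
  have hW : ∀ m, ¬ (p = 0 ∧ m = 0) → W p m k P = 0 := by
    intro m hm
    refine integral_eq_zero_of_ae ((hP.ae_integrandW hn hp m k h0).mono fun x hx => ?_)
    obtain ⟨h, hx⟩ := hx
    rw [hx, if_neg hm]
    rfl
  rw [V, Finset.sum_range_succ', Finset.sum_eq_zero fun m _ => by rw [hW _ (by simp), mul_zero],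
    zero_add, Nat.sub_zero]
  split_ifs with h
  · obtain ⟨rfl, rfl⟩ := h
    rw [Ring.choose_one_right, show (n : ℝ) * (1 - 0) / (n + 0) = 1 by simp [hn0], one_mul, W,
      setIntegral_congr_ae₀ (g := fun _ => (1 : ℝ))]
    · simp
    · exact isClosed_frontier.measurableSet.nullMeasurableSet
    · have := hP.ae_integrandW hn hp 0 1 h0
      rw [ae_restrict_iff' isClosed_frontier.measurableSet] at this
      filter_upwards [this] with x hx hxF
      obtain ⟨h, hx⟩ := hx hxF
      simpa using hx
  · by_cases hp0 : p = 0
    · subst hp0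
      rw [show (n : ℝ) * (1 - 0) / (n + 0) = 1 by simp [hn0], choose_one_eq_zero, zero_mul]
      simp only [true_and] at h
      omega
    · rw [hW 0 (by simp [hp0]), mul_zero]

end Polytope
end LpSteiner

namespace LpSteiner

/-! ### Approximation by polytopes and criteria for failing semicontinuity. -/

section Approximation

variable {n : ℕ}

theorem dist_le_of_subset {K L : ConvexBody (Euc n)} {r : ℝ} (hr : 0 ≤ r)
    (h1 : ∀ x ∈ K, ∃ y ∈ L, ‖x - y‖ ≤ r) (h2 : ∀ x ∈ L, ∃ y ∈ K, ‖x - y‖ ≤ r) : dist K L ≤ r := by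
  rw [← ConvexBody.hausdorffDist_coe]
  refine Metric.hausdorffDist_le_of_mem_dist hr (fun x hx => ?_) (fun x hx => ?_)
  · obtain ⟨y, hy, h⟩ := h1 x hx
    exact ⟨y, hy, by rwa [dist_eq_norm]⟩
  · obtain ⟨y, hy, h⟩ := h2 x hx
    exact ⟨y, hy, by rwa [dist_eq_norm]⟩

/-- The supporting half-space at a boundary point `z` controls, up to the factor `1 + δ`, all rays
through a neighbourhood of `z`. By compactness of the boundary finitely many half-spaces are enough.
-/
theorem exists_polytope_between {K : ConvexBody (Euc n)}
    (h0 : (0 : Euc n) ∈ interior (K : Set (Euc n))) {δ : ℝ} (hδ : 0 < δ) :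
    ∃ P : ConvexBody (Euc n), IsPolytope P ∧ K ≤ P ∧ P ≤ (1 + δ) • K := by
  choose! u hu using fun z (hz : z ∈ frontier (K : Set (Euc n))) =>
    exists_isOuterUnitNormal ⟨0, h0⟩ hz
  have hpos : ∀ z ∈ frontier (K : Set (Euc n)), 0 < inner ℝ z (u z) := by
    intro z hz
    have := (hu z hz).inner_lt h0
    rw [zero_sub, inner_neg_left] at this
    linarith
  have hcomp : IsCompact (frontier (K : Set (Euc n))) :=
    K.isCompact.of_isClosed_subset isClosed_frontier K.isClosed.frontier_subset
  obtain ⟨t, htsub, htcov⟩ := hcomp.elim_nhds_subcover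
    (fun z => {x | inner ℝ z (u z) < (1 + δ) * inner ℝ x (u z)}) fun z hz => by
      refine (isOpen_lt continuous_const (by fun_prop)).mem_nhds ?_
      have := hpos z hz
      change inner ℝ z (u z) < (1 + δ) * inner ℝ z (u z)
      nlinarith
  set S : Set (Euc n) := {x | ∀ q ∈ t.image fun z => (u z, (inner ℝ z (u z) : ℝ)),
    inner ℝ q.1 x ≤ q.2} with hS
  have hmemS : ∀ x, x ∈ S ↔ ∀ z ∈ t, inner ℝ x (u z) ≤ inner ℝ z (u z) := by
    intro x
    rw [hS, Set.mem_ofPred_eq]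
    simp only [Finset.forall_mem_image, real_inner_comm x]
  have hKS : (K : Set (Euc n)) ⊆ S := by
    intro x hx
    rw [hmemS]
    intro z hz
    have := (hu z (htsub z hz)).2 x hx
    rw [inner_sub_left] at this
    linarith
  have hSK : S ⊆ (((1 + δ) • K : ConvexBody (Euc n)) : Set (Euc n)) := by
    intro x hx
    rw [hmemS] at hx
    rw [ConvexBody.coe_smul, Set.mem_smul_set_iff_inv_smul_mem₀ (by positivity)]
    -- Otherwise the segment from `0` to `(1 + δ)⁻¹ • x` crosses the boundary at a point covered by
    -- some `z`, and `x` violates the constraint at `z`.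
    by_contra hxK
    have hcont : Continuous fun s : ℝ => s • ((1 + δ)⁻¹ • x) := by fun_prop
    obtain ⟨_, ⟨s, hs, rfl⟩, hfr⟩ := exists_mem_frontier_of_isPreconnected
      (s := (K : Set (Euc n))) ((isPreconnected_Icc (a := (0 : ℝ)) (b := 1)).image _
        hcont.continuousOn) ⟨0, ⟨le_rfl, zero_le_one⟩, rfl⟩
      (by simpa using interior_subset h0) ⟨1, ⟨zero_le_one, le_rfl⟩, rfl⟩ (by simpa using hxK)
    have h1 := htcov hfr
    simp only [Set.mem_iUnion] at h1
    obtain ⟨z, hz, h1⟩ := h1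
    rw [Set.mem_ofPred_eq] at h1
    rw [real_inner_smul_left, real_inner_smul_left] at h1
    have h2 := hx z hz
    have h3 := hpos z (htsub z hz)
    have h4 : (1 + δ) * (s * ((1 + δ)⁻¹ * inner ℝ x (u z))) = s * inner ℝ x (u z) := by
      field_simp
    rw [h4] at h1
    have h5 := mul_le_mul_of_nonneg_left h2 hs.1
    nlinarith [hs.2]
  have hSconv : Convex ℝ S := by
    have : S = ⋂ q ∈ t.image fun z => (u z, (inner ℝ z (u z) : ℝ)), {x | inner ℝ q.1 x ≤ q.2} := by
      ext x; simp [hS]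
    rw [this]
    refine convex_iInter₂ fun q _ => ?_
    exact convex_halfSpace_le (IsLinearMap.mk (fun x y => inner_add_right _ _ _)
      fun c x => real_inner_smul_right _ _ _) q.2
  have hSclosed : IsClosed S := by
    have : S = ⋂ q ∈ t.image fun z => (u z, (inner ℝ z (u z) : ℝ)), {x | inner ℝ q.1 x ≤ q.2} := by
      ext x; simp [hS]
    rw [this]
    exact isClosed_biInter fun q _ => isClosed_le (by fun_prop) continuous_const
  exact ⟨⟨S, hSconv, ((1 + δ) • K).isCompact.of_isClosed_subset hSclosed hSK,
    K.nonempty.mono hKS⟩, ⟨_, rfl⟩, hKS, hSK⟩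

theorem exists_polytope_seq {K : ConvexBody (Euc n)}
    (h0 : (0 : Euc n) ∈ interior (K : Set (Euc n))) :
    ∃ P : ℕ → ConvexBody (Euc n), (∀ l, IsPolytope (P l) ∧
      (0 : Euc n) ∈ interior (P l : Set (Euc n)) ∧ P l ≤ (1 + 1 / ((l : ℝ) + 1)) • K) ∧
      Tendsto P atTop (𝓝 K) := by
  choose P hP hKP hPK using fun l : ℕ => exists_polytope_between h0
    (show (0 : ℝ) < 1 / ((l : ℝ) + 1) by positivity)
  refine ⟨P, fun l => ⟨hP l, interior_mono (hKP l) h0, hPK l⟩, ?_⟩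
  obtain ⟨R, hR⟩ := K.isBounded.exists_norm_le
  have hR0 : 0 ≤ R := (norm_nonneg _).trans (hR 0 (interior_subset h0))
  rw [tendsto_iff_dist_tendsto_zero]
  have hlim : Tendsto (fun l : ℕ => 1 / ((l : ℝ) + 1) * R) atTop (𝓝 0) := by
    simpa using tendsto_one_div_add_atTop_nhds_zero_nat.mul_const R
  refine squeeze_zero (fun _ => dist_nonneg) (fun l => ?_) hlim
  refine dist_le_of_subset (by positivity) (fun x hx => ?_)
    fun x hx => ⟨x, hKP l hx, by rw [sub_self, norm_zero]; positivity⟩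
  have h1 := hPK l hx
  rw [← SetLike.mem_coe, ConvexBody.coe_smul] at h1
  obtain ⟨y, hy, rfl⟩ := h1
  refine ⟨y, hy, ?_⟩
  have : (1 + 1 / ((l : ℝ) + 1)) • y - y = (1 / ((l : ℝ) + 1)) • y := by module
  change ‖(1 + 1 / ((l : ℝ) + 1)) • y - y‖ ≤ _
  rw [this, norm_smul, Real.norm_of_nonneg (by positivity)]
  exact mul_le_mul_of_nonneg_left (hR y hy) (by positivity)

theorem not_lowerSemicontinuousOn_of_seq {X : Type*} [TopologicalSpace X] {f : X → ℝ} {D : Set X}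
    {x : X} (hx : x ∈ D) {u : ℕ → X} (hu : Tendsto u atTop (𝓝 x)) (huD : ∀ᶠ l in atTop, u l ∈ D)
    {c : ℝ} (hc : c < f x) (hle : ∀ᶠ l in atTop, f (u l) ≤ c) : ¬ LowerSemicontinuousOn f D := by
  intro h
  have h1 := (tendsto_nhdsWithin_iff.2 ⟨hu, huD⟩).eventually (h x hx c hc)
  obtain ⟨l, hl1, hl2⟩ := (h1.and hle).exists
  exact absurd hl1 (not_lt.2 hl2)

theorem not_upperSemicontinuousOn_of_seq {X : Type*} [TopologicalSpace X] {f : X → ℝ} {D : Set X}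
    {x : X} (hx : x ∈ D) {u : ℕ → X} (hu : Tendsto u atTop (𝓝 x)) (huD : ∀ᶠ l in atTop, u l ∈ D)
    {c : ℝ} (hc : f x < c) (hle : ∀ᶠ l in atTop, c ≤ f (u l)) : ¬ UpperSemicontinuousOn f D := by
  intro h
  have h1 := (tendsto_nhdsWithin_iff.2 ⟨hu, huD⟩).eventually (h x hx c hc)
  obtain ⟨l, hl1, hl2⟩ := (h1.and hle).exists
  exact absurd hl1 (not_lt.2 hl2)

end Approximation

/-! ### Spherical boundary pieces and the unit ball. -/

section Sphere

variable {n : ℕ} {K : ConvexBody (Euc n)} {x u : Euc n}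

/-- Where the boundary is a piece of a sphere of radius `r`, all principal curvatures are `1/r`. -/
theorem sphere_principalCurvature (hn : 2 ≤ n) (hK : (interior (K : Set (Euc n))).Nonempty)
    (hx : x ∈ K) (hN : IsOuterUnitNormal K x (outerNormal K x)) {q : Euc n} {r : ℝ} (hr : 0 < r)
    (hxq : x = q + r • outerNormal K x)
    (hev : ∀ᶠ y in 𝓝[frontier (K : Set (Euc n))] x, ‖y - q‖ = r) :
    ∃ i₀, principalCurvature K x = fun i => if i = i₀ then 1 / r else 1 / r := by
  set u := outerNormal K x with hu
  obtain ⟨T, hT, hTu⟩ := exists_unit_orthogonal hn u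
  refine exists_principalCurvature_eq hn hK hx hN hT hTu ?_
  -- On the sphere `‖y - x‖²` is `-2r` times the normal component of `y - x`, so the error of the
  -- expansion is exactly `‖y - x‖⁴ / (8 r³)`.
  have heq : (fun y => (1 / (8 * r ^ 3) * ‖y - x‖ ^ 2) * ‖y - x‖ ^ 2)
      =ᶠ[𝓝[frontier (K : Set (Euc n))] x] (fun y => inner ℝ (x - y) u - (1 / 2 : ℝ) *
      (twoForm (1 / r) (1 / r) T (y - x) - 1 / r * inner ℝ (y - x) u ^ 2)) := by
    filter_upwards [hev] with y hy
    have h1 : ‖y - x‖ ^ 2 = -(2 * r * inner ℝ (y - x) u) := by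
      have h2 : y - q = (y - x) + r • u := by rw [hxq]; abel
      rw [h2] at hy
      have h3 := norm_add_sq_real (y - x) (r • u)
      rw [hy, norm_smul, hN.1, Real.norm_of_nonneg hr.le, real_inner_smul_right] at h3
      linarith
    have h4 : inner ℝ (x - y) u = - inner ℝ (y - x) u := by
      rw [← inner_neg_left, neg_sub]
    rw [twoForm, h4, h1]
    field_simp
    ring
  refine Asymptotics.IsLittleO.congr' ?_ heq EventuallyEq.rfl
  have h0 : Tendsto (fun y : Euc n => 1 / (8 * r ^ 3) * ‖y - x‖ ^ 2)
      (𝓝[frontier (K : Set (Euc n))] x) (𝓝 0) := by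
    have : Tendsto (fun y : Euc n => 1 / (8 * r ^ 3) * ‖y - x‖ ^ 2) (𝓝 x)
        (𝓝 (1 / (8 * r ^ 3) * ‖x - x‖ ^ 2)) := Continuous.tendsto (by fun_prop) x
    rw [sub_self, norm_zero] at this
    simpa using this.mono_left nhdsWithin_le_nhds
  have h1 := ((Asymptotics.isLittleO_one_iff ℝ).2 h0).mul_isBigO
    (Asymptotics.isBigO_refl (fun y : Euc n => ‖y - x‖ ^ 2) (𝓝[frontier (K : Set (Euc n))] x))
  simpa using h1

theorem esymmTwo_self (hn : 2 ≤ n) (β : ℝ) (j : ℕ) :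
    esymmTwo n β β j = β ^ j * ((n - 1).choose j : ℝ) := by
  rcases j with _ | j
  · simp [esymmTwo]
  · obtain ⟨d, rfl⟩ := Nat.exists_eq_add_of_le' hn
    simp only [esymmTwo, show d + 2 - 2 = d by omega, show d + 2 - 1 = d + 1 by omega,
      Nat.choose_succ_succ d j]
    push_cast
    ring

/-- Weighted homogeneity contributes `β^m`, and the Gauss curvature contributes `β^((n-1)p/(n+p))`.
-/
theorem density_self (hn : 2 ≤ n) (p : ℝ) (m k : ℕ) (h : ℝ) {β : ℝ} (hβ : 0 < β) :
    density n p m k h β β = β ^ ((m : ℝ) + (n - 1) * (p / (n + p))) * F n p m *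
      h ^ ((m : ℝ) - k + n * (1 - p) / (n + p)) := by
  rw [density, funext (esymmTwo_self hn β), powCoeff_smul, ← pow_succ', Real.rpow_add hβ,
    Real.rpow_natCast, ← Real.rpow_natCast β (n - 2 + 1), ← Real.rpow_mul hβ.le]
  have h1 : ((n - 2 + 1 : ℕ) : ℝ) = n - 1 := by
    rw [show n - 2 + 1 = n - 1 by omega, Nat.cast_sub (by omega), Nat.cast_one]
  rw [h1]
  change _ * (β ^ m * F n p m) = _
  ring

end Sphere

section Ball

variable {n : ℕ}

theorem zero_mem_interior_unitBall : (0 : Euc n) ∈ interior (unitBall n : Set (Euc n)) := by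
  refine mem_interior.2 ⟨Metric.ball 0 1, Metric.ball_subset_closedBall, Metric.isOpen_ball, ?_⟩
  simp

theorem frontier_unitBall : frontier (unitBall n : Set (Euc n)) = Metric.sphere 0 1 :=
  frontier_closedBall 0 one_ne_zero

theorem integrandW_unitBall (hn : 2 ≤ n) (p : ℝ) (m k : ℕ) {x : Euc n}
    (hx : x ∈ Metric.sphere (0 : Euc n) 1) : integrandW p m k (unitBall n) x = F n p m := by
  have hx1 : ‖x‖ = 1 := by simpa using hx
  have hxF : x ∈ frontier (unitBall n : Set (Euc n)) := by rwa [frontier_unitBall]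
  have hN := isOuterUnitNormal_outerNormal ⟨0, zero_mem_interior_unitBall⟩ hxF
  have hNx : outerNormal (unitBall n) x = x := by
    set u := outerNormal (unitBall n) x
    have h1 : inner ℝ (u - x) u ≤ 0 := hN.2 u (by
      change u ∈ Metric.closedBall (0 : Euc n) 1
      simp [hN.1])
    rw [inner_sub_left, real_inner_self_eq_norm_sq, hN.1] at h1
    have h2 := norm_sub_sq_real u x
    rw [hN.1, hx1, real_inner_comm] at h2
    have h3 : ‖u - x‖ = 0 := by nlinarith [norm_nonneg (u - x)]
    exact sub_eq_zero.1 (norm_eq_zero.1 h3)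
  obtain ⟨i₀, hi₀⟩ := sphere_principalCurvature hn ⟨0, zero_mem_interior_unitBall⟩
    (mem_of_mem_frontier hxF) hN (q := 0) one_pos (by rw [hNx]; simp) (by
      filter_upwards [self_mem_nhdsWithin] with y hy
      rw [frontier_unitBall] at hy
      simpa using hy)
  rw [integrandW_eq_density hi₀, hNx, real_inner_self_eq_norm_sq, hx1, one_div_one,
    density_self hn p m k _ one_pos]
  simp

theorem measure_sphere_lt_top (hn : 1 ≤ n) : μHE[n - 1] (Metric.sphere (0 : Euc n) 1) < ⊤ := by
  rw [← frontier_unitBall]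
  exact measure_frontier_lt_top hn ⟨0, zero_mem_interior_unitBall⟩

theorem unitBall_mem_domainV (hn : 2 ≤ n) (p : ℝ) (k : ℕ) : unitBall n ∈ domainV n p k := by
  refine ⟨zero_mem_interior_unitBall, fun m _ => ?_⟩
  rw [frontier_unitBall]
  refine (integrableOn_const (C := F n p m) (measure_sphere_lt_top (by omega)).ne).congr_fun
    (fun x hx => (integrandW_unitBall hn p m k hx).symm) Metric.isClosed_sphere.measurableSet

theorem V_unitBall (hn : 2 ≤ n) (p : ℝ) (k : ℕ) : V p k (unitBall n) =
    Ring.choose ((n : ℝ) * (n - p) / (n + p)) k *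
      (μHE[n - 1] : Measure (Euc n)).real (Metric.sphere 0 1) := by
  rw [V, ← sum_choose_mul_F (by omega : 1 ≤ n), Finset.sum_mul]
  refine Finset.sum_congr rfl fun m _ => ?_
  rw [W, frontier_unitBall, setIntegral_congr_fun Metric.isClosed_sphere.measurableSet
    fun x hx => integrandW_unitBall hn p m k hx, setIntegral_const, smul_eq_mul]
  ring

end Ball

/-! ### Rounded convex bodies. -/

section Rounding

variable {n : ℕ} {A : ConvexBody (Euc n)} {r : ℝ}

/-- The convex body `A`, rounded at scale `r`. -/
noncomputable def rounding (A : ConvexBody (Euc n)) (r : ℝ) : ConvexBody (Euc n) :=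
  (1 - r) • A + r • unitBall n

theorem mem_rounding {x : Euc n} : x ∈ rounding A r ↔
    ∃ a ∈ A, ∃ b : Euc n, ‖b‖ ≤ 1 ∧ x = (1 - r) • a + r • b := by
  rw [← SetLike.mem_coe, rounding, ConvexBody.coe_add, ConvexBody.coe_smul, ConvexBody.coe_smul,
    Set.mem_add]
  constructor
  · rintro ⟨_, ⟨a, ha, rfl⟩, _, ⟨b, hb, rfl⟩, rfl⟩
    exact ⟨a, ha, b, by simpa using (mem_closedBall_zero_iff.1 hb), rfl⟩
  · rintro ⟨a, ha, b, hb, rfl⟩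
    exact ⟨_, ⟨a, ha, rfl⟩, _, ⟨b, mem_closedBall_zero_iff.2 hb, rfl⟩, rfl⟩

theorem zero_mem_interior_rounding (hA : (0 : Euc n) ∈ A) (hr : 0 < r) :
    (0 : Euc n) ∈ interior (rounding A r : Set (Euc n)) := by
  refine mem_interior.2 ⟨Metric.ball 0 r, fun x hx => ?_, Metric.isOpen_ball, by simpa using hr⟩
  rw [SetLike.mem_coe, mem_rounding]
  refine ⟨0, hA, r⁻¹ • x, ?_, ?_⟩
  · rw [norm_smul, norm_inv, Real.norm_of_nonneg hr.le, inv_mul_le_iff₀ hr, mul_one]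
    simpa using (mem_ball_zero_iff.1 hx).le
  · rw [smul_zero, zero_add, smul_smul, mul_inv_cancel₀ hr.ne', one_smul]

/-- Replacing `b` by `w` stays in the body, so maximality in the direction `w` gives `⟨b, w⟩ ≥ 1`,
and `‖b‖ ≤ 1` leaves only `b = w`. Rounded bodies therefore have unique normals. -/
theorem rounding_normal_eq {a b w : Euc n} (hr : 0 < r) (ha : a ∈ A) (hb : ‖b‖ ≤ 1)
    (hw : IsOuterUnitNormal (rounding A r) ((1 - r) • a + r • b) w) : w = b := by
  have h1 := hw.2 ((1 - r) • a + r • w) (mem_rounding.2 ⟨a, ha, w, hw.1.le, rfl⟩)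
  rw [add_sub_add_left_eq_sub, ← smul_sub, real_inner_smul_left, inner_sub_left,
    real_inner_self_eq_norm_sq, hw.1] at h1
  have h2 : 1 ≤ inner ℝ b w := by nlinarith
  have h3 := norm_sub_sq_real w b
  rw [hw.1, real_inner_comm] at h3
  have h4 : ‖w - b‖ = 0 := by nlinarith [norm_nonneg (w - b), norm_nonneg b]
  exact sub_eq_zero.1 (norm_eq_zero.1 h4)

/-- The boundary points of a rounded convex body. -/
theorem exists_of_mem_frontier_rounding (hA : (0 : Euc n) ∈ A) (hr : 0 < r) (hr1 : r < 1)
    {x : Euc n} (hx : x ∈ frontier (rounding A r : Set (Euc n))) :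
    ∃ a ∈ A, ∃ u : Euc n, ‖u‖ = 1 ∧ x = (1 - r) • a + r • u ∧ (∀ a' ∈ A, inner ℝ (a' - a) u ≤ 0) ∧
      outerNormal (rounding A r) x = u := by
  have hN := isOuterUnitNormal_outerNormal ⟨0, zero_mem_interior_rounding hA hr⟩ hx
  obtain ⟨a, ha, b, hb, rfl⟩ := mem_rounding.1 (mem_of_mem_frontier hx)
  have h := rounding_normal_eq hr ha hb hN
  refine ⟨a, ha, b, h ▸ hN.1, rfl, fun a' ha' => ?_, h⟩
  have h1 := hN.2 ((1 - r) • a' + r • b) (mem_rounding.2 ⟨a', ha', b, hb, rfl⟩)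
  rw [h, add_sub_add_right_eq_sub, ← smul_sub, real_inner_smul_left] at h1
  exact nonpos_of_mul_nonpos_right h1 (by linarith)

theorem isOuterUnitNormal_rounding (hr : 0 < r) (hr1 : r ≤ 1) {a u : Euc n}
    (hu : ‖u‖ = 1) (hau : ∀ a' ∈ A, inner ℝ (a' - a) u ≤ 0) :
    IsOuterUnitNormal (rounding A r) ((1 - r) • a + r • u) u := by
  refine ⟨hu, fun y hy => ?_⟩
  obtain ⟨a', ha', b, hb, rfl⟩ := mem_rounding.1 hy
  have h1 : (1 - r) • a' + r • b - ((1 - r) • a + r • u) = (1 - r) • (a' - a) + r • (b - u) := by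
    module
  have h2 : inner ℝ b u ≤ 1 := (real_inner_le_norm _ _).trans (by rw [hu, mul_one]; exact hb)
  rw [h1, inner_add_left, real_inner_smul_left, real_inner_smul_left, inner_sub_left b u,
    real_inner_self_eq_norm_sq, hu]
  have h3 := hau a' ha'
  nlinarith

theorem mem_frontier_rounding (hr : 0 < r) (hr1 : r ≤ 1) {a u : Euc n} (ha : a ∈ A)
    (hu : ‖u‖ = 1) (hau : ∀ a' ∈ A, inner ℝ (a' - a) u ≤ 0) :
    (1 - r) • a + r • u ∈ frontier (rounding A r : Set (Euc n)) :=
  (isOuterUnitNormal_rounding hr hr1 hu hau).mem_frontier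
    (mem_rounding.2 ⟨a, ha, u, hu.le, rfl⟩) (by simp)

theorem outerNormal_rounding (hr : 0 < r) (hr1 : r ≤ 1) {a u : Euc n} (ha : a ∈ A)
    (hu : ‖u‖ = 1) (hau : ∀ a' ∈ A, inner ℝ (a' - a) u ≤ 0) :
    outerNormal (rounding A r) ((1 - r) • a + r • u) = u :=
  outerNormal_eq (isOuterUnitNormal_rounding hr hr1 hu hau)
    fun _ hw => rounding_normal_eq hr ha hu.le hw

/-- A segment in the face of `A` with normal `u` survives rounding: scaled by `1 - r` and shifted by
`r u` it lies in the boundary, so the Gauss curvature vanishes. -/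
theorem integrandW_rounding_eq_zero {p : ℝ} (hn : 2 ≤ n) (hp : p < -n ∨ 0 ≤ p) (hp0 : p ≠ 0)
    (hA : (0 : Euc n) ∈ A) (hr : 0 < r) (hr1 : r < 1) {a a' u : Euc n} (ha : a ∈ A) (ha' : a' ∈ A)
    (hne : a' ≠ a) (hu : ‖u‖ = 1) (hau : ∀ a' ∈ A, inner ℝ (a' - a) u ≤ 0)
    (h0 : inner ℝ (a' - a) u = 0) (m k : ℕ) :
    integrandW p m k (rounding A r) ((1 - r) • a + r • u) = 0 := by
  refine integrandW_eq_zero hn hp hp0 (prod_principalCurvature_eq_zero hn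
    ⟨0, zero_mem_interior_rounding hA hr⟩ (mem_rounding.2 ⟨a, ha, u, hu.le, rfl⟩)
    (mem_rounding.2 ⟨a', ha', u, hu.le, rfl⟩) ?_ ?_) m k
  · intro h
    have h1 := add_right_cancel h
    exact hne (smul_right_injective _ (by linarith : (1 - r) ≠ 0) h1)
  · rw [outerNormal_rounding hr hr1.le ha hu hau, add_sub_add_right_eq_sub, ← smul_sub,
      real_inner_smul_left, h0, mul_zero]

theorem tendsto_rounding {ρ : ℕ → ℝ} (hρ : Tendsto ρ atTop (𝓝 0)) :
    Tendsto (fun l => rounding A (ρ l)) atTop (𝓝 A) := by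
  obtain ⟨R, hR⟩ := A.isBounded.exists_norm_le
  obtain ⟨a₀, ha₀⟩ := A.nonempty
  have hR0 : 0 ≤ R := (norm_nonneg _).trans (hR a₀ ha₀)
  rw [tendsto_iff_dist_tendsto_zero]
  have hlim : Tendsto (fun l : ℕ => |ρ l| * (R + 1)) atTop (𝓝 0) := by
    simpa using hρ.abs.mul_const (R + 1)
  refine squeeze_zero (fun _ => dist_nonneg) (fun l => ?_) hlim
  have key : ∀ a ∈ A, ∀ b : Euc n, ‖b‖ ≤ 1 → ‖(1 - ρ l) • a + ρ l • b - a‖ ≤ |ρ l| * (R + 1) := by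
    intro a ha b hb
    have : (1 - ρ l) • a + ρ l • b - a = ρ l • (b - a) := by module
    rw [this, norm_smul, Real.norm_eq_abs]
    refine mul_le_mul_of_nonneg_left ?_ (abs_nonneg _)
    have := norm_sub_le b a
    have := hR a ha
    linarith
  refine dist_le_of_subset (by positivity) (fun x hx => ?_) (fun a ha => ?_)
  · obtain ⟨a, ha, b, hb, rfl⟩ := mem_rounding.1 hx
    exact ⟨a, ha, key a ha b hb⟩
  · refine ⟨(1 - ρ l) • a + ρ l • (0 : Euc n), mem_rounding.2 ⟨a, ha, 0, by simp, rfl⟩, ?_⟩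
    rw [norm_sub_rev]
    exact key a ha 0 (by simp)

end Rounding
end LpSteiner

namespace LpSteiner

/-! ### Limits of sums of powers. -/

section Asymptotics

/-- A sum of powers of `l` with convergent coefficients. -/
noncomputable def powerSum (k : ℕ) (s : ℝ) (A : ℕ → ℝ) (c : ℕ → ℕ → ℝ) (l : ℕ) : ℝ :=
  ∑ m ∈ Finset.range (k + 1), (l : ℝ) ^ ((m : ℝ) - s) * A m * c m l

theorem tendsto_natCast_rpow_neg {t : ℝ} (ht : t < 0) :
    Tendsto (fun l : ℕ => (l : ℝ) ^ t) atTop (𝓝 0) := by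
  have h := (tendsto_rpow_neg_atTop (neg_pos.2 ht)).comp tendsto_natCast_atTop_atTop
  simpa [Function.comp_def] using h

/-- No coefficient beyond `M` is present, and after division by `l^(M - s)` every lower term carries
a negative power of `l`. -/
theorem tendsto_powerSum_lead {k M : ℕ} (hM : M ≤ k) {s : ℝ} {A : ℕ → ℝ}
    (hA : ∀ m, M < m → m ≤ k → A m = 0) {c : ℕ → ℕ → ℝ} {c₀ : ℕ → ℝ}
    (hc : ∀ m, Tendsto (c m) atTop (𝓝 (c₀ m))) :
    Tendsto (fun l : ℕ => (l : ℝ) ^ (s - M) * powerSum k s A c l) atTop (𝓝 (A M * c₀ M)) := by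
  have hterm : ∀ m ∈ Finset.range (k + 1), Tendsto (fun l : ℕ =>
      (l : ℝ) ^ ((m : ℝ) - M) * A m * c m l) atTop (𝓝 (if m = M then A M * c₀ M else 0)) := by
    intro m hm
    rcases lt_trichotomy m M with h | h | h
    · rw [if_neg h.ne]
      have h1 := tendsto_natCast_rpow_neg (t := (m : ℝ) - M) (by
        rw [sub_neg]; exact_mod_cast h)
      simpa using (h1.mul_const (A m)).mul (hc m)
    · subst h
      rw [if_pos rfl]
      simpa using (hc m).const_mul (A m)
    · rw [hA m h (by simpa [Nat.lt_succ_iff] using hm), if_neg h.ne']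
      simp
  have h1 := tendsto_finsetSum _ hterm
  rw [Finset.sum_ite_eq' (Finset.range (k + 1)), if_pos (Finset.mem_range.2 (by omega))] at h1
  refine h1.congr' ?_
  filter_upwards [eventually_ge_atTop 1] with l hl
  have hl' : (0 : ℝ) < l := by exact_mod_cast hl
  rw [powerSum, Finset.mul_sum]
  refine Finset.sum_congr rfl fun m _ => ?_
  rw [← mul_assoc, ← mul_assoc, ← Real.rpow_add hl']
  congr 3
  ring

theorem tendsto_powerSum_atTop {k M : ℕ} (hM : M ≤ k) {s : ℝ} {A : ℕ → ℝ}
    (hA : ∀ m, M < m → m ≤ k → A m = 0) {c : ℕ → ℕ → ℝ} {c₀ : ℕ → ℝ}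
    (hc : ∀ m, Tendsto (c m) atTop (𝓝 (c₀ m))) (hs : s < M) (hpos : 0 < A M * c₀ M) :
    Tendsto (powerSum k s A c) atTop atTop := by
  have h1 := tendsto_powerSum_lead hM hA hc (s := s)
  have h2 : Tendsto (fun l : ℕ => (l : ℝ) ^ ((M : ℝ) - s)) atTop atTop :=
    (tendsto_rpow_atTop (sub_pos.2 hs)).comp tendsto_natCast_atTop_atTop
  refine (h2.atTop_mul_pos hpos h1).congr' ?_
  filter_upwards [eventually_ge_atTop 1] with l hl
  have hl' : (0 : ℝ) < l := by exact_mod_cast hl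
  rw [← mul_assoc, ← Real.rpow_add hl']
  simp

theorem powerSum_neg (k : ℕ) (s : ℝ) (A : ℕ → ℝ) (c : ℕ → ℕ → ℝ) (l : ℕ) :
    powerSum k s (fun m => -A m) c l = -powerSum k s A c l := by
  simp [powerSum]

theorem tendsto_powerSum_atBot {k M : ℕ} (hM : M ≤ k) {s : ℝ} {A : ℕ → ℝ}
    (hA : ∀ m, M < m → m ≤ k → A m = 0) {c : ℕ → ℕ → ℝ} {c₀ : ℕ → ℝ}
    (hc : ∀ m, Tendsto (c m) atTop (𝓝 (c₀ m))) (hs : s < M) (hneg : A M * c₀ M < 0) :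
    Tendsto (powerSum k s A c) atTop atBot := by
  have h := tendsto_powerSum_atTop (A := fun m => -A m) hM
    (fun m h1 h2 => by rw [hA m h1 h2, neg_zero]) hc hs (by linarith)
  rw [← tendsto_neg_atTop_iff]
  exact h.congr fun l => powerSum_neg k s A c l

theorem tendsto_powerSum_of_eq {k M : ℕ} (hM : M ≤ k) {s : ℝ} {A : ℕ → ℝ}
    (hA : ∀ m, M < m → m ≤ k → A m = 0) {c : ℕ → ℕ → ℝ} {c₀ : ℕ → ℝ}
    (hc : ∀ m, Tendsto (c m) atTop (𝓝 (c₀ m))) (hs : s = M) :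
    Tendsto (powerSum k s A c) atTop (𝓝 (A M * c₀ M)) := by
  refine (tendsto_powerSum_lead hM hA hc (s := s)).congr fun l => ?_
  rw [hs, sub_self, Real.rpow_zero, one_mul]

theorem tendsto_powerSum_of_lt {k M : ℕ} (hM : M ≤ k) {s : ℝ} {A : ℕ → ℝ}
    (hA : ∀ m, M < m → m ≤ k → A m = 0) {c : ℕ → ℕ → ℝ} {c₀ : ℕ → ℝ}
    (hc : ∀ m, Tendsto (c m) atTop (𝓝 (c₀ m))) (hs : M < s) :
    Tendsto (powerSum k s A c) atTop (𝓝 0) := by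
  have h1 := (tendsto_natCast_rpow_neg (sub_neg.2 hs)).mul
    (tendsto_powerSum_lead hM hA hc (s := s))
  rw [zero_mul] at h1
  refine h1.congr' ?_
  filter_upwards [eventually_ge_atTop 1] with l hl
  have hl' : (0 : ℝ) < l := by exact_mod_cast hl
  rw [← mul_assoc, ← Real.rpow_add hl']
  simp

/-- The limit of such a sum depends only on the limits of the coefficients. -/
theorem exists_tendsto_powerSum (k : ℕ) (s : ℝ) (A : ℕ → ℝ) {c₀ : ℕ → ℝ} (hpos : ∀ m, 0 < c₀ m) :
    ∃ L : EReal, ∀ c : ℕ → ℕ → ℝ, (∀ m, Tendsto (c m) atTop (𝓝 (c₀ m))) →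
      Tendsto (fun l => (powerSum k s A c l : EReal)) atTop (𝓝 L) := by
  classical
  by_cases hex : ∃ m, m ≤ k ∧ A m ≠ 0
  · obtain ⟨m₀, hm₀⟩ := hex
    -- The last nonzero coefficient decides the limit, through its sign and the comparison of `s`
    -- with `M`; neither involves `c`.
    set M := Nat.findGreatest (fun m => A m ≠ 0) k with hMdef
    have hM : M ≤ k := Nat.findGreatest_le k
    have hAM : A M ≠ 0 := Nat.findGreatest_spec (P := fun m => A m ≠ 0) hm₀.1 hm₀.2
    have hA : ∀ m, M < m → m ≤ k → A m = 0 := fun m h1 h2 => by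
      have := Nat.findGreatest_is_greatest h1 h2
      simpa using this
    rcases lt_trichotomy s M with h | h | h
    · rcases lt_or_gt_of_ne hAM with h' | h'
      · exact ⟨⊥, fun c hc => EReal.tendsto_coe_atBot.comp
          (tendsto_powerSum_atBot hM hA hc h (mul_neg_of_neg_of_pos h' (hpos M)))⟩
      · exact ⟨⊤, fun c hc => EReal.tendsto_coe_atTop.comp
          (tendsto_powerSum_atTop hM hA hc h (mul_pos h' (hpos M)))⟩
    · exact ⟨((A M * c₀ M : ℝ) : EReal), fun c hc =>
        (continuous_coe_real_ereal.tendsto _).comp (tendsto_powerSum_of_eq hM hA hc h)⟩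
    · exact ⟨((0 : ℝ) : EReal), fun c hc =>
        (continuous_coe_real_ereal.tendsto _).comp (tendsto_powerSum_of_lt hM hA hc h)⟩
  · push Not at hex
    refine ⟨((0 : ℝ) : EReal), fun c _ => tendsto_const_nhds.congr fun l => ?_⟩
    rw [powerSum, Finset.sum_eq_zero]
    intro m hm
    rw [hex m (by simpa [Nat.lt_succ_iff] using hm)]
    ring

end Asymptotics

/-! ### Integrals over the positive part of the sphere. -/

section PositiveSphere

variable {n : ℕ}

theorem exists_dropCoord (hn : 1 ≤ n) (y : Euc (n - 1)) (t : ℝ) : ∃ x : Euc n, dropCoord n x = y ∧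
    x ⟨0, by omega⟩ = t ∧ ‖x‖ ^ 2 = t ^ 2 + ‖y‖ ^ 2 := by
  obtain ⟨d, rfl⟩ := Nat.exists_eq_add_of_le' hn
  refine ⟨WithLp.toLp 2 (Fin.cons t fun j : Fin d => y j), ?_, rfl, ?_⟩
  · ext j
    rfl
  · rw [EuclideanSpace.norm_sq_eq, EuclideanSpace.norm_sq_eq, Fin.sum_univ_succ]
    simp only [Fin.cons_zero, Fin.cons_succ, Real.norm_eq_abs, sq_abs]
    rfl

/-- Coordinates of a unit vector dominate their squares. This keeps the bases of the real powers
over the sphere away from zero. -/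
theorem one_le_sum_of_norm_eq_one {ξ : Euc n} (h : ‖ξ‖ = 1) : 1 ≤ ∑ i, |ξ i| := by
  have h1 := EuclideanSpace.norm_sq_eq ξ
  rw [h, one_pow] at h1
  rw [h1]
  refine Finset.sum_le_sum fun i _ => ?_
  have h2 := PiLp.norm_apply_le ξ i
  rw [h] at h2
  rw [Real.norm_eq_abs] at h2 ⊢
  nlinarith [abs_nonneg (ξ i)]

theorem sum_le_of_norm_eq_one {ξ : Euc n} (h : ‖ξ‖ = 1) : ∑ i, |ξ i| ≤ n := by
  have : ∑ i, |ξ i| ≤ ∑ _i : Fin n, (1 : ℝ) := Finset.sum_le_sum fun i _ => by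
    have h2 := PiLp.norm_apply_le ξ i
    rwa [h, Real.norm_eq_abs] at h2
  simpa using this

theorem isClosed_positiveSphere : IsClosed (positiveSphere n) := by
  have : positiveSphere n = {ξ | ‖ξ‖ = 1} ∩ ⋂ i, {ξ : Euc n | 0 ≤ ξ i} := by
    ext; simp [positiveSphere]
  rw [this]
  exact (isClosed_eq continuous_norm continuous_const).inter
    (isClosed_iInter fun i => isClosed_le continuous_const (by fun_prop))

theorem measure_positiveSphere_lt_top (hn : 1 ≤ n) : μHE[n - 1] (positiveSphere n) < ⊤ :=
  (measure_mono fun ξ hξ => by simpa using hξ.1).trans_lt (measure_sphere_lt_top hn)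

theorem measure_positiveSphere_pos (hn : 1 ≤ n) : 0 < μHE[n - 1] (positiveSphere n) := by
  have hn0 : (0 : ℝ) < n := by exact_mod_cast hn
  refine lt_of_lt_of_le ?_ (volume_box_le_of_subset_image (fun _ => 0) (fun _ => 1 / (n : ℝ)) ?_)
  · rw [CanonicallyOrderedAdd.prod_pos]
    intro _ _
    simpa using Nat.lt_of_lt_of_le Nat.zero_lt_one hn
  · intro y hy
    have hy1 : ‖y‖ ^ 2 ≤ 1 := by
      rw [EuclideanSpace.norm_sq_eq]
      calc ∑ i, ‖y i‖ ^ 2 ≤ ∑ _i : Fin (n - 1), (1 / (n : ℝ)) := by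
            refine Finset.sum_le_sum fun i _ => ?_
            rw [Real.norm_eq_abs, sq_abs]
            have h1 : (1 / (n : ℝ)) ≤ 1 := by
              rw [div_le_one hn0]; exact_mod_cast hn
            nlinarith [(hy i).1, (hy i).2]
        _ = ((n - 1 : ℕ) : ℝ) * (1 / n) := by simp
        _ ≤ n * (1 / n) := by
            refine mul_le_mul_of_nonneg_right ?_ (by positivity)
            exact_mod_cast Nat.sub_le n 1
        _ = 1 := by field_simp
    obtain ⟨x, hx, hx0, hxn⟩ := exists_dropCoord hn y √(1 - ‖y‖ ^ 2)
    refine ⟨x, ⟨?_, fun i => ?_⟩, hx⟩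
    · rw [Real.sq_sqrt (by linarith), sub_add_cancel] at hxn
      nlinarith [norm_nonneg x]
    · rcases i with ⟨_ | i, hi⟩
      · rw [hx0]; positivity
      · have := (hy ⟨i, by omega⟩).1
        rw [← hx] at this
        exact this

/-- A bounded function of a measurable map is integrable on sets of finite measure. -/
theorem integrableOn_comp_of_mapsTo {Y : Type*} [TopologicalSpace Y] {d : ℕ} {s : Set (Euc n)}
    (hs : MeasurableSet s) (hfin : μHE[d] s < ⊤) {g : Euc n → Y} {φ : Y → ℝ} {S : Set Y}
    (hS : IsCompact S)
    (hφ : ContinuousOn φ S) (hg : Set.MapsTo g s S) (hm : Measurable fun x => φ (g x)) :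
    IntegrableOn (fun x => φ (g x)) s μHE[d] := by
  obtain ⟨B, hB⟩ := hS.exists_bound_of_continuousOn hφ
  refine Measure.integrableOn_of_bounded hfin.ne hm.aestronglyMeasurable (M := B) ?_
  rw [ae_restrict_iff' hs]
  exact Eventually.of_forall fun x hx => hB _ (hg hx)

theorem sum_mem_Icc {ξ : Euc n} (hξ : ξ ∈ positiveSphere n) {r : ℝ} (hr : 0 ≤ r) (hr1 : r ≤ 1) :
    (1 - r) * ∑ i, ξ i + r ∈ Set.Icc (1 : ℝ) n := by
  have habs : ∑ i, |ξ i| = ∑ i, ξ i := Finset.sum_congr rfl fun i _ => abs_of_nonneg (hξ.2 i)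
  have h1 := one_le_sum_of_norm_eq_one hξ.1
  have h2 := sum_le_of_norm_eq_one hξ.1
  rw [habs] at h1 h2
  constructor <;> nlinarith

theorem continuousOn_rpow_Icc (e : ℝ) : ContinuousOn (fun t : ℝ => t ^ e) (Set.Icc 1 n) :=
  continuousOn_id.rpow_const fun t ht => Or.inl (by linarith [ht.1] : t ≠ 0)

/-- The integrals over `S_+` that appear in the asymptotics of the rounded cubes. -/
noncomputable def sphereIntegral (n : ℕ) (e r : ℝ) : ℝ :=
  ∫ ξ in positiveSphere n, ((1 - r) * ∑ i, ξ i + r) ^ e ∂μHE[n - 1]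

theorem sphereIntegral_zero (n : ℕ) (e : ℝ) : sphereIntegral n e 0 =
    ∫ ξ in positiveSphere n, (∑ i, ξ i) ^ e ∂μHE[n - 1] := by
  simp [sphereIntegral]

theorem integrableOn_sphereIntegral (hn : 1 ≤ n) (e : ℝ) {r : ℝ} (hr : 0 ≤ r) (hr1 : r ≤ 1) :
    IntegrableOn (fun ξ : Euc n => ((1 - r) * ∑ i, ξ i + r) ^ e) (positiveSphere n) μHE[n - 1] :=
  integrableOn_comp_of_mapsTo isClosed_positiveSphere.measurableSet
    (measure_positiveSphere_lt_top hn) (φ := fun t : ℝ => t ^ e)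
    (g := fun ξ : Euc n => (1 - r) * ∑ i, ξ i + r) isCompact_Icc (continuousOn_rpow_Icc e)
    (fun ξ hξ => sum_mem_Icc hξ hr hr1) (by
      refine Measurable.pow_const ?_ e
      exact (by fun_prop : Continuous fun ξ : Euc n => (1 - r) * ∑ i, ξ i + r).measurable)

theorem sphereIntegral_zero_pos (hn : 1 ≤ n) (e : ℝ) : 0 < sphereIntegral n e 0 := by
  rw [sphereIntegral, setIntegral_pos_iff_support_of_nonneg_ae]
  · refine lt_of_lt_of_le (measure_positiveSphere_pos hn) (measure_mono fun ξ hξ => ⟨?_, hξ⟩)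
    exact (Real.rpow_pos_of_pos (by linarith [(sum_mem_Icc hξ le_rfl zero_le_one).1]) _).ne'
  · rw [EventuallyLE, ae_restrict_iff' isClosed_positiveSphere.measurableSet]
    refine Eventually.of_forall fun ξ hξ => ?_
    exact Real.rpow_nonneg (by linarith [(sum_mem_Icc hξ le_rfl zero_le_one).1]) _
  · exact integrableOn_sphereIntegral hn e le_rfl zero_le_one

/-- Dominated convergence: for `r ∈ [0, 1]` the base `(1 - r) ∑ ξ_i + r` stays in `[1, n]`. -/
theorem tendsto_sphereIntegral (hn : 1 ≤ n) (e : ℝ) :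
    Tendsto (fun l : ℕ => sphereIntegral n e (1 / l)) atTop (𝓝 (sphereIntegral n e 0)) := by
  obtain ⟨B, hB⟩ := isCompact_Icc.exists_bound_of_continuousOn (continuousOn_rpow_Icc (n := n) e)
  have hl1 : ∀ᶠ l : ℕ in atTop, (0 : ℝ) ≤ 1 / l ∧ 1 / (l : ℝ) ≤ 1 := by
    filter_upwards [eventually_ge_atTop 1] with l hl
    have hl' : (1 : ℝ) ≤ l := by exact_mod_cast hl
    exact ⟨by positivity, by rw [div_le_one (by linarith)]; exact hl'⟩
  refine tendsto_integral_filter_of_dominated_convergence (fun _ => B) ?_ ?_ ?_ ?_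
  · filter_upwards [hl1] with l hl
    exact (integrableOn_sphereIntegral hn e hl.1 hl.2).aestronglyMeasurable
  · filter_upwards [hl1] with l hl
    rw [ae_restrict_iff' isClosed_positiveSphere.measurableSet]
    exact Eventually.of_forall fun ξ hξ => hB _ (sum_mem_Icc hξ hl.1 hl.2)
  · exact integrableOn_const (measure_positiveSphere_lt_top hn).ne
  · rw [ae_restrict_iff' isClosed_positiveSphere.measurableSet]
    refine Eventually.of_forall fun ξ hξ => ?_
    have h0 := (sum_mem_Icc hξ le_rfl zero_le_one).1
    refine Tendsto.rpow_const ?_ (Or.inl (by linarith))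
    have h1 : Tendsto (fun l : ℕ => 1 / (l : ℝ)) atTop (𝓝 0) := tendsto_one_div_atTop_nhds_zero_nat
    exact ((tendsto_const_nhds.sub h1).mul_const _).add h1

end PositiveSphere
end LpSteiner

namespace LpSteiner

/-! ### Curvature and measure of the rounded cube. -/

section RoundedCube

variable {n : ℕ}

/-- The sign `±1` encoded by a Boolean. -/
noncomputable def boolSign (b : Bool) : ℝ := if b then 1 else -1

theorem abs_boolSign (b : Bool) : |boolSign b| = 1 := by
  cases b <;> simp [boolSign]

theorem boolSign_mul_self (b : Bool) : boolSign b * boolSign b = 1 := by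
  cases b <;> simp [boolSign]

/-- The vertices of the cube. -/
noncomputable def vertex (σ : Fin n → Bool) : Euc n := WithLp.toLp 2 fun i => boolSign (σ i)

/-- The open part of the unit sphere in the orthant of signs `σ`. -/
def orthantSphere (σ : Fin n → Bool) : Set (Euc n) :=
  {ξ | ‖ξ‖ = 1 ∧ ∀ i, 0 < boolSign (σ i) * ξ i}

/-- The part of the boundary of the rounded cube around the vertex of signs `σ`. -/
def cubeCorner (r : ℝ) (σ : Fin n → Bool) : Set (Euc n) :=
  (fun ξ => (1 - r) • vertex σ + r • ξ) '' orthantSphere σ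

theorem mem_cube {x : Euc n} : x ∈ cube n ↔ ∀ i, |x i| ≤ 1 := Iff.rfl

theorem zero_mem_cube : (0 : Euc n) ∈ cube n := mem_cube.2 fun i => by simp

theorem roundedCube_eq (n l : ℕ) : roundedCube n l = rounding (cube n) (1 / (l : ℝ)) := rfl

theorem measurableSet_orthantSphere (σ : Fin n → Bool) : MeasurableSet (orthantSphere σ) := by
  have : orthantSphere σ = {ξ | ‖ξ‖ = 1} ∩ ⋂ i, {ξ : Euc n | 0 < boolSign (σ i) * ξ i} := by
    ext; simp [orthantSphere]
  rw [this]
  exact (isClosed_eq continuous_norm continuous_const).measurableSet.inter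
    (MeasurableSet.iInter fun i => (isOpen_lt continuous_const (by fun_prop)).measurableSet)

theorem measurableSet_cubeCorner {r : ℝ} (hr : 0 < r) (σ : Fin n → Bool) :
    MeasurableSet (cubeCorner r σ) :=
  ((Homeomorph.smulOfNeZero r hr.ne').trans
    (Homeomorph.addLeft ((1 - r) • vertex σ))).measurableEmbedding.measurableSet_image.2
    (measurableSet_orthantSphere σ)

theorem vertex_mem_cube (σ : Fin n → Bool) : vertex σ ∈ cube n :=
  mem_cube.2 fun i => (abs_boolSign (σ i)).le

theorem inner_sub_vertex_nonpos {σ : Fin n → Bool} {ξ : Euc n} (hξ : ξ ∈ orthantSphere σ)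
    {a : Euc n} (ha : a ∈ cube n) : inner ℝ (a - vertex σ) ξ ≤ 0 := by
  rw [EuclideanSpace.inner_eq_star_dotProduct, dotProduct]
  refine Finset.sum_nonpos fun i _ => ?_
  have h1 := hξ.2 i
  have h2 := abs_le.1 (mem_cube.1 ha i)
  simp only [PiLp.sub_apply, star_trivial, vertex, boolSign, Pi.star_apply] at h1 ⊢
  split_ifs at h1 ⊢ <;> nlinarith

theorem cubeCorner_subset {r : ℝ} (hr : 0 < r) (hr1 : r ≤ 1) (σ : Fin n → Bool) :
    cubeCorner r σ ⊆ frontier (rounding (cube n) r : Set (Euc n)) := by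
  rintro _ ⟨ξ, hξ, rfl⟩
  exact mem_frontier_rounding hr hr1 (vertex_mem_cube σ) hξ.1
    fun a ha => inner_sub_vertex_nonpos hξ ha

theorem boolSign_mul_lt {r : ℝ} (hr : 0 < r) {σ : Fin n → Bool} {x : Euc n}
    (hx : x ∈ cubeCorner r σ) (i : Fin n) : 1 - r < boolSign (σ i) * x i := by
  obtain ⟨ξ, hξ, rfl⟩ := hx
  have h1 := hξ.2 i
  have h2 := boolSign_mul_self (σ i)
  simp only [PiLp.add_apply, PiLp.smul_apply, smul_eq_mul, vertex]
  nlinarith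

/-- A coordinate beyond `1 - r` forces the normal to have a component of that sign. If this happens
in every coordinate, the supporting point of the cube is the vertex. -/
theorem mem_cubeCorner_of_lt {r : ℝ} (hr : 0 < r) (hr1 : r < 1) {σ : Fin n → Bool} {x : Euc n}
    (hx : x ∈ frontier (rounding (cube n) r : Set (Euc n)))
    (h : ∀ i, 1 - r < boolSign (σ i) * x i) : x ∈ cubeCorner r σ := by
  obtain ⟨a, ha, u, hu, rfl, hau, -⟩ := exists_of_mem_frontier_rounding zero_mem_cube hr hr1 hx
  have hsu : ∀ i, 0 < boolSign (σ i) * u i := by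
    intro i
    have h1 := h i
    have h2 := abs_le.1 (mem_cube.1 ha i)
    simp only [PiLp.add_apply, PiLp.smul_apply, smul_eq_mul, boolSign] at h1 ⊢
    split_ifs at h1 ⊢ <;> nlinarith
  have hav : a = vertex σ := by
    have h1 := hau _ (vertex_mem_cube σ)
    rw [EuclideanSpace.inner_eq_star_dotProduct, dotProduct] at h1
    have hterm : ∀ i, 0 ≤ u.ofLp i * (star (vertex σ - a).ofLp) i := by
      intro i
      have h1 := hsu i
      have h2 := abs_le.1 (mem_cube.1 ha i)
      simp only [PiLp.sub_apply, star_trivial, vertex, boolSign, Pi.star_apply] at h1 ⊢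
      split_ifs at h1 ⊢ <;> nlinarith
    have h2 := (Finset.sum_eq_zero_iff_of_nonneg fun i _ => hterm i).1
      (le_antisymm h1 (Finset.sum_nonneg fun i _ => hterm i))
    ext i
    have h3 := h2 i (Finset.mem_univ i)
    have h4 : u i ≠ 0 := fun h0 => by simpa [h0] using hsu i
    rcases mul_eq_zero.1 h3 with h5 | h5
    · exact absurd h5 h4
    · simp only [PiLp.sub_apply, star_trivial, Pi.star_apply] at h5
      linarith
  rw [hav]
  exact ⟨u, ⟨hu, hsu⟩, rfl⟩

/-- Away from the corners some component of the normal vanishes, so the face of the cube in that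
direction contains a segment parallel to the corresponding axis. -/
theorem integrandW_eq_zero_of_notMem_cubeCorner {p : ℝ} (hn : 2 ≤ n) (hp : p < -n ∨ 0 ≤ p)
    (hp0 : p ≠ 0) {r : ℝ} (hr : 0 < r) (hr1 : r < 1) {x : Euc n}
    (hx : x ∈ frontier (rounding (cube n) r : Set (Euc n))) (hxc : ∀ σ, x ∉ cubeCorner r σ)
    (m k : ℕ) : integrandW p m k (rounding (cube n) r) x = 0 := by
  obtain ⟨a, ha, u, hu, rfl, hau, -⟩ := exists_of_mem_frontier_rounding zero_mem_cube hr hr1 hx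
  have hex : ∃ i, u i = 0 := by
    by_contra! hall
    refine hxc (fun i => decide (0 < u i)) (mem_cubeCorner_of_lt hr hr1 hx fun i => ?_)
    set σ : Fin n → Bool := fun i => decide (0 < u i) with hσ
    have hsu : 0 < boolSign (σ i) * u i := by
      rcases lt_or_gt_of_ne (hall i) with h | h
      · simp [hσ, boolSign, not_lt.2 h.le, h]
      · simp [hσ, boolSign, h]
    have hai : a i = boolSign (σ i) := by
      have h1 : a + (boolSign (σ i) - a i) • EuclideanSpace.single i (1 : ℝ) ∈ cube n := by
        refine mem_cube.2 fun j => ?_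
        by_cases hj : j = i
        · subst hj
          simp [abs_boolSign]
        · simpa [hj] using mem_cube.1 ha j
      have h2 := hau _ h1
      rw [add_sub_cancel_left, real_inner_smul_left, EuclideanSpace.inner_single_left] at h2
      simp only [map_one, one_mul] at h2
      have h3 := abs_le.1 (mem_cube.1 ha i)
      revert h2 hsu
      simp only [boolSign]
      split_ifs <;> intro h4 h5 <;> nlinarith
    simp only [PiLp.add_apply, PiLp.smul_apply, smul_eq_mul, hai]
    have h2 := boolSign_mul_self (σ i)
    nlinarith
  obtain ⟨i, hi⟩ := hex
  -- A unit step towards the opposite side keeps the `i`-th coordinate in `[-1, 1]`.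
  set t : ℝ := if a i ≤ 0 then 1 else -1 with ht
  have ht0 : t ≠ 0 := by rw [ht]; split_ifs <;> norm_num
  refine integrandW_rounding_eq_zero (a' := a + t • EuclideanSpace.single i (1 : ℝ)) hn hp hp0
    zero_mem_cube hr hr1 ha ?_ ?_ hu hau ?_ m k
  · refine mem_cube.2 fun j => ?_
    by_cases hj : j = i
    · subst hj
      have h3 := abs_le.1 (mem_cube.1 ha j)
      simp only [PiLp.add_apply, PiLp.smul_apply, smul_eq_mul, PiLp.single_apply, if_true,
        mul_one, abs_le, ht]
      split_ifs <;> constructor <;> linarith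
    · simpa [hj] using mem_cube.1 ha j
  · intro h
    have := congrArg (fun v : Euc n => v i) h
    simp [ht0] at this
  · rw [add_sub_cancel_left, real_inner_smul_left, EuclideanSpace.inner_single_left, hi]
    simp

theorem integrandW_cubeCorner {p : ℝ} (hn : 2 ≤ n) {r : ℝ} (hr : 0 < r) (hr1 : r < 1)
    {σ : Fin n → Bool} {ξ : Euc n} (hξ : ξ ∈ orthantSphere σ) (m k : ℕ) :
    integrandW p m k (rounding (cube n) r) ((1 - r) • vertex σ + r • ξ) =
      (1 / r) ^ ((m : ℝ) + (n - 1) * (p / (n + p))) * F n p m *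
      ((1 - r) * ∑ i, |ξ i| + r) ^ ((m : ℝ) - k + n * (1 - p) / (n + p)) := by
  have hau : ∀ a ∈ cube n, inner ℝ (a - vertex σ) ξ ≤ 0 := fun a ha => inner_sub_vertex_nonpos hξ ha
  have hN := outerNormal_rounding hr hr1.le (vertex_mem_cube σ) hξ.1 hau
  have hxF := mem_frontier_rounding hr hr1.le (vertex_mem_cube σ) hξ.1 hau
  have hxc : (1 - r) • vertex σ + r • ξ ∈ cubeCorner r σ := ⟨ξ, hξ, rfl⟩
  -- The inequalities characterizing a corner are open, so all boundary points near this one lie on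
  -- the same sphere of radius `r`.
  have hopen : IsOpen {y : Euc n | ∀ i, 1 - r < boolSign (σ i) * y i} := by
    have : {y : Euc n | ∀ i, 1 - r < boolSign (σ i) * y i} =
      ⋂ i, {y : Euc n | 1 - r < boolSign (σ i) * y i} := by ext; simp
    rw [this]
    exact isOpen_iInter_of_finite fun i => isOpen_lt continuous_const (by fun_prop)
  obtain ⟨i₀, hi₀⟩ := sphere_principalCurvature hn ⟨0, zero_mem_interior_rounding zero_mem_cube hr⟩
    (mem_of_mem_frontier hxF) (by rw [hN]; exact isOuterUnitNormal_rounding hr hr1.le hξ.1 hau)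
    (q := (1 - r) • vertex σ) hr (by rw [hN]) (by
      filter_upwards [self_mem_nhdsWithin, nhdsWithin_le_nhds
        (hopen.mem_nhds fun i => boolSign_mul_lt hr hxc i)] with y hy hy'
      obtain ⟨η, hη, rfl⟩ := mem_cubeCorner_of_lt hr hr1 hy hy'
      rw [add_sub_cancel_left, norm_smul, hη.1, Real.norm_of_nonneg hr.le, mul_one])
  rw [integrandW_eq_density hi₀, hN, density_self hn p m k _ (by positivity)]
  congr 2
  rw [inner_add_left, real_inner_smul_left, real_inner_smul_left, real_inner_self_eq_norm_sq, hξ.1,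
    one_pow, mul_one, EuclideanSpace.inner_eq_star_dotProduct, dotProduct]
  congr 2
  refine Finset.sum_congr rfl fun i _ => ?_
  have h1 := hξ.2 i
  have h3 : |ξ i| = boolSign (σ i) * ξ i := by
    rw [← abs_of_pos h1, abs_mul, abs_boolSign, one_mul]
  rw [h3]
  simp [vertex, mul_comm]

theorem disjoint_cubeCorner {r : ℝ} (hr : 0 < r) (hr1 : r ≤ 1) :
    Pairwise (Function.onFun Disjoint (cubeCorner (n := n) r)) := by
  intro σ τ hστ
  rw [Function.onFun, Set.disjoint_left]
  intro x hx hx'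
  apply hστ
  funext i
  have h1 := boolSign_mul_lt hr hx i
  have h2 := boolSign_mul_lt hr hx' i
  revert h1 h2
  simp only [boolSign]
  cases σ i <;> cases τ i <;> simp <;> intros <;> linarith

/-- The reflection with signs `σ`. -/
noncomputable def reflect (σ : Fin n → Bool) : Euc n ≃ₗᵢ[ℝ] Euc n :=
  LinearIsometryEquiv.piLpCongrRight 2 fun i =>
    if σ i then LinearIsometryEquiv.refl ℝ ℝ else LinearIsometryEquiv.neg ℝ

theorem reflect_apply (σ : Fin n → Bool) (ξ : Euc n) (i : Fin n) :
    reflect σ ξ i = boolSign (σ i) * ξ i := by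
  rw [reflect, LinearIsometryEquiv.piLpCongrRight_apply]
  change (if σ i then LinearIsometryEquiv.refl ℝ ℝ else LinearIsometryEquiv.neg ℝ) (ξ i) = _
  cases σ i <;> simp [boolSign]

/-- Reflections carry one orthant to another. The open and the closed orthant differ on the sphere
only within coordinate hyperplanes, which meet it in null sets. -/
theorem setIntegral_orthantSphere (hn : 1 ≤ n) (σ : Fin n → Bool) (ψ : Euc n → ℝ)
    (hψ : ∀ ξ, ψ (reflect σ ξ) = ψ ξ) :
    ∫ ξ in orthantSphere σ, ψ ξ ∂μHE[n - 1] = ∫ ξ in positiveSphere n, ψ ξ ∂μHE[n - 1] := by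
  have h1 : orthantSphere σ = reflect σ ⁻¹' (orthantSphere fun _ => true) := by
    ext ξ
    simp only [orthantSphere, Set.mem_preimage, Set.mem_ofPred_eq, LinearIsometryEquiv.norm_map,
      reflect_apply]
    simp [boolSign]
  have hmp := (reflect (n := n) σ).toIsometryEquiv.measurePreserving_euclideanHausdorffMeasure (n - 1)
  have h2 := hmp.setIntegral_preimage_emb
    (reflect (n := n) σ).toHomeomorph.measurableEmbedding ψ (orthantSphere fun _ => true)
  have h3 : ∫ ξ in orthantSphere σ, ψ ξ ∂μHE[n - 1] =
      ∫ ξ in orthantSphere fun _ => true, ψ ξ ∂μHE[n - 1] := by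
    rw [← h2, h1]
    refine setIntegral_congr_fun ?_ fun ξ _ => (hψ ξ).symm
    rw [← h1]
    exact measurableSet_orthantSphere σ
  rw [h3]
  refine setIntegral_congr_set ?_
  have hsub : orthantSphere (fun _ => true) ⊆ positiveSphere n := fun ξ hξ =>
    ⟨hξ.1, fun i => by simpa [boolSign] using (hξ.2 i).le⟩
  refine (LE.le.eventuallyLE hsub).antisymm ?_
  have hnull : ∀ i : Fin n, ∀ᵐ ξ ∂(μHE[n - 1] : Measure (Euc n)),
      ¬ (ξ ∈ Metric.sphere (0 : Euc n) 1 ∧ ξ i = 0) := by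
    intro i
    have := measure_frontier_inter_hyperplane hn (unitBall n) (u := EuclideanSpace.single i 1)
      (by simp) zero_mem_interior_unitBall
    rw [frontier_unitBall] at this
    have h4 := measure_eq_zero_iff_ae_notMem.1 this
    filter_upwards [h4] with ξ hξ hξ'
    exact hξ ⟨hξ'.1, by simp [EuclideanSpace.inner_single_right, hξ'.2]⟩
  filter_upwards [ae_all_iff.2 hnull] with ξ hξ hξ'
  refine ⟨hξ'.1, fun i => ?_⟩
  have h5 : ξ i ≠ 0 := fun h0 => hξ i ⟨by simpa using hξ'.1, h0⟩
  simpa [boolSign] using lt_of_le_of_ne (hξ'.2 i) h5.symm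

theorem integrableOn_cubeCorner {p : ℝ} (hn : 2 ≤ n) {r : ℝ} (hr : 0 < r) (hr1 : r < 1)
    (σ : Fin n → Bool) (m k : ℕ) :
    IntegrableOn (integrandW p m k (rounding (cube n) r)) (cubeCorner r σ) μHE[n - 1] := by
  set e := (m : ℝ) - k + n * (1 - p) / (n + p) with he
  set g : Euc n → ℝ := fun x => (1 - r) * ∑ i, |(r⁻¹ • (x - (1 - r) • vertex σ)) i| + r with hg
  have hgc : Continuous g := by
    rw [hg]
    fun_prop
  have h1 : IntegrableOn (fun x => (g x) ^ e) (cubeCorner r σ) μHE[n - 1] := by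
    refine integrableOn_comp_of_mapsTo (measurableSet_cubeCorner hr σ)
      ((measure_mono (cubeCorner_subset hr hr1.le σ)).trans_lt (measure_frontier_lt_top (by omega)
        ⟨0, zero_mem_interior_rounding zero_mem_cube hr⟩))
      (φ := fun t : ℝ => t ^ e) (isCompact_Icc (a := (1 : ℝ)) (b := n)) (continuousOn_rpow_Icc e) ?_
      (hgc.measurable.pow_const e)
    rintro _ ⟨ξ, hξ, rfl⟩
    rw [hg]
    simp only [add_sub_cancel_left, smul_smul, inv_mul_cancel₀ hr.ne', one_smul]
    have h1 := one_le_sum_of_norm_eq_one hξ.1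
    have h2 := sum_le_of_norm_eq_one hξ.1
    constructor <;> nlinarith
  refine IntegrableOn.congr_fun (h1.const_mul ((1 / r) ^ ((m : ℝ) + (n - 1) * (p / (n + p))) *
    F n p m)) ?_ (measurableSet_cubeCorner hr σ)
  rintro _ ⟨ξ, hξ, rfl⟩
  simp only
  rw [integrandW_cubeCorner hn hr hr1 hξ, hg]
  simp only [add_sub_cancel_left, smul_smul, inv_mul_cancel₀ hr.ne', one_smul]
  rw [he]

theorem setIntegral_cubeCorner {p : ℝ} (hn : 2 ≤ n) {r : ℝ} (hr : 0 < r) (hr1 : r < 1)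
    (σ : Fin n → Bool) (m k : ℕ) :
    ∫ x in cubeCorner r σ, integrandW p m k (rounding (cube n) r) x ∂μHE[n - 1] =
      r ^ (n - 1) * ((1 / r) ^ ((m : ℝ) + (n - 1) * (p / (n + p))) * F n p m *
        sphereIntegral n ((m : ℝ) - k + n * (1 - p) / (n + p)) r) := by
  rw [cubeCorner, setIntegral_homothety (n - 1) _ hr]
  congr 1
  rw [setIntegral_congr_fun (measurableSet_orthantSphere σ)
    fun ξ hξ => integrandW_cubeCorner hn hr hr1 hξ m k, integral_const_mul,
    setIntegral_orthantSphere (by omega) σ (fun ξ => ((1 - r) * ∑ i, |ξ i| + r) ^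
      ((m : ℝ) - k + n * (1 - p) / (n + p))) ?_, sphereIntegral]
  · congr 1
    refine setIntegral_congr_fun isClosed_positiveSphere.measurableSet fun ξ hξ => ?_
    have habs : ∑ i, |ξ i| = ∑ i, ξ i := Finset.sum_congr rfl fun i _ => abs_of_nonneg (hξ.2 i)
    simp only [habs]
  · intro ξ
    simp only [reflect_apply, abs_mul, abs_boolSign, one_mul]

theorem eq_of_notMem_iUnion_cubeCorner {p : ℝ} (hn : 2 ≤ n) (hp : p < -n ∨ 0 ≤ p)
    (hp0 : p ≠ 0) {r : ℝ} (hr : 0 < r) (hr1 : r < 1) (m k : ℕ) :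
    ∀ x ∈ frontier (rounding (cube n) r : Set (Euc n)) \ ⋃ σ, cubeCorner r σ,
      integrandW p m k (rounding (cube n) r) x = 0 := fun _ hx =>
  integrandW_eq_zero_of_notMem_cubeCorner hn hp hp0 hr hr1 hx.1
    (fun σ hσ => hx.2 (Set.mem_iUnion.2 ⟨σ, hσ⟩)) m k

theorem rounding_cube_mem_domainV {p : ℝ} (hn : 2 ≤ n) (hp : p < -n ∨ 0 ≤ p) (hp0 : p ≠ 0) {r : ℝ}
    (hr : 0 < r) (hr1 : r < 1) (k : ℕ) : rounding (cube n) r ∈ domainV n p k := by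
  refine ⟨zero_mem_interior_rounding zero_mem_cube hr, fun m _ => ?_⟩
  have h1 : IntegrableOn (integrandW p m k (rounding (cube n) r)) (⋃ σ, cubeCorner r σ)
      μHE[n - 1] := by
    rw [integrableOn_finite_iUnion]
    exact fun σ => integrableOn_cubeCorner hn hr hr1 σ m k
  exact h1.of_forall_sdiff_eq_zero isClosed_frontier.measurableSet
    (eq_of_notMem_iUnion_cubeCorner hn hp hp0 hr hr1 m k)

theorem W_rounding_cube {p : ℝ} (hn : 2 ≤ n) (hp : p < -n ∨ 0 ≤ p) (hp0 : p ≠ 0) {r : ℝ}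
    (hr : 0 < r) (hr1 : r < 1) (m k : ℕ) : W p m k (rounding (cube n) r) =
      2 ^ n * (r ^ (n - 1) * ((1 / r) ^ ((m : ℝ) + (n - 1) * (p / (n + p))) * F n p m *
        sphereIntegral n ((m : ℝ) - k + n * (1 - p) / (n + p)) r)) := by
  rw [W, setIntegral_eq_of_subset_of_forall_sdiff_eq_zero isClosed_frontier.measurableSet
    (Set.iUnion_subset fun σ => cubeCorner_subset hr hr1.le σ)
    (eq_of_notMem_iUnion_cubeCorner hn hp hp0 hr hr1 m k),
    integral_iUnion_fintype (measurableSet_cubeCorner hr) (disjoint_cubeCorner hr hr1.le)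
    fun σ => integrableOn_cubeCorner hn hr hr1 σ m k,
    Finset.sum_congr rfl fun σ _ => setIntegral_cubeCorner hn hr hr1 σ m k]
  simp

theorem roundedCube_one (n : ℕ) : roundedCube n 1 = unitBall n := by
  refine SetLike.coe_injective ?_
  ext x
  rw [SetLike.mem_coe, roundedCube_eq, mem_rounding]
  simp only [Nat.cast_one, div_one, sub_self, zero_smul, zero_add, one_smul]
  constructor
  · rintro ⟨a, -, b, hb, rfl⟩
    exact mem_closedBall_zero_iff.2 hb
  · intro hx
    exact ⟨0, zero_mem_cube, x, mem_closedBall_zero_iff.1 hx, rfl⟩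

theorem roundedCube_mem_domainV {p : ℝ} (hn : 2 ≤ n) (hp : p < -n ∨ 0 ≤ p) (hp0 : p ≠ 0) (k : ℕ)
    {l : ℕ} (hl : 1 ≤ l) : roundedCube n l ∈ domainV n p k := by
  -- For `l = 1` the body is the ball; the analysis of the corners needs `r < 1`.
  rcases hl.eq_or_lt with rfl | hl
  · rw [roundedCube_one]
    exact unitBall_mem_domainV hn p k
  · have hl' : (1 : ℝ) < l := by exact_mod_cast hl
    exact rounding_cube_mem_domainV hn hp hp0 (by positivity)
      (by rw [div_lt_one (by linarith)]; exact hl') k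

/-- The coefficients in the asymptotic expansion of `V` at the rounded cubes. -/
noncomputable def cubeCoeff (n : ℕ) (p : ℝ) (k m : ℕ) : ℝ :=
  2 ^ n * Ring.choose ((n : ℝ) * (1 - p) / (n + p)) (k - m) * F n p m

theorem V_roundedCube {p : ℝ} (hn : 2 ≤ n) (hp : p < -n ∨ 0 ≤ p) (hp0 : p ≠ 0) (k : ℕ) {l : ℕ}
    (hl : 2 ≤ l) : V p k (roundedCube n l) = powerSum k (n * (n - 1) / (n + p)) (cubeCoeff n p k)
      (fun m l => sphereIntegral n ((m : ℝ) - k + n * (1 - p) / (n + p)) (1 / l)) l := by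
  have hl' : (1 : ℝ) < l := by exact_mod_cast hl
  have hl0 : (0 : ℝ) < l := by linarith
  have hne := add_ne_zero_of_range hn hp
  rw [V, powerSum]
  refine Finset.sum_congr rfl fun m _ => ?_
  rw [roundedCube_eq, W_rounding_cube hn hp hp0 (by positivity)
    (by rw [div_lt_one (by linarith)]; exact hl') m k, cubeCoeff, one_div_one_div]
  -- Area scaling and curvature growth combine: `m + (n-1)p/(n+p) - (n-1) = m - n(n-1)/(n+p)`.
  have h1 : (1 / (l : ℝ)) ^ (n - 1) * (l : ℝ) ^ ((m : ℝ) + (n - 1) * (p / (n + p))) =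
      (l : ℝ) ^ ((m : ℝ) - n * (n - 1) / (n + p)) := by
    have h2 : (1 / (l : ℝ)) ^ (n - 1) = (l : ℝ) ^ (-((n : ℝ) - 1)) := by
      rw [one_div, inv_pow, Real.rpow_neg hl0.le, ← Real.rpow_natCast, Nat.cast_sub (by omega),
        Nat.cast_one]
    rw [h2, ← Real.rpow_add hl0]
    congr 1
    field_simp
    ring
  rw [← h1]
  ring

theorem cubeAsymptotics_eq (n : ℕ) (p : ℝ) (k l : ℕ) : cubeAsymptotics n p k l =
    powerSum k (n * (n - 1) / (n + p)) (cubeCoeff n p k)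
      (fun m _ => sphereIntegral n ((m : ℝ) - k + n * (1 - p) / (n + p)) 0) l := by
  rw [cubeAsymptotics, powerSum, Finset.mul_sum]
  refine Finset.sum_congr rfl fun m _ => ?_
  rw [sphereIntegral_zero, cubeCoeff]
  ring

end RoundedCube
end LpSteiner

namespace LpSteiner

/-! ### Orthogonal decomposition along an axis. -/

section Perp

variable {n : ℕ} {e : Euc n}

/-- The component of `x` orthogonal to `e`. -/
noncomputable def perp (e x : Euc n) : Euc n := x - (inner ℝ x e : ℝ) • e

theorem perp_add (e x y : Euc n) : perp e (x + y) = perp e x + perp e y := by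
  simp only [perp, inner_add_left]
  module

theorem perp_sub (e x y : Euc n) : perp e (x - y) = perp e x - perp e y := by
  simp only [perp, inner_sub_left]
  module

theorem perp_smul (e : Euc n) (t : ℝ) (x : Euc n) : perp e (t • x) = t • perp e x := by
  simp only [perp, real_inner_smul_left]
  module

theorem perp_add_smul (e x : Euc n) : perp e x + (inner ℝ x e : ℝ) • e = x := by
  rw [perp, sub_add_cancel]

theorem continuous_perp (e : Euc n) : Continuous (perp e) := by
  unfold perp
  fun_prop

theorem inner_self_of_norm_one (he : ‖e‖ = 1) : inner ℝ e e = (1 : ℝ) := by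
  rw [real_inner_self_eq_norm_sq, he, one_pow]

theorem inner_perp (he : ‖e‖ = 1) (x : Euc n) : inner ℝ (perp e x) e = 0 := by
  rw [perp, inner_sub_left, real_inner_smul_left, inner_self_of_norm_one he]
  ring

theorem perp_self (he : ‖e‖ = 1) : perp e e = 0 := by
  rw [perp, inner_self_of_norm_one he, one_smul, sub_self]

theorem perp_of_inner_eq_zero {x : Euc n} (h : inner ℝ x e = 0) : perp e x = x := by
  rw [perp, h, zero_smul, sub_zero]

theorem inner_perp_perp (he : ‖e‖ = 1) (x y : Euc n) :
    inner ℝ (perp e x) (perp e y) = inner ℝ (perp e x) y := by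
  conv_rhs => rw [← perp_add_smul e y]
  rw [inner_add_right, real_inner_smul_right, inner_perp he, mul_zero, add_zero]

theorem inner_eq_perp (he : ‖e‖ = 1) (x y : Euc n) :
    inner ℝ x y = inner ℝ (perp e x) (perp e y) + inner ℝ x e * inner ℝ y e := by
  rw [inner_perp_perp he]
  conv_lhs => rw [← perp_add_smul e x]
  rw [inner_add_left, real_inner_smul_left, real_inner_comm y e]

theorem norm_sq_eq_perp (he : ‖e‖ = 1) (x : Euc n) :
    ‖x‖ ^ 2 = ‖perp e x‖ ^ 2 + inner ℝ x e ^ 2 := by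
  rw [← real_inner_self_eq_norm_sq, inner_eq_perp he, real_inner_self_eq_norm_sq]
  ring

theorem norm_perp_le (he : ‖e‖ = 1) (x : Euc n) : ‖perp e x‖ ≤ ‖x‖ := by
  have := norm_sq_eq_perp he x
  nlinarith [norm_nonneg x, norm_nonneg (perp e x), sq_nonneg (inner ℝ x e : ℝ)]

theorem abs_inner_le_norm (he : ‖e‖ = 1) (x : Euc n) : |inner ℝ x e| ≤ ‖x‖ := by
  have := abs_real_inner_le_norm x e
  rwa [he, mul_one] at this

end Perp

/-! ### The cylinder and bodies that agree with it near the equator. -/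

section Cylinder

variable {n : ℕ} {e : Euc n}

/-- The cylinder with axis `e` over the unit ball of the orthogonal hyperplane. -/
noncomputable def cylinder (e : Euc n) (he : ‖e‖ = 1) : ConvexBody (Euc n) where
  carrier := {x | |inner ℝ x e| ≤ 1 ∧ ‖perp e x‖ ≤ 1}
  convex' := by
    rintro x ⟨hx1, hx2⟩ y ⟨hy1, hy2⟩ a b ha hb hab
    constructor
    · rw [inner_add_left, real_inner_smul_left, real_inner_smul_left]
      rw [abs_le] at *
      constructor <;> nlinarith
    · rw [perp_add, perp_smul, perp_smul]
      refine (norm_add_le _ _).trans ?_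
      rw [norm_smul, norm_smul, Real.norm_of_nonneg ha, Real.norm_of_nonneg hb]
      nlinarith
  isCompact' := by
    refine Metric.isCompact_of_isClosed_isBounded ?_ ?_
    · exact (isClosed_le (f := fun x : Euc n => |inner ℝ x e|) (by fun_prop) continuous_const).inter
        (isClosed_le (continuous_perp e).norm continuous_const)
    · refine (Metric.isBounded_iff_subset_closedBall 0).2 ⟨2, fun x hx => ?_⟩
      rw [mem_closedBall_zero_iff]
      have h1 := norm_sq_eq_perp he x
      have h2 := abs_le.1 hx.1
      nlinarith [norm_nonneg x, hx.2, norm_nonneg (perp e x)]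
  nonempty' := ⟨0, by simp [perp]⟩

theorem mem_cylinder (he : ‖e‖ = 1) {x : Euc n} :
    x ∈ cylinder e he ↔ |inner ℝ x e| ≤ 1 ∧ ‖perp e x‖ ≤ 1 := Iff.rfl

theorem zero_mem_cylinder (he : ‖e‖ = 1) : (0 : Euc n) ∈ cylinder e he := by
  simp [mem_cylinder, perp]

theorem mem_cylinder_of_norm_le (he : ‖e‖ = 1) {x : Euc n} (hx : ‖x‖ ≤ 1) : x ∈ cylinder e he :=
  (mem_cylinder he).2 ⟨(abs_inner_le_norm he x).trans hx, (norm_perp_le he x).trans hx⟩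

theorem zero_mem_interior_cylinder (he : ‖e‖ = 1) :
    (0 : Euc n) ∈ interior (cylinder e he : Set (Euc n)) :=
  interior_mono (fun _ hx => mem_cylinder_of_norm_le he (mem_closedBall_zero_iff.1 hx))
    zero_mem_interior_unitBall

theorem rounding_cylinder_le (he : ‖e‖ = 1) {r : ℝ} (hr : 0 ≤ r) (hr1 : r ≤ 1) :
    rounding (cylinder e he) r ≤ cylinder e he := by
  intro x hx
  obtain ⟨a, ha, b, hb, rfl⟩ := mem_rounding.1 hx
  exact (cylinder e he).convex ha (mem_cylinder_of_norm_le he hb) (by linarith) hr (by ring)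

theorem mem_rounding_cylinder (he : ‖e‖ = 1) {r : ℝ} (hr1 : r < 1) {x : Euc n}
    (h1 : |inner ℝ x e| ≤ 1 - r) (h2 : ‖perp e x‖ ≤ 1) : x ∈ rounding (cylinder e he) r := by
  have h3 : 0 < 1 - r := by linarith
  refine mem_rounding.2 ⟨perp e x + ((1 - r)⁻¹ * inner ℝ x e) • e, ?_, perp e x, h2, ?_⟩
  · refine (mem_cylinder he).2 ⟨?_, ?_⟩
    · rw [inner_add_left, inner_perp he, real_inner_smul_left, inner_self_of_norm_one he, zero_add,
        mul_one, abs_mul, abs_inv, abs_of_pos h3, inv_mul_le_iff₀ h3, mul_one]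
      exact h1
    · rw [perp_add, perp_smul, perp_self he, smul_zero, add_zero,
        perp_of_inner_eq_zero (inner_perp he x)]
      exact h2
  · rw [smul_add, smul_smul, ← mul_assoc, mul_inv_cancel₀ h3.ne', one_mul]
    conv_lhs => rw [← perp_add_smul e x]
    module

/-- `K` agrees with the cylinder at heights up to `s`. -/
structure IsCylindrical (K : ConvexBody (Euc n)) (e : Euc n) (he : ‖e‖ = 1) (s : ℝ) : Prop where
  zero_mem : (0 : Euc n) ∈ interior (K : Set (Euc n))
  le : K ≤ cylinder e he
  mem : ∀ x, |inner ℝ x e| ≤ s → ‖perp e x‖ ≤ 1 → x ∈ K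

theorem isCylindrical_cylinder (he : ‖e‖ = 1) : IsCylindrical (cylinder e he) e he 1 :=
  ⟨zero_mem_interior_cylinder he, le_rfl, fun _ h1 h2 => ⟨h1, h2⟩⟩

theorem isCylindrical_rounding (he : ‖e‖ = 1) {r : ℝ} (hr : 0 < r) (hr1 : r < 1) :
    IsCylindrical (rounding (cylinder e he) r) e he (1 - r) :=
  ⟨zero_mem_interior_rounding (zero_mem_cylinder he) hr, rounding_cylinder_le he hr.le hr1.le,
    fun _ h1 h2 => mem_rounding_cylinder he hr1 h1 h2⟩

variable {K : ConvexBody (Euc n)} {s : ℝ} {he : ‖e‖ = 1} {x : Euc n}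

theorem isLittleO_sq_of_le_cube {f : Euc n → ℝ} {S : Set (Euc n)} {C : ℝ}
    (h : ∀ᶠ y in 𝓝[S] x, |f y| ≤ C * ‖y - x‖ ^ 3) :
    f =o[𝓝[S] x] fun y => ‖y - x‖ ^ 2 := by
  have h1 : f =O[𝓝[S] x] fun y => ‖y - x‖ * ‖y - x‖ ^ 2 := by
    refine Asymptotics.IsBigO.of_bound C (h.mono fun y hy => ?_)
    rw [Real.norm_eq_abs, Real.norm_of_nonneg (by positivity : 0 ≤ ‖y - x‖ * ‖y - x‖ ^ 2),
      ← pow_succ']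
    exact hy
  have h0 : Tendsto (fun y : Euc n => ‖y - x‖) (𝓝[S] x) (𝓝 0) := by
    have : Tendsto (fun y : Euc n => ‖y - x‖) (𝓝 x) (𝓝 ‖x - x‖) :=
      Continuous.tendsto (by fun_prop) x
    rw [sub_self, norm_zero] at this
    exact this.mono_left nhdsWithin_le_nhds
  refine h1.trans_isLittleO ?_
  have h2 := ((Asymptotics.isLittleO_one_iff ℝ).2 h0).mul_isBigO
    (Asymptotics.isBigO_refl (fun y : Euc n => ‖y - x‖ ^ 2) (𝓝[S] x))
  simpa using h2

/-- The lateral boundary of a cylindrical body. -/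
def lateral (e : Euc n) (s : ℝ) : Set (Euc n) := {x | |inner ℝ x e| < s ∧ ‖perp e x‖ = 1}

theorem IsCylindrical.mem_lateral (hK : IsCylindrical K e he s)
    (hx : x ∈ frontier (K : Set (Euc n))) (hxs : |inner ℝ x e| < s) : x ∈ lateral e s := by
  refine ⟨hxs, le_antisymm (hK.le (mem_of_mem_frontier hx)).2 ?_⟩
  by_contra! hlt
  refine hx.2 (mem_interior.2 ⟨{y | |inner ℝ y e| < s} ∩ {y | ‖perp e y‖ < 1},
    fun y hy => hK.mem y hy.1.le (le_of_lt hy.2), ?_, hxs, hlt⟩)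
  exact (isOpen_lt (by fun_prop) continuous_const).inter
    (isOpen_lt (continuous_perp e).norm continuous_const)

theorem IsCylindrical.isOuterUnitNormal (hK : IsCylindrical K e he s) (hx : x ∈ lateral e s) :
    IsOuterUnitNormal K x (perp e x) := by
  refine ⟨hx.2, fun y hy => ?_⟩
  have h1 := (hK.le hy).2
  have h2 := real_inner_le_norm (perp e y) (perp e x)
  rw [hx.2, mul_one] at h2
  rw [real_inner_comm, ← inner_perp_perp he, perp_sub, inner_sub_right,
    real_inner_self_eq_norm_sq, hx.2, real_inner_comm]
  linarith

theorem IsCylindrical.lateral_subset (hK : IsCylindrical K e he s) (hx : x ∈ lateral e s) :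
    x ∈ frontier (K : Set (Euc n)) :=
  (hK.isOuterUnitNormal hx).mem_frontier (hK.mem x hx.1.le hx.2.le) (by simp)

/-- Short moves along the axis in both directions stay in `K`, so a normal is orthogonal to the
axis. Comparison with the point in its own direction at the same height shows that it is radial. -/
theorem IsCylindrical.outerNormal_eq (hK : IsCylindrical K e he s) (hx : x ∈ lateral e s) :
    outerNormal K x = perp e x := by
  refine LpSteiner.outerNormal_eq (hK.isOuterUnitNormal hx) fun w hw => ?_
  -- the segments in the direction of the axis
  have hwe : inner ℝ w e = 0 := by
    have hsh : ∀ t : ℝ, |t| ≤ s - |inner ℝ x e| → t * inner ℝ w e ≤ 0 := by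
      intro t ht
      have hmem : x + t • e ∈ K := by
        refine hK.mem _ ?_ ?_
        · rw [inner_add_left, real_inner_smul_left, inner_self_of_norm_one he, mul_one]
          have := abs_add_le (inner ℝ x e) t
          linarith
        · rw [perp_add, perp_smul, perp_self he, smul_zero, add_zero]
          exact hx.2.le
      have h1 := hw.2 _ hmem
      rwa [add_sub_cancel_left, real_inner_smul_left, real_inner_comm] at h1
    have hpos : 0 < s - |inner ℝ x e| := sub_pos.2 hx.1
    have h1 := hsh (s - |inner ℝ x e|) (by rw [abs_of_pos hpos])
    have h2 := hsh (-(s - |inner ℝ x e|)) (by rw [abs_neg, abs_of_pos hpos])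
    have h3 := nonpos_of_mul_nonpos_right h1 hpos
    nlinarith
  have hpw : perp e w = w := perp_of_inner_eq_zero hwe
  have hmem : w + (inner ℝ x e : ℝ) • e ∈ K := by
    refine hK.mem _ ?_ ?_
    · rw [inner_add_left, real_inner_smul_left, inner_self_of_norm_one he, mul_one, hwe, zero_add]
      exact hx.1.le
    · rw [perp_add, perp_smul, perp_self he, smul_zero, add_zero, hpw, hw.1]
  have h1 := hw.2 _ hmem
  have h2 : w + (inner ℝ x e : ℝ) • e - x = w - perp e x := by
    rw [perp]; abel
  rw [h2, inner_sub_left, real_inner_self_eq_norm_sq, hw.1] at h1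
  have h3 := norm_sub_sq_real w (perp e x)
  rw [hw.1, hx.2, real_inner_comm] at h3
  have h4 : ‖w - perp e x‖ = 0 := by nlinarith [norm_nonneg (w - perp e x)]
  exact sub_eq_zero.1 (norm_eq_zero.1 h4)

/-- The error of the expansion is `‖perp e (y - x)‖⁴ / 8`, as on a unit sphere orthogonal to the
axis. -/
theorem IsCylindrical.principalCurvature_lateral (hn : 2 ≤ n) (hK : IsCylindrical K e he s)
    (hx : x ∈ lateral e s) : ∃ i₀, principalCurvature K x = fun i => if i = i₀ then 0 else 1 := by
  have hN := hK.outerNormal_eq hx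
  refine exists_principalCurvature_eq hn ⟨0, hK.zero_mem⟩ (hK.mem x hx.1.le hx.2.le)
    (by rw [hN]; exact hK.isOuterUnitNormal hx) he
    (by rw [hN, real_inner_comm]; exact inner_perp he x) ?_
  rw [hN]
  have hopen : IsOpen {y : Euc n | |inner ℝ y e| < s} := isOpen_lt (by fun_prop) continuous_const
  have hball : ∀ᶠ y in 𝓝 x, ‖y - x‖ < 1 := by
    filter_upwards [Metric.ball_mem_nhds x one_pos] with y hy using mem_ball_iff_norm.1 hy
  refine isLittleO_sq_of_le_cube (C := 1) ?_
  filter_upwards [self_mem_nhdsWithin, nhdsWithin_le_nhds (hopen.mem_nhds hx.1),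
    nhdsWithin_le_nhds hball] with y hy hys hyx
  have hyl := hK.mem_lateral hy hys
  have h1 : ‖perp e (y - x)‖ ^ 2 = -(2 * inner ℝ (y - x) (perp e x)) := by
    have h2 : perp e y = perp e (y - x) + perp e x := by rw [perp_sub, sub_add_cancel]
    have h3 := norm_add_sq_real (perp e (y - x)) (perp e x)
    rw [← h2, hyl.2, hx.2, inner_eq_perp he] at h3
    rw [inner_eq_perp he (y - x)]
    simp only [perp_of_inner_eq_zero (inner_perp he _), inner_perp he, mul_zero, add_zero] at h3 ⊢
    linarith
  have h4 := norm_sq_eq_perp he (y - x)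
  have h5 : inner ℝ (x - y) (perp e x) = - inner ℝ (y - x) (perp e x) := by
    rw [← inner_neg_left, neg_sub]
  have h6 : inner ℝ (x - y) (perp e x) - 1 / 2 *
      (twoForm 0 1 e (y - x) - 1 * inner ℝ (y - x) (perp e x) ^ 2) =
      1 / 8 * (‖perp e (y - x)‖ ^ 2) ^ 2 := by
    rw [twoForm, h5, h4, h1]
    ring
  have h7 := norm_perp_le he (y - x)
  rw [h6, abs_of_nonneg (by positivity), one_mul, ← pow_mul]
  norm_num only
  have h8 : ‖perp e (y - x)‖ ^ 4 ≤ ‖y - x‖ ^ 4 := pow_le_pow_left₀ (norm_nonneg _) h7 4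
  have h9 : ‖y - x‖ ^ 4 ≤ ‖y - x‖ ^ 3 := pow_le_pow_of_le_one (norm_nonneg _) hyx.le (by norm_num)
  have h10 : 0 ≤ ‖y - x‖ ^ 4 := by positivity
  linarith

theorem IsCylindrical.integrandW_lateral (hn : 2 ≤ n) (hK : IsCylindrical K e he s)
    (hx : x ∈ lateral e s) (p : ℝ) (m k : ℕ) : integrandW p m k K x = density n p m k 1 0 1 := by
  obtain ⟨i₀, hi₀⟩ := hK.principalCurvature_lateral hn hx
  rw [integrandW_eq_density hi₀, hK.outerNormal_eq hx, real_inner_comm, ← inner_perp_perp he,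
    real_inner_self_eq_norm_sq, hx.2, one_pow]

end Cylinder
end LpSteiner

namespace LpSteiner

/-! ### The rim of the rounded cylinder. -/

section Rim

variable {n : ℕ} {e : Euc n}

/-- The cylinder is the product of a segment and a ball, so maximality at `a` splits into maximality
of the axial and of the orthogonal component. -/
theorem support_cylinder (he : ‖e‖ = 1) {a u : Euc n} (ha : a ∈ cylinder e he)
    (hau : ∀ a' ∈ cylinder e he, inner ℝ (a' - a) u ≤ 0) :
    inner ℝ a e * inner ℝ u e = |inner ℝ u e| ∧
      inner ℝ (perp e a) (perp e u) = ‖perp e u‖ := by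
  have h1 : inner ℝ a e * inner ℝ u e ≤ |inner ℝ u e| := by
    refine (le_abs_self _).trans ?_
    rw [abs_mul]
    exact mul_le_of_le_one_left (abs_nonneg _) ha.1
  have h2 : inner ℝ (perp e a) (perp e u) ≤ ‖perp e u‖ :=
    (real_inner_le_norm _ _).trans (mul_le_of_le_one_left (norm_nonneg _) ha.2)
  obtain ⟨s, hs, hsu⟩ : ∃ s : ℝ, |s| = 1 ∧ s * inner ℝ u e = |inner ℝ u e| := by
    rcases abs_cases (inner ℝ u e : ℝ) with h | h
    · exact ⟨1, by norm_num, by rw [h.1, one_mul]⟩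
    · exact ⟨-1, by norm_num, by rw [h.1, neg_one_mul]⟩
  obtain ⟨w, hw, hwe, hwu⟩ : ∃ w : Euc n, ‖w‖ ≤ 1 ∧ inner ℝ w e = 0 ∧
      inner ℝ w (perp e u) = ‖perp e u‖ := by
    by_cases h0 : ‖perp e u‖ = 0
    · refine ⟨0, by simp, by simp, ?_⟩
      rw [h0, inner_zero_left]
    · refine ⟨‖perp e u‖⁻¹ • perp e u, ?_, ?_, ?_⟩
      · rw [norm_smul, norm_inv, norm_norm, inv_mul_cancel₀ h0]
      · rw [real_inner_smul_left, inner_perp he, mul_zero]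
      · rw [real_inner_smul_left, real_inner_self_eq_norm_sq, pow_two, ← mul_assoc,
          inv_mul_cancel₀ h0, one_mul]
  have h3 := hau (w + s • e) ((mem_cylinder he).2 ⟨by
    rw [inner_add_left, hwe, real_inner_smul_left, inner_self_of_norm_one he, zero_add, mul_one, hs],
    by rw [perp_add, perp_smul, perp_self he, smul_zero, add_zero, perp_of_inner_eq_zero hwe]
       exact hw⟩)
  rw [inner_sub_left, inner_eq_perp he a u, inner_eq_perp he _ u, perp_add, perp_smul,
    perp_self he, smul_zero, add_zero, perp_of_inner_eq_zero hwe, hwu, inner_add_left, hwe,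
    real_inner_smul_left, inner_self_of_norm_one he, zero_add, mul_one, hsu] at h3
  constructor <;> linarith

/-- The curved part of the boundary of the rounded cylinder at its two ends. -/
def rim (e : Euc n) (r : ℝ) : Set (Euc n) :=
  {x | 1 - r < |inner ℝ x e| ∧ 1 - r < ‖perp e x‖ ∧
    (‖perp e x‖ - (1 - r)) ^ 2 + (|inner ℝ x e| - (1 - r)) ^ 2 = r ^ 2}

/-- The radial component of the normal vector of the rounded cylinder at a point of the rim. -/
noncomputable def rimCos (e : Euc n) (r : ℝ) (x : Euc n) : ℝ := (‖perp e x‖ - (1 - r)) / r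

/-- The axial component of the normal vector of the rounded cylinder at a point of the rim, up to
its sign. -/
noncomputable def rimSin (e : Euc n) (r : ℝ) (x : Euc n) : ℝ := (|inner ℝ x e| - (1 - r)) / r

variable {r : ℝ} {x : Euc n}

theorem rimCos_sq_add (hr : 0 < r) (hx : x ∈ rim e r) :
    rimCos e r x ^ 2 + rimSin e r x ^ 2 = 1 := by
  rw [rimCos, rimSin, div_pow, div_pow, ← add_div, hx.2.2, div_self (by positivity)]

theorem rimCos_pos (hr : 0 < r) (hx : x ∈ rim e r) : 0 < rimCos e r x :=
  div_pos (sub_pos.2 hx.2.1) hr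

theorem rimSin_pos (hr : 0 < r) (hx : x ∈ rim e r) : 0 < rimSin e r x :=
  div_pos (sub_pos.2 hx.1) hr

theorem norm_perp_eq (hr : 0 < r) : ‖perp e x‖ = (1 - r) + r * rimCos e r x := by
  rw [rimCos]; field_simp; ring

theorem abs_inner_eq (hr : 0 < r) : |inner ℝ x e| = (1 - r) + r * rimSin e r x := by
  rw [rimSin]; field_simp; ring

theorem exists_sign (t : ℝ) : ∃ s : ℝ, s ^ 2 = 1 ∧ t = s * |t| := by
  rcases abs_cases t with h | h
  · exact ⟨1, by norm_num, by rw [h.1, one_mul]⟩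
  · exact ⟨-1, by norm_num, by rw [h.1]; ring⟩

/-- The normal vector of the rounded cylinder at a point of the rim. -/
noncomputable def rimNormal (e : Euc n) (r s : ℝ) (x : Euc n) : Euc n :=
  (rimCos e r x / ‖perp e x‖) • perp e x + (s * rimSin e r x) • e

/-- The direction of the principal curvature `1 / r` at a point of the rim. -/
noncomputable def rimTangent (e : Euc n) (r s : ℝ) (x : Euc n) : Euc n :=
  (-(rimSin e r x / ‖perp e x‖)) • perp e x + (s * rimCos e r x) • e

theorem inner_perp_add (a b : ℝ) (x d : Euc n) :
    inner ℝ d (a • perp e x + b • e) = a * inner ℝ d (perp e x) + b * inner ℝ d e := by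
  rw [inner_add_right, real_inner_smul_right, real_inner_smul_right]

theorem norm_sq_perp_add (he : ‖e‖ = 1) (a b : ℝ) (x : Euc n) :
    ‖a • perp e x + b • e‖ ^ 2 = a ^ 2 * ‖perp e x‖ ^ 2 + b ^ 2 := by
  rw [norm_sq_eq_perp he, perp_add, perp_smul, perp_smul, perp_self he, smul_zero, add_zero,
    perp_of_inner_eq_zero (inner_perp he x), norm_smul, mul_pow, Real.norm_eq_abs, sq_abs,
    inner_add_left, real_inner_smul_left, real_inner_smul_left, inner_perp he,
    inner_self_of_norm_one he]
  ring

theorem norm_rimNormal (he : ‖e‖ = 1) (hr : 0 < r) (hr1 : r < 1) (hx : x ∈ rim e r) {s : ℝ}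
    (hs : s ^ 2 = 1) : ‖rimNormal e r s x‖ = 1 := by
  have hS : 0 < ‖perp e x‖ := lt_trans (by linarith) hx.2.1
  have h : ‖rimNormal e r s x‖ ^ 2 = 1 := by
    rw [rimNormal, norm_sq_perp_add he, div_pow, div_mul_cancel₀ _ (by positivity), mul_pow, hs,
      one_mul, rimCos_sq_add hr hx]
  exact (pow_eq_one_iff_of_nonneg (norm_nonneg _) two_ne_zero).1 h

theorem norm_rimTangent (he : ‖e‖ = 1) (hr : 0 < r) (hr1 : r < 1) (hx : x ∈ rim e r) {s : ℝ}
    (hs : s ^ 2 = 1) : ‖rimTangent e r s x‖ = 1 := by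
  have hS : 0 < ‖perp e x‖ := lt_trans (by linarith) hx.2.1
  have h : ‖rimTangent e r s x‖ ^ 2 = 1 := by
    rw [rimTangent, norm_sq_perp_add he, neg_sq, div_pow, div_mul_cancel₀ _ (by positivity),
      mul_pow, hs, one_mul, add_comm, rimCos_sq_add hr hx]
  exact (pow_eq_one_iff_of_nonneg (norm_nonneg _) two_ne_zero).1 h

theorem inner_rimTangent_rimNormal (he : ‖e‖ = 1) (hr1 : r < 1) (hx : x ∈ rim e r) {s : ℝ}
    (hs : s ^ 2 = 1) : inner ℝ (rimTangent e r s x) (rimNormal e r s x) = 0 := by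
  have hS : ‖perp e x‖ ≠ 0 := (lt_trans (by linarith) hx.2.1).ne'
  rw [rimNormal, inner_perp_add, rimTangent, inner_add_left, inner_add_left,
    real_inner_smul_left, real_inner_smul_left, real_inner_smul_left, real_inner_smul_left,
    real_inner_self_eq_norm_sq, inner_perp he, inner_self_of_norm_one he,
    real_inner_comm, inner_perp he]
  field_simp
  linear_combination (rimSin e r x * rimCos e r x * ‖perp e x‖) * hs

theorem inner_rimNormal (he : ‖e‖ = 1) (hr : 0 < r) (hr1 : r < 1) (hx : x ∈ rim e r) {s : ℝ}
    (hs : s ^ 2 = 1) (hsx : inner ℝ x e = s * |inner ℝ x e|) :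
    inner ℝ x (rimNormal e r s x) = (1 - r) * (rimCos e r x + rimSin e r x) + r := by
  have hS : ‖perp e x‖ ≠ 0 := (lt_trans (by linarith) hx.2.1).ne'
  rw [rimNormal, inner_perp_add, real_inner_comm, ← inner_perp_perp he,
    real_inner_self_eq_norm_sq, hsx]
  have h1 : rimCos e r x / ‖perp e x‖ * ‖perp e x‖ ^ 2 = rimCos e r x * ‖perp e x‖ := by
    field_simp
  rw [h1, norm_perp_eq hr, abs_inner_eq hr]
  linear_combination (rimSin e r x * (1 - r + r * rimSin e r x)) * hs + r * rimCos_sq_add hr hx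

/-- A rim point is at distance `r` from the edge of the cylinder shrunk by `1 - r`. The witness `a`
is the corresponding edge point of the full cylinder. -/
theorem exists_rim_decomposition (he : ‖e‖ = 1) (hr : 0 < r) (hr1 : r < 1) (hx : x ∈ rim e r)
    {s : ℝ} (hs : s ^ 2 = 1) (hsx : inner ℝ x e = s * |inner ℝ x e|) :
    ∃ a ∈ cylinder e he, x = (1 - r) • a + r • rimNormal e r s x ∧
      ∀ a' ∈ cylinder e he, inner ℝ (a' - a) (rimNormal e r s x) ≤ 0 := by
  have hS : 0 < ‖perp e x‖ := lt_trans (by linarith) hx.2.1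
  have hs1 : |s| = 1 := by
    rw [← sq_abs] at hs
    exact (pow_eq_one_iff_of_nonneg (abs_nonneg _) two_ne_zero).1 hs
  refine ⟨‖perp e x‖⁻¹ • perp e x + s • e, ?_, ?_, fun a' ha' => ?_⟩
  · refine (mem_cylinder he).2 ⟨?_, ?_⟩
    · rw [inner_add_left, real_inner_smul_left, real_inner_smul_left, inner_perp he,
        inner_self_of_norm_one he, mul_zero, zero_add, mul_one, hs1]
    · rw [perp_add, perp_smul, perp_smul, perp_self he, smul_zero, add_zero,
        perp_of_inner_eq_zero (inner_perp he x), norm_smul, norm_inv, norm_norm,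
        inv_mul_cancel₀ hS.ne']
  · have h1 : (1 - r) * ‖perp e x‖⁻¹ + r * (rimCos e r x / ‖perp e x‖) = 1 := by
      rw [rimCos]; field_simp; ring
    have h2 : (1 - r) * s + r * (s * rimSin e r x) = inner ℝ x e := by
      rw [hsx, abs_inner_eq hr]; ring
    have h3 : x = ((1 - r) * ‖perp e x‖⁻¹ + r * (rimCos e r x / ‖perp e x‖)) • perp e x +
        ((1 - r) * s + r * (s * rimSin e r x)) • e := by
      rw [h1, h2, one_smul, perp_add_smul]
    refine h3.trans ?_
    rw [rimNormal]
    module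
  · rw [rimNormal, inner_perp_add, inner_sub_left, inner_sub_left, inner_add_left,
      inner_add_left, real_inner_smul_left, real_inner_smul_left, real_inner_smul_left,
      real_inner_smul_left, real_inner_self_eq_norm_sq, inner_perp he, inner_self_of_norm_one he,
      real_inner_comm (perp e x) e, inner_perp he]
    have h1 : inner ℝ a' (perp e x) ≤ ‖perp e x‖ := by
      rw [real_inner_comm, ← inner_perp_perp he, real_inner_comm]
      exact (real_inner_le_norm _ _).trans (mul_le_of_le_one_left (norm_nonneg _) ha'.2)
    have h2 : s * inner ℝ a' e ≤ 1 := by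
      refine (le_abs_self _).trans ?_
      rw [abs_mul, hs1, one_mul]
      exact ha'.1
    have h3 : rimCos e r x / ‖perp e x‖ *
        (inner ℝ a' (perp e x) - (‖perp e x‖⁻¹ * ‖perp e x‖ ^ 2 + s * 0)) ≤ 0 := by
      refine mul_nonpos_of_nonneg_of_nonpos (div_nonneg (rimCos_pos hr hx).le hS.le) ?_
      have : ‖perp e x‖⁻¹ * ‖perp e x‖ ^ 2 = ‖perp e x‖ := by field_simp
      rw [this]; linarith
    have h4 : s * rimSin e r x * (inner ℝ a' e - (‖perp e x‖⁻¹ * 0 + s * 1)) ≤ 0 := by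
      have h5 := rimSin_pos hr hx
      have : s * rimSin e r x * (inner ℝ a' e - (‖perp e x‖⁻¹ * 0 + s * 1)) =
        rimSin e r x * (s * inner ℝ a' e - s ^ 2) := by ring
      rw [this, hs]
      nlinarith
    linarith

theorem rim_subset_frontier (he : ‖e‖ = 1) (hr : 0 < r) (hr1 : r < 1) :
    rim e r ⊆ frontier (rounding (cylinder e he) r : Set (Euc n)) := by
  intro x hx
  obtain ⟨s, hs, hsx⟩ := exists_sign (inner ℝ x e)
  obtain ⟨a, ha, hxa, hau⟩ := exists_rim_decomposition he hr hr1 hx hs hsx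
  rw [hxa]
  exact mem_frontier_rounding hr hr1.le ha (norm_rimNormal he hr hr1 hx hs) hau

theorem outerNormal_rim (he : ‖e‖ = 1) (hr : 0 < r) (hr1 : r < 1) (hx : x ∈ rim e r)
    {s : ℝ} (hs : s ^ 2 = 1) (hsx : inner ℝ x e = s * |inner ℝ x e|) :
    outerNormal (rounding (cylinder e he) r) x = rimNormal e r s x := by
  obtain ⟨a, ha, hxa, hau⟩ := exists_rim_decomposition he hr hr1 hx hs hsx
  conv_lhs => rw [hxa]
  exact outerNormal_rounding hr hr1.le ha (norm_rimNormal he hr hr1 hx hs) hau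

/-- At such a height the normal `u` has a nonzero axial component. If its radial component vanishes,
the point is on a flat end. Otherwise the supporting point is on the edge, and the equation of the
rim is `‖u‖ = 1`. -/
theorem mem_rim_or (he : ‖e‖ = 1) (hr : 0 < r) (hr1 : r < 1)
    (hx : x ∈ frontier (rounding (cylinder e he) r : Set (Euc n))) (hxr : 1 - r < |inner ℝ x e|) :
    |inner ℝ x e| = 1 ∨ x ∈ rim e r := by
  obtain ⟨a, ha, u, hu, rfl, hau, -⟩ := exists_of_mem_frontier_rounding (zero_mem_cylinder he) hr
    hr1 hx
  obtain ⟨h1, h2⟩ := support_cylinder he ha hau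
  have hu2 := norm_sq_eq_perp he u
  rw [hu, one_pow] at hu2
  have h3 : |inner ℝ ((1 - r) • a + r • u) e| = (1 - r) + r * |inner ℝ u e| ∧ inner ℝ u e ≠ 0 := by
    have ha1 := ha.1
    rw [inner_add_left, real_inner_smul_left, real_inner_smul_left] at hxr ⊢
    have hne : inner ℝ u e ≠ 0 := by
      intro h0
      rw [h0, mul_zero, add_zero, abs_mul, abs_of_pos (by linarith : 0 < 1 - r)] at hxr
      nlinarith
    refine ⟨?_, hne⟩
    have h4 : (1 - r) * inner ℝ a e + r * inner ℝ u e =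
        (inner ℝ u e)⁻¹ * |inner ℝ u e| * (1 - r) + (inner ℝ u e)⁻¹ * (r * |inner ℝ u e| ^ 2) := by
      rw [← h1, h1, sq_abs]
      field_simp
      linear_combination (1 - r) * h1
    have h5 : (inner ℝ u e)⁻¹ * |inner ℝ u e| * (1 - r) +
        (inner ℝ u e)⁻¹ * (r * |inner ℝ u e| ^ 2) =
        (inner ℝ u e)⁻¹ * |inner ℝ u e| * ((1 - r) + r * |inner ℝ u e|) := by ring
    rw [h4, h5, abs_mul, abs_mul, abs_inv, abs_abs, inv_mul_cancel₀ (abs_ne_zero.2 hne), one_mul,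
      abs_of_nonneg (by have := abs_nonneg (inner ℝ u e : ℝ); nlinarith)]
  obtain ⟨h3, hne⟩ := h3
  by_cases hc : ‖perp e u‖ = 0
  · left
    rw [h3]
    rw [hc] at hu2
    have : |inner ℝ u e| = 1 := by
      refine (pow_eq_one_iff_of_nonneg (abs_nonneg _) two_ne_zero).1 ?_
      rw [sq_abs]; linarith
    rw [this]; ring
  · right
    have hc0 : 0 < ‖perp e u‖ := lt_of_le_of_ne (norm_nonneg _) (Ne.symm hc)
    have h6 : perp e a = ‖perp e u‖⁻¹ • perp e u := by
      have h7 : ‖perp e a - ‖perp e u‖⁻¹ • perp e u‖ ^ 2 ≤ 0 := by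
        rw [norm_sub_sq_real, real_inner_smul_right, h2, norm_smul, norm_inv, norm_norm,
          inv_mul_cancel₀ hc]
        nlinarith [ha.2, norm_nonneg (perp e a)]
      have h8 := pow_eq_zero_iff (two_ne_zero) |>.1 (le_antisymm h7 (by positivity))
      exact sub_eq_zero.1 (norm_eq_zero.1 h8)
    have h7 : ‖perp e ((1 - r) • a + r • u)‖ = (1 - r) + r * ‖perp e u‖ := by
      have : perp e ((1 - r) • a + r • u) = (‖perp e u‖⁻¹ * ((1 - r) + r * ‖perp e u‖)) • perp e u := by
        rw [perp_add, perp_smul, perp_smul, h6, smul_smul, ← add_smul]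
        congr 1
        field_simp
      rw [this, norm_smul, Real.norm_of_nonneg (by
        refine mul_nonneg (by positivity) ?_
        nlinarith)]
      field_simp
    have hd0 : 0 < |inner ℝ u e| := abs_pos.2 hne
    refine ⟨hxr, ?_, ?_⟩
    · rw [h7]; nlinarith
    · rw [h7, h3]
      have := sq_abs (inner ℝ u e : ℝ)
      linear_combination r ^ 2 * this - r ^ 2 * hu2

theorem abs_inner_lt_one_of_mem_rim (hr : 0 < r) (hx : x ∈ rim e r) : |inner ℝ x e| < 1 := by
  have h1 := hx.2.2
  have h2 : 0 < (‖perp e x‖ - (1 - r)) ^ 2 := pow_pos (sub_pos.2 hx.2.1) 2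
  have h3 : (|inner ℝ x e| - (1 - r)) ^ 2 < r ^ 2 := by linarith
  have h4 := lt_of_pow_lt_pow_left₀ 2 hr.le h3
  linarith

end Rim
end LpSteiner

namespace LpSteiner

/-! ### Curvature and integrability on the rim. -/

section RimCurvature

theorem continuous_powCoeff {Y : Type*} [TopologicalSpace Y] {n m : ℕ} {a : ℝ} {e : Y → ℕ → ℝ}
    (he : ∀ j, Continuous fun y => e y j) : Continuous fun y => powCoeff n m a (e y) :=
  continuous_finsetSum _ fun _ _ => continuous_const.mul
    (continuous_finsetProd _ fun j _ => (he (j + 1)).pow _)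

theorem continuous_esymmTwo {Y : Type*} [TopologicalSpace Y] {n : ℕ} {α β : Y → ℝ}
    (hα : Continuous α) (hβ : Continuous β) (j : ℕ) :
    Continuous fun y => esymmTwo n (α y) (β y) j := by
  cases j with
  | zero => exact continuous_const
  | succ j =>
    exact ((hβ.pow _).mul continuous_const).add ((hα.mul (hβ.pow _)).mul continuous_const)

variable {n : ℕ} {e : Euc n} {r : ℝ} {x : Euc n}

/-- The second-order expansion of the rim in coordinates: `σ` and `ζ` are the increments of the
distance from the axis and of the height, `q` is the increment in the radial direction, and `P` is
the squared length of the increment orthogonal to the axis. -/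
theorem abs_rim_error_le {S c d σ ζ q P δ : ℝ} (hr : 0 < r) (hS : 0 < S)
    (hcd : c ^ 2 + d ^ 2 = 1) (hrim : 2 * r * (c * σ + d * ζ) + σ ^ 2 + ζ ^ 2 = 0)
    (hq : 2 * S * (q - σ) = σ ^ 2 - P) (hc : 0 < c) (hσ : σ ^ 2 ≤ P) (hqP : q ^ 2 ≤ P)
    (hδ0 : 0 ≤ δ) (hδ : δ ^ 2 = P + ζ ^ 2) (hδ1 : δ ≤ 1) :
    |-(c * q + d * ζ) - 1 / 2 * (1 / r * (-d * q + c * ζ) ^ 2 + c / S * (δ ^ 2 -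
      (-d * q + c * ζ) ^ 2) - c / S * (c * q + d * ζ) ^ 2)| ≤
      (1 / (r * S) + c / S ^ 2 + (1 / r + c / S) ^ 2 / (2 * r)) * δ ^ 3 := by
  have hPδ : P ≤ δ ^ 2 := by nlinarith [sq_nonneg ζ]
  have hP0 : 0 ≤ P := (sq_nonneg σ).trans hσ
  have hσ1 : |σ| ≤ δ := abs_le_of_sq_le_sq (hσ.trans hPδ) hδ0
  have hq1 : |q| ≤ δ := abs_le_of_sq_le_sq (hqP.trans hPδ) hδ0
  set ν := c * q + d * ζ with hν
  -- The circle equation handles `c * σ + d * ζ`, and `hq` the difference of `q` and `σ`. So the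
  -- normal increment `ν` consists of second order terms.
  have hν1 : ν = -((σ ^ 2 + ζ ^ 2) / (2 * r)) - c * (P - σ ^ 2) / (2 * S) := by
    rw [hν]
    field_simp
    linear_combination S * hrim + c * r * hq
  have hνb : |ν| ≤ (1 / r + c / S) * δ ^ 2 := by
    rw [hν1, ← neg_add', abs_neg, abs_of_nonneg (by
      have : 0 ≤ P - σ ^ 2 := sub_nonneg.2 hσ
      positivity), add_mul]
    have h1 : (σ ^ 2 + ζ ^ 2) / (2 * r) ≤ 1 / r * δ ^ 2 := by
      rw [div_mul_eq_mul_div, one_mul, div_le_div_iff₀ (by positivity) hr]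
      nlinarith
    have h2 : c * (P - σ ^ 2) / (2 * S) ≤ c / S * δ ^ 2 := by
      rw [div_mul_eq_mul_div, div_le_div_iff₀ (by positivity) hS]
      have : c * (P - σ ^ 2) ≤ c * δ ^ 2 := mul_le_mul_of_nonneg_left (by nlinarith) hc.le
      have h3 : 0 ≤ c * δ ^ 2 := by positivity
      nlinarith
    linarith
  have hν2 : ν ^ 2 ≤ (1 / r + c / S) ^ 2 * δ ^ 3 := by
    rw [← sq_abs]
    calc |ν| ^ 2 ≤ ((1 / r + c / S) * δ ^ 2) ^ 2 := pow_le_pow_left₀ (abs_nonneg _) hνb 2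
      _ = (1 / r + c / S) ^ 2 * (δ ^ 3 * δ) := by ring
      _ ≤ _ := mul_le_mul_of_nonneg_left (mul_le_of_le_one_right (by positivity) hδ1)
          (by positivity)
  have hdiff : |σ ^ 2 - q ^ 2| ≤ δ ^ 3 / S := by
    rw [sq_sub_sq, abs_mul]
    have h1 : |σ + q| ≤ 2 * δ := (abs_add_le _ _).trans (by linarith)
    have h2 : |σ - q| ≤ δ ^ 2 / (2 * S) := by
      have : σ - q = (P - σ ^ 2) / (2 * S) := by
        field_simp
        linarith
      rw [this, abs_of_nonneg (div_nonneg (sub_nonneg.2 hσ) (by positivity))]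
      gcongr
      nlinarith [sq_nonneg σ]
    calc |σ + q| * |σ - q| ≤ (2 * δ) * (δ ^ 2 / (2 * S)) := by gcongr
      _ = δ ^ 3 / S := by field_simp
  -- The second order terms cancel. Since `ν` and `σ - q` are `O(δ²)`, each remaining term is
  -- `O(δ³)`.
  have hid : -ν - 1 / 2 * (1 / r * (-d * q + c * ζ) ^ 2 + c / S * (δ ^ 2 -
      (-d * q + c * ζ) ^ 2) - c / S * ν ^ 2) =
      (σ ^ 2 - q ^ 2) * (1 / (2 * r)) - (σ ^ 2 - q ^ 2) * (c / (2 * S)) + ν ^ 2 * (1 / (2 * r)) := by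
    have h1 : (-d * q + c * ζ) ^ 2 = q ^ 2 + ζ ^ 2 - ν ^ 2 := by
      rw [hν]; linear_combination (q ^ 2 + ζ ^ 2) * hcd
    rw [h1, hδ]
    have h2 : -ν = (σ ^ 2 + ζ ^ 2) / (2 * r) + c * (P - σ ^ 2) / (2 * S) := by rw [hν1]; ring
    rw [h2]
    field_simp
    ring
  rw [hid]
  have hA : |(σ ^ 2 - q ^ 2) * (1 / (2 * r))| ≤ δ ^ 3 / S * (1 / (2 * r)) := by
    rw [abs_mul, abs_of_pos (by positivity : 0 < 1 / (2 * r))]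
    gcongr
  have hB : |(σ ^ 2 - q ^ 2) * (c / (2 * S))| ≤ δ ^ 3 / S * (c / (2 * S)) := by
    rw [abs_mul, abs_of_pos (by positivity : 0 < c / (2 * S))]
    gcongr
  have hC : |ν ^ 2 * (1 / (2 * r))| ≤ (1 / r + c / S) ^ 2 * δ ^ 3 * (1 / (2 * r)) := by
    rw [abs_mul, abs_of_pos (by positivity : 0 < 1 / (2 * r)), abs_of_nonneg (sq_nonneg ν)]
    gcongr
  have h1 := abs_add_le ((σ ^ 2 - q ^ 2) * (1 / (2 * r)) - (σ ^ 2 - q ^ 2) * (c / (2 * S)))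
    (ν ^ 2 * (1 / (2 * r)))
  have h2 := abs_sub ((σ ^ 2 - q ^ 2) * (1 / (2 * r))) ((σ ^ 2 - q ^ 2) * (c / (2 * S)))
  have h3 : δ ^ 3 / S * (1 / (2 * r)) ≤ 1 / (r * S) * δ ^ 3 := by
    have : δ ^ 3 / S * (1 / (2 * r)) = 1 / (r * S) * δ ^ 3 / 2 := by field_simp
    rw [this]
    exact half_le_self (by positivity)
  have h4 : δ ^ 3 / S * (c / (2 * S)) ≤ c / S ^ 2 * δ ^ 3 := by
    have : δ ^ 3 / S * (c / (2 * S)) = c / S ^ 2 * δ ^ 3 / 2 := by field_simp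
    rw [this]
    exact half_le_self (by positivity)
  have h5 : (1 / r + c / S) ^ 2 * δ ^ 3 * (1 / (2 * r)) =
      (1 / r + c / S) ^ 2 / (2 * r) * δ ^ 3 := by ring
  rw [add_mul, add_mul]
  linarith

/-- The meridian is a circle of radius `r`. The other directions come from rotation about the axis
at distance `‖perp e x‖`, and their curvature is the radial component of the normal divided by that
distance (Meusnier). -/
theorem principalCurvature_rim (hn : 2 ≤ n) (he : ‖e‖ = 1) (hr : 0 < r) (hr1 : r < 1)
    (hx : x ∈ rim e r) : ∃ i₀, principalCurvature (rounding (cylinder e he) r) x =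
      fun i => if i = i₀ then 1 / r else rimCos e r x / ‖perp e x‖ := by
  obtain ⟨s, hs, hsx⟩ := exists_sign (inner ℝ x e)
  set K := rounding (cylinder e he) r with hKdef
  have hN : outerNormal K x = rimNormal e r s x := outerNormal_rim he hr hr1 hx hs hsx
  have hint : (interior (K : Set (Euc n))).Nonempty :=
    ⟨0, zero_mem_interior_rounding (zero_mem_cylinder he) hr⟩
  have hxf := rim_subset_frontier he hr hr1 hx
  have hS : 0 < ‖perp e x‖ := lt_trans (by linarith) hx.2.1
  refine exists_principalCurvature_eq hn hint (mem_of_mem_frontier hxf)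
    (isOuterUnitNormal_outerNormal hint hxf) (norm_rimTangent he hr hr1 hx hs)
    (by rw [hN]; exact inner_rimTangent_rimNormal he hr1 hx hs) ?_
  rw [hN]
  refine isLittleO_sq_of_le_cube (C := 1 / (r * ‖perp e x‖) + rimCos e r x / ‖perp e x‖ ^ 2 +
    (1 / r + rimCos e r x / ‖perp e x‖) ^ 2 / (2 * r)) ?_
  have hsz : 1 - r < s * inner ℝ x e := by
    have h1 : s * inner ℝ x e = |inner ℝ x e| := by
      rw [hsx, ← mul_assoc, ← pow_two, hs, one_mul, abs_mul, abs_abs]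
      rw [← sq_abs] at hs
      rw [(pow_eq_one_iff_of_nonneg (abs_nonneg _) two_ne_zero).1 hs, one_mul]
    rw [h1]; exact hx.1
  have hopen1 : ∀ᶠ y : Euc n in 𝓝 x, 1 - r < s * inner ℝ y e :=
    (isOpen_lt continuous_const (by fun_prop)).mem_nhds hsz
  have hopen2 : ∀ᶠ y : Euc n in 𝓝 x, |inner ℝ y e| < 1 :=
    (isOpen_lt (f := fun y : Euc n => |inner ℝ y e|) (by fun_prop) continuous_const).mem_nhds
      (abs_inner_lt_one_of_mem_rim hr hx)
  filter_upwards [self_mem_nhdsWithin, nhdsWithin_le_nhds hopen1, nhdsWithin_le_nhds hopen2,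
    nhdsWithin_le_nhds (Metric.ball_mem_nhds x one_pos)] with y hy hy1 hy2 hyx
  have hyx' : ‖y - x‖ ≤ 1 := (mem_ball_iff_norm.1 hyx).le
  have hs1 : |s| = 1 := by
    rw [← sq_abs] at hs
    exact (pow_eq_one_iff_of_nonneg (abs_nonneg _) two_ne_zero).1 hs
  have habs : ∀ w : Euc n, 1 - r < s * inner ℝ w e → |inner ℝ w e| = s * inner ℝ w e := by
    intro w hw
    have : |s * inner ℝ w e| = s * inner ℝ w e := abs_of_pos (by linarith)
    rwa [abs_mul, hs1, one_mul] at this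
  have hyr : y ∈ rim e r := by
    refine (mem_rim_or he hr hr1 hy ?_).resolve_left hy2.ne
    rw [habs y hy1]; exact hy1
  set D := y - x with hD
  have hpy : perp e y = perp e D + perp e x := by rw [hD, perp_sub, sub_add_cancel]
  have hDx : inner ℝ D (perp e x) = inner ℝ (perp e D) (perp e x) := by
    rw [real_inner_comm, ← inner_perp_perp he, real_inner_comm]
  have hPq := norm_add_sq_real (perp e D) (perp e x)
  rw [← hpy, ← hDx] at hPq
  set S := ‖perp e x‖ with hSdef
  set q := inner ℝ D (perp e x) / S with hqdef
  have hqS : inner ℝ D (perp e x) = q * S := by rw [hqdef, div_mul_cancel₀ _ hS.ne']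
  have hDN : inner ℝ D (rimNormal e r s x) =
      rimCos e r x * q + rimSin e r x * (s * inner ℝ D e) := by
    rw [rimNormal, inner_perp_add, hqS, ← hSdef]
    field_simp
  have hDT : inner ℝ D (rimTangent e r s x) =
      -rimSin e r x * q + rimCos e r x * (s * inner ℝ D e) := by
    rw [rimTangent, inner_perp_add, hqS, ← hSdef]
    field_simp
  have hxy : inner ℝ (x - y) (rimNormal e r s x) = -inner ℝ D (rimNormal e r s x) := by
    rw [← inner_neg_left, hD, neg_sub]
  have hsign : ‖perp e y‖ - S ≤ ‖perp e D‖ ∧ -‖perp e D‖ ≤ ‖perp e y‖ - S := by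
    have h1 := abs_le.1 (abs_norm_sub_norm_le (perp e y) (perp e x))
    rw [← perp_sub] at h1
    exact ⟨h1.2, h1.1⟩
  have hDe : s * inner ℝ D e = |inner ℝ y e| - |inner ℝ x e| := by
    rw [hD, inner_sub_left, habs y hy1, habs x hsz]
    ring
  have key := abs_rim_error_le (S := S) (c := rimCos e r x) (d := rimSin e r x)
    (σ := ‖perp e y‖ - S) (ζ := s * inner ℝ D e) (q := q) (P := ‖perp e D‖ ^ 2) (δ := ‖D‖) hr hS
    (rimCos_sq_add hr hx) ?_ ?_ (rimCos_pos hr hx) ?_ ?_ (norm_nonneg _) ?_ hyx'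
  · rw [hxy, twoForm, hDN, hDT]
    convert key using 3
  · have h1 : r * rimCos e r x = S - (1 - r) := by rw [rimCos, ← hSdef]; field_simp
    have h2 : r * rimSin e r x = |inner ℝ x e| - (1 - r) := by rw [rimSin]; field_simp
    rw [hDe]
    linear_combination 2 * (‖perp e y‖ - S) * h1 + 2 * (|inner ℝ y e| - |inner ℝ x e|) * h2 +
      hyr.2.2 - hx.2.2
  · rw [hqS] at hPq
    linear_combination -hPq
  · exact sq_le_sq' hsign.2 hsign.1
  · have h1 := abs_le.1 (abs_real_inner_le_norm (perp e D) (perp e x))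
    rw [← hDx, hqS, ← hSdef] at h1
    exact sq_le_sq' (by nlinarith) (by nlinarith)
  · rw [mul_pow, hs, one_mul]
    exact norm_sq_eq_perp he D

theorem integrandW_rim (hn : 2 ≤ n) (he : ‖e‖ = 1) (hr : 0 < r) (hr1 : r < 1) (hx : x ∈ rim e r)
    (p : ℝ) (m k : ℕ) : integrandW p m k (rounding (cylinder e he) r) x =
      density n p m k ((1 - r) * (rimCos e r x + rimSin e r x) + r) (1 / r)
        (rimCos e r x / ‖perp e x‖) := by
  obtain ⟨s, hs, hsx⟩ := exists_sign (inner ℝ x e)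
  obtain ⟨i₀, hi₀⟩ := principalCurvature_rim hn he hr hr1 hx
  rw [integrandW_eq_density hi₀, outerNormal_rim he hr hr1 hx hs hsx,
    inner_rimNormal he hr hr1 hx hs hsx]

theorem rim_height_mem (hr : 0 < r) (hr1 : r < 1) (hx : x ∈ rim e r) :
    (1 - r) * (rimCos e r x + rimSin e r x) + r ∈ Set.Icc (1 : ℝ) 2 := by
  have h1 := rimCos_sq_add hr hx
  have h2 := rimCos_pos hr hx
  have h3 := rimSin_pos hr hx
  have h4 : 1 ≤ rimCos e r x + rimSin e r x := by nlinarith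
  have h5 : rimCos e r x + rimSin e r x ≤ 2 := by
    nlinarith [sq_nonneg (rimCos e r x - 1), sq_nonneg (rimSin e r x - 1)]
  constructor <;> nlinarith

theorem rimCos_le_one (hr : 0 < r) (hx : x ∈ rim e r) : rimCos e r x ≤ 1 := by
  have h1 := rimCos_sq_add hr hx
  have h2 := rimCos_pos hr hx
  nlinarith [sq_nonneg (rimSin e r x)]

/-- With `c = rimCos e r x` and `S = ‖perp e x‖ = 1 - r + r c` one has `c ≤ S ≤ 1`. Thus only one
curvature blows up as `r → 0`. -/
theorem rim_curvature_mem (hr : 0 < r) (hr1 : r < 1) (hx : x ∈ rim e r) :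
    rimCos e r x / ‖perp e x‖ ∈ Set.Icc (rimCos e r x) 1 := by
  have h1 := rimCos_le_one hr hx
  have h2 := rimCos_pos hr hx
  have hS : 0 < ‖perp e x‖ := lt_trans (by linarith) hx.2.1
  have h3 := norm_perp_eq (e := e) (x := x) hr
  constructor
  · rw [le_div_iff₀ hS]
    have h4 : ‖perp e x‖ ≤ 1 := by nlinarith
    exact mul_le_of_le_one_right h2.le h4
  · rw [div_le_one hS]
    nlinarith

theorem measurableSet_rim (e : Euc n) (r : ℝ) : MeasurableSet (rim e r) := by
  have h := (continuous_perp e).norm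
  have h2 : Continuous fun x : Euc n => |inner ℝ x e| := by fun_prop
  exact (measurableSet_lt measurable_const h2.measurable).inter
    ((measurableSet_lt measurable_const h.measurable).inter
      (isClosed_eq (((h.sub continuous_const).pow 2).add ((h2.sub continuous_const).pow 2))
        continuous_const).measurableSet)

/-- The integrand is a continuous function of height and curvature on the compact set `[1, 2] × [0,
1]`; continuity at curvature zero uses `exponent_nonneg`. -/
theorem integrableOn_rim (hn : 2 ≤ n) (he : ‖e‖ = 1) (hr : 0 < r) (hr1 : r < 1) {p : ℝ}
    (hp : p < -n ∨ 0 ≤ p) (m k : ℕ) :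
    IntegrableOn (integrandW p m k (rounding (cylinder e he) r)) (rim e r) μHE[n - 1] := by
  have hint : (interior (rounding (cylinder e he) r : Set (Euc n))).Nonempty :=
    ⟨0, zero_mem_interior_rounding (zero_mem_cylinder he) hr⟩
  have hfin : μHE[n - 1] (rim e r) < ⊤ :=
    (measure_mono (rim_subset_frontier he hr hr1)).trans_lt (measure_frontier_lt_top (by omega) hint)
  have h := (continuous_perp e).norm.measurable
  have h2 : Measurable fun x : Euc n => |inner ℝ x e| :=
    (by fun_prop : Continuous fun x : Euc n => |inner ℝ x e|).measurable
  have hc : Measurable (rimCos e r) := (h.sub_const _).div_const _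
  have hd : Measurable (rimSin e r) := (h2.sub_const _).div_const _
  refine IntegrableOn.congr_fun (f := fun x => (fun y : ℝ × ℝ => density n p m k y.1 (1 / r) y.2)
    ((1 - r) * (rimCos e r x + rimSin e r x) + r, rimCos e r x / ‖perp e x‖)) ?_
    (fun x hx => (integrandW_rim hn he hr hr1 hx p m k).symm) (measurableSet_rim e r)
  refine integrableOn_comp_of_mapsTo (φ := fun y : ℝ × ℝ => density n p m k y.1 (1 / r) y.2)
    (measurableSet_rim e r) hfin
    (S := Set.Icc (1 : ℝ) 2 ×ˢ Set.Icc (0 : ℝ) 1) (isCompact_Icc.prod isCompact_Icc) ?_ ?_ ?_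
  · refine ((ContinuousOn.rpow_const continuousOn_fst fun y hy => ?_).mul
      (Continuous.continuousOn ?_)).mul (continuous_powCoeff fun j => ?_).continuousOn
    · exact Or.inl (by linarith [hy.1.1] : 0 < y.1).ne'
    · exact (continuous_const.mul (continuous_snd.pow _)).rpow_const fun _ =>
        Or.inr (exponent_nonneg hp)
    · exact continuous_esymmTwo continuous_const continuous_snd j
  · intro x hx
    have h3 := rim_curvature_mem hr hr1 hx
    exact ⟨rim_height_mem hr hr1 hx, (rimCos_pos hr hx).le.trans h3.1, h3.2⟩
  · have h3 : Measurable fun y : ℝ × ℝ => density n p m k y.1 (1 / r) y.2 :=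
      ((measurable_fst.pow_const _).mul
        ((measurable_const.mul (measurable_snd.pow_const _)).pow_const _)).mul
        (continuous_powCoeff fun j => continuous_esymmTwo continuous_const continuous_snd j).measurable
    exact h3.comp ((((hc.add hd).const_mul _).add_const _).prodMk (hc.div h))

end RimCurvature
end LpSteiner

namespace LpSteiner

/-! ### Evaluation of `V` on the cylinder and its roundings. -/

section CylinderIntegrals

variable {n : ℕ} {e : Euc n} {K : ConvexBody (Euc n)} {s r : ℝ} {he : ‖e‖ = 1} {x : Euc n}

theorem measurableSet_lateral (e : Euc n) (s : ℝ) : MeasurableSet (lateral e s) :=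
  (isOpen_lt (f := fun x : Euc n => |inner ℝ x e|) (by fun_prop)
    continuous_const).measurableSet.inter
    (isClosed_eq (continuous_perp e).norm continuous_const).measurableSet

/-- The face of `K` in the direction `u`, if `u` is a unit vector and the support function of `K`
at `u` is `1`. -/
def unitFace (K : ConvexBody (Euc n)) (u : Euc n) : Set (Euc n) := {x | x ∈ K ∧ inner ℝ x u = 1}

theorem measurableSet_unitFace (K : ConvexBody (Euc n)) (u : Euc n) :
    MeasurableSet (unitFace K u) := measurableSet_face K u 1

theorem IsCylindrical.inner_le (hK : IsCylindrical K e he s) {u : Euc n} (hu : u = e ∨ u = -e) :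
    ∀ y ∈ K, inner ℝ y u ≤ 1 := by
  intro y hy
  have h := abs_le.1 (hK.le hy).1
  rcases hu with rfl | rfl
  · exact h.2
  · rw [inner_neg_right]; linarith

theorem IsCylindrical.unitFace_subset (hK : IsCylindrical K e he s) {u : Euc n}
    (hu : u = e ∨ u = -e) : unitFace K u ⊆ frontier (K : Set (Euc n)) := by
  intro x hx
  have h : IsOuterUnitNormal K x u := by
    refine ⟨?_, fun y hy => ?_⟩
    · rcases hu with rfl | rfl
      · exact he
      · rw [norm_neg]; exact he
    · rw [inner_sub_left, hx.2]
      linarith [hK.inner_le hu y hy]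
  exact h.mem_frontier hx.1 (by simp)

theorem unitFace_ae (hn : 2 ≤ n) (hK : IsCylindrical K e he s) {u : Euc n} (hu : u = e ∨ u = -e)
    {p : ℝ} (hp : p < -n ∨ 0 ≤ p) (m k : ℕ) :
    ∀ᵐ x ∂(μHE[n - 1] : Measure (Euc n)).restrict (unitFace K u),
      integrandW p m k K x = density n p m k 1 0 0 := by
  have hu1 : ‖u‖ = 1 := by
    rcases hu with rfl | rfl
    · exact he
    · rw [norm_neg]; exact he
  rw [density_zero hn hp]
  exact flat_ae hn hp hK.zero_mem hu1 (hK.inner_le hu) m k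

theorem measure_frontier_ne_top (hn : 2 ≤ n) (h0 : (0 : Euc n) ∈ interior (K : Set (Euc n)))
    {S : Set (Euc n)} (hS : S ⊆ frontier (K : Set (Euc n))) : μHE[n - 1] S ≠ ⊤ :=
  ((measure_mono hS).trans_lt (measure_frontier_lt_top (by omega) ⟨0, h0⟩)).ne

/-- The density of `V^p_k` at a boundary point with support height `h` and principal curvatures
`α, β, …, β`. -/
noncomputable def totalDensity (n : ℕ) (p : ℝ) (k : ℕ) (h α β : ℝ) : ℝ :=
  ∑ m ∈ Finset.range (k + 1),
    Ring.choose ((n : ℝ) * (1 - p) / (n + p)) (k - m) * density n p m k h α β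

/-- The integrand of `V^p_k`. -/
noncomputable def integrandV (p : ℝ) (k : ℕ) (K : ConvexBody (Euc n)) (x : Euc n) : ℝ :=
  ∑ m ∈ Finset.range (k + 1),
    Ring.choose ((n : ℝ) * (1 - p) / (n + p)) (k - m) * integrandW p m k K x

theorem integrableOn_integrandV {p : ℝ} {k : ℕ} {S : Set (Euc n)}
    (h : ∀ m ≤ k, IntegrableOn (integrandW p m k K) S μHE[n - 1]) :
    IntegrableOn (integrandV p k K) S μHE[n - 1] :=
  integrable_finsetSum _ fun m hm =>
    (h m (Nat.lt_succ_iff.1 (Finset.mem_range.1 hm))).const_mul _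

theorem V_eq_setIntegral {p : ℝ} {k : ℕ} (h : K ∈ domainV n p k) : V p k K =
    ∫ x in frontier (K : Set (Euc n)), integrandV p k K x ∂μHE[n - 1] := by
  simp only [integrandV]
  rw [integral_finsetSum _ fun m hm =>
    (h.2 m (Nat.lt_succ_iff.1 (Finset.mem_range.1 hm))).const_mul _]
  simp only [integral_const_mul]
  rfl

/-- Evaluation of `V^p_k` at a body whose boundary consists of a part of the lateral boundary of the
cylinder, the two flat ends, and a further set `R`. -/
theorem IsCylindrical.V_eq (hn : 2 ≤ n) (hK : IsCylindrical K e he s) {p : ℝ}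
    (hp : p < -n ∨ 0 ≤ p) (k : ℕ) {R : Set (Euc n)} (hR : MeasurableSet R)
    (hfr : frontier (K : Set (Euc n)) =ᵐ[μHE[n - 1]]
      (lateral e s ∪ unitFace K e ∪ unitFace K (-e) ∪ R : Set (Euc n)))
    (hs : s ≤ 1) (hR1 : Disjoint (lateral e s ∪ unitFace K e ∪ unitFace K (-e)) R)
    (hint : ∀ m ≤ k, IntegrableOn (integrandW p m k K) R μHE[n - 1]) :
    K ∈ domainV n p k ∧ V p k K =
      totalDensity n p k 1 0 1 * (μHE[n - 1] : Measure (Euc n)).real (lateral e s) +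
      totalDensity n p k 1 0 0 * (μHE[n - 1] : Measure (Euc n)).real (unitFace K e) +
      totalDensity n p k 1 0 0 * (μHE[n - 1] : Measure (Euc n)).real (unitFace K (-e)) +
      ∫ x in R, integrandV p k K x ∂μHE[n - 1] := by
  have hlat : ∀ m, IntegrableOn (integrandW p m k K) (lateral e s) μHE[n - 1] := fun m =>
    (integrableOn_const (measure_frontier_ne_top hn hK.zero_mem fun _ hx =>
      hK.lateral_subset hx)).congr_fun (fun x hx => (hK.integrandW_lateral hn hx p m k).symm)
      (measurableSet_lateral e s)
  have hface : ∀ m (u : Euc n), u = e ∨ u = -e →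
      IntegrableOn (integrandW p m k K) (unitFace K u) μHE[n - 1] := fun m u hu =>
    (integrableOn_const (μ := μHE[n - 1]) (C := density n p m k 1 0 0)
      (measure_frontier_ne_top hn hK.zero_mem (hK.unitFace_subset hu))).congr
      ((unitFace_ae hn hK hu hp m k).mono fun x hx => hx.symm)
  have hdom : K ∈ domainV n p k := by
    refine ⟨hK.zero_mem, fun m hm => IntegrableOn.congr_set_ae ?_ hfr⟩
    exact (((hlat m).union (hface m e (Or.inl rfl))).union (hface m (-e) (Or.inr rfl))).union
      (hint m hm)
  refine ⟨hdom, ?_⟩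
  have hV : ∀ {S : Set (Euc n)}, (∀ m ≤ k, IntegrableOn (integrandW p m k K) S μHE[n - 1]) →
      IntegrableOn (integrandV p k K) S μHE[n - 1] := fun h => integrableOn_integrandV h
  have hd1 : Disjoint (lateral e s) (unitFace K e) := by
    rw [Set.disjoint_left]
    intro x h1 h2
    have := h1.1
    rw [h2.2, abs_one] at this
    linarith
  have hd2 : Disjoint (lateral e s ∪ unitFace K e) (unitFace K (-e)) := by
    rw [Set.disjoint_left]
    intro x h1 h2
    have h3 := h2.2
    rw [inner_neg_right] at h3
    rcases h1 with h1 | h1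
    · have h4 := abs_lt.1 h1.1
      linarith
    · have h4 := h1.2
      linarith
  have hl := hV fun m _ => hlat m
  have hf1 := hV fun m _ => hface m e (Or.inl rfl)
  have hf2 := hV fun m _ => hface m (-e) (Or.inr rfl)
  rw [V_eq_setIntegral hdom, setIntegral_congr_set hfr,
    setIntegral_union hR1 hR ((hl.union hf1).union hf2) (hV hint),
    setIntegral_union hd2 (measurableSet_unitFace K _) (hl.union hf1) hf2,
    setIntegral_union hd1 (measurableSet_unitFace K _) hl hf1]
  have hfaceV : ∀ u : Euc n, u = e ∨ u = -e →
      ∫ x in unitFace K u, integrandV p k K x ∂μHE[n - 1] =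
      totalDensity n p k 1 0 0 * (μHE[n - 1] : Measure (Euc n)).real (unitFace K u) := by
    intro u hu
    rw [integral_congr_ae (g := fun _ => totalDensity n p k 1 0 0), setIntegral_const, smul_eq_mul,
      mul_comm]
    filter_upwards [ae_all_iff.2 fun m => unitFace_ae hn hK hu hp m k] with x hx
    simp only [integrandV, totalDensity, hx]
  rw [hfaceV e (Or.inl rfl), hfaceV (-e) (Or.inr rfl)]
  congr 3
  rw [setIntegral_congr_fun (g := fun _ => totalDensity n p k 1 0 1) (measurableSet_lateral e s),
    setIntegral_const, smul_eq_mul, mul_comm]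
  intro x hx
  simp only [integrandV, totalDensity, hK.integrandW_lateral hn hx p]

theorem frontier_cylinder (he : ‖e‖ = 1) : frontier (cylinder e he : Set (Euc n)) =
    lateral e 1 ∪ unitFace (cylinder e he) e ∪ unitFace (cylinder e he) (-e) := by
  have hK := isCylindrical_cylinder he
  apply Set.Subset.antisymm
  · intro x hx
    have hxK := mem_of_mem_frontier hx
    rcases lt_or_eq_of_le hxK.1 with h | h
    · exact Or.inl (Or.inl (hK.mem_lateral hx h))
    · rcases (abs_eq zero_le_one).1 h with h | h
      · exact Or.inl (Or.inr ⟨hxK, h⟩)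
      · exact Or.inr ⟨hxK, by rw [inner_neg_right, h, neg_neg]⟩
  · refine Set.union_subset (Set.union_subset (fun x hx => hK.lateral_subset hx) ?_) ?_
    · exact hK.unitFace_subset (Or.inl rfl)
    · exact hK.unitFace_subset (Or.inr rfl)

theorem V_cylinder (hn : 2 ≤ n) (he : ‖e‖ = 1) {p : ℝ} (hp : p < -n ∨ 0 ≤ p) (k : ℕ) :
    cylinder e he ∈ domainV n p k ∧ V p k (cylinder e he) =
      totalDensity n p k 1 0 1 * (μHE[n - 1] : Measure (Euc n)).real (lateral e 1) +
      totalDensity n p k 1 0 0 *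
        (μHE[n - 1] : Measure (Euc n)).real (unitFace (cylinder e he) e) +
      totalDensity n p k 1 0 0 *
        (μHE[n - 1] : Measure (Euc n)).real (unitFace (cylinder e he) (-e)) := by
  have h := (isCylindrical_cylinder he).V_eq hn hp k MeasurableSet.empty
    (by rw [Set.union_empty, ← frontier_cylinder he]; exact Filter.EventuallyEq.rfl) le_rfl (Set.disjoint_empty _)
    (fun m _ => integrableOn_empty)
  rwa [setIntegral_empty, add_zero] at h

theorem smul_mem_interior_rounding (he : ‖e‖ = 1) (hr : 0 < r) {u : Euc n} (hu : ‖u‖ ≤ 1) :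
    (1 - r) • u ∈ interior (rounding (cylinder e he) r : Set (Euc n)) := by
  refine interior_mono (s := Metric.ball ((1 - r) • u) r) (fun y hy => ?_)
    (by rw [Metric.isOpen_ball.interior_eq]; exact Metric.mem_ball_self hr)
  refine mem_rounding.2 ⟨u, mem_cylinder_of_norm_le he hu, r⁻¹ • (y - (1 - r) • u), ?_, ?_⟩
  · rw [norm_smul, norm_inv, Real.norm_of_nonneg hr.le, inv_mul_le_iff₀ hr, mul_one]
    exact (mem_ball_iff_norm.1 hy).le
  · rw [smul_smul, mul_inv_cancel₀ hr.ne', one_smul]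
    abel

/-- Only points at the heights `±(1 - r)` can be missing from the union. They lie in hyperplanes
through interior points, hence form a null set. -/
theorem frontier_rounding_cylinder (hn : 2 ≤ n) (he : ‖e‖ = 1) (hr : 0 < r) (hr1 : r < 1) :
    frontier (rounding (cylinder e he) r : Set (Euc n)) =ᵐ[μHE[n - 1]]
      (lateral e (1 - r) ∪ unitFace (rounding (cylinder e he) r) e ∪
        unitFace (rounding (cylinder e he) r) (-e) ∪ rim e r : Set (Euc n)) := by
  have hK := isCylindrical_rounding he hr hr1
  set K := rounding (cylinder e he) r
  have hsub : lateral e (1 - r) ∪ unitFace K e ∪ unitFace K (-e) ∪ rim e r ⊆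
      frontier (K : Set (Euc n)) := by
    refine Set.union_subset (Set.union_subset (Set.union_subset (fun x hx => hK.lateral_subset hx)
      ?_) ?_) (rim_subset_frontier he hr hr1)
    · exact hK.unitFace_subset (Or.inl rfl)
    · exact hK.unitFace_subset (Or.inr rfl)
  have hnull : ∀ t : ℝ, |t| ≤ 1 → μHE[n - 1] {x | x ∈ frontier (K : Set (Euc n)) ∧
      inner ℝ x e = (1 - r) * t} = 0 := by
    intro t ht
    have h := measure_frontier_inter_hyperplane (by omega : 1 ≤ n) K he
      (smul_mem_interior_rounding he hr (u := t • e) (by rwa [norm_smul, he, mul_one]))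
    rwa [real_inner_smul_left, real_inner_smul_left, inner_self_of_norm_one he, mul_one] at h
  refine (ae_eq_set.2 ⟨?_, by rw [Set.sdiff_eq_empty.2 hsub, measure_empty]⟩)
  refine measure_mono_null ?_ (measure_union_null (hnull 1 (by norm_num)) (hnull (-1) (by norm_num)))
  rintro x ⟨hx, hnot⟩
  have hxK := mem_of_mem_frontier hx
  simp only [Set.mem_union, not_or] at hnot
  obtain ⟨⟨⟨h1, h2⟩, h3⟩, h4⟩ := hnot
  have h5 : |inner ℝ x e| = 1 - r := by
    rcases lt_trichotomy |inner ℝ x e| (1 - r) with h | h | h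
    · exact absurd (hK.mem_lateral hx h) h1
    · exact h
    · rcases mem_rim_or he hr hr1 hx h with h6 | h6
      · rcases (abs_eq zero_le_one).1 h6 with h | h
        · exact absurd ⟨hxK, h⟩ h2
        · exact absurd ⟨hxK, by rw [inner_neg_right, h, neg_neg]⟩ h3
      · exact absurd h6 h4
  rcases (abs_eq (by linarith)).1 h5 with h | h
  · exact Or.inl ⟨hx, by rw [h, mul_one]⟩
  · exact Or.inr ⟨hx, by rw [h]; ring⟩

theorem V_rounding_cylinder (hn : 2 ≤ n) (he : ‖e‖ = 1) (hr : 0 < r) (hr1 : r < 1) {p : ℝ}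
    (hp : p < -n ∨ 0 ≤ p) (k : ℕ) :
    rounding (cylinder e he) r ∈ domainV n p k ∧ V p k (rounding (cylinder e he) r) =
      totalDensity n p k 1 0 1 * (μHE[n - 1] : Measure (Euc n)).real (lateral e (1 - r)) +
      totalDensity n p k 1 0 0 *
        (μHE[n - 1] : Measure (Euc n)).real (unitFace (rounding (cylinder e he) r) e) +
      totalDensity n p k 1 0 0 *
        (μHE[n - 1] : Measure (Euc n)).real (unitFace (rounding (cylinder e he) r) (-e)) +
      ∫ x in rim e r, integrandV p k (rounding (cylinder e he) r) x ∂μHE[n - 1] := by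
  refine (isCylindrical_rounding he hr hr1).V_eq hn hp k (measurableSet_rim e r)
    (frontier_rounding_cylinder hn he hr hr1) (by linarith) ?_
    (fun m _ => integrableOn_rim hn he hr hr1 hp m k)
  rw [Set.disjoint_right]
  intro x hx
  have h1 := abs_inner_lt_one_of_mem_rim hr hx
  rintro ((h | h) | h)
  · linarith [h.1, hx.1]
  · rw [h.2, abs_one] at h1
    linarith
  · have h2 := h.2
    rw [inner_neg_right] at h2
    have := abs_lt.1 h1
    linarith

theorem integrandV_rim (hn : 2 ≤ n) (he : ‖e‖ = 1) (hr : 0 < r) (hr1 : r < 1) (hx : x ∈ rim e r)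
    (p : ℝ) (k : ℕ) : integrandV p k (rounding (cylinder e he) r) x =
      totalDensity n p k ((1 - r) * (rimCos e r x + rimSin e r x) + r) (1 / r)
        (rimCos e r x / ‖perp e x‖) := by
  simp only [integrandV, totalDensity, integrandW_rim hn he hr hr1 hx]

end CylinderIntegrals
end LpSteiner

namespace LpSteiner

/-! ### Growth of the density when one curvature is large. -/

section DensityEstimates

variable {n : ℕ} {p : ℝ} {k : ℕ}

/-- The weight `∑ j i_j` equals the size `∑ i_j` only when `i` is concentrated at `j = 1`. This
isolates the highest power of the large curvature. -/
theorem sum_indices_eq_single (hn : 2 ≤ n) (k : ℕ) (f : (Fin (n - 1) → ℕ) → ℝ)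
    (hf : ∀ i ∈ indices n k, ∑ j, i j ≠ k → f i = 0) :
    ∑ i ∈ indices n k, f i = f (Pi.single ⟨0, by omega⟩ k) := by
  refine Finset.sum_eq_single _ (fun i hi hne => ?_) (fun h => ?_)
  · refine hf i hi fun hk => hne ?_
    have h1 := (mem_indices.1 hi)
    rw [← hk] at h1
    have h2 : ∑ j : Fin (n - 1), (j : ℕ) * i j = 0 := by
      have : ∑ j : Fin (n - 1), ((j : ℕ) + 1) * i j =
          ∑ j : Fin (n - 1), (j : ℕ) * i j + ∑ j, i j := by
        rw [← Finset.sum_add_distrib]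
        exact Finset.sum_congr rfl fun j _ => by ring
      omega
    have h3 : ∀ j : Fin (n - 1), j ≠ ⟨0, by omega⟩ → i j = 0 := by
      intro j hj
      have h4 := (Finset.sum_eq_zero_iff.1 h2) j (Finset.mem_univ j)
      rcases Nat.mul_eq_zero.1 h4 with h5 | h5
      · exact absurd (Fin.ext h5) hj
      · exact h5
    have h4 : ∑ j, i j = i ⟨0, by omega⟩ :=
      Finset.sum_eq_single _ (fun j _ hj => h3 j hj) (fun h => absurd (Finset.mem_univ _) h)
    ext j
    by_cases hj : j = ⟨0, by omega⟩
    · rw [hj, Pi.single_eq_same, ← hk, h4]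
    · rw [h3 j hj, Pi.single_eq_of_ne hj]
  · refine absurd (mem_indices.2 ?_) h
    rw [Finset.sum_eq_single (⟨0, by omega⟩ : Fin (n - 1))]
    · simp
    · intro j _ hj
      rw [Pi.single_eq_of_ne hj, mul_zero]
    · exact fun h => absurd (Finset.mem_univ _) h

/-- The elementary symmetric functions of one large and `n - 2` equal curvatures, divided by the
large curvature `1 / ε`. -/
noncomputable def scaledEsymm (n : ℕ) (ε β : ℝ) : ℕ → ℝ
  | 0 => 1
  | j + 1 => ε * β ^ (j + 1) * ((n - 2).choose (j + 1) : ℝ) + β ^ j * ((n - 2).choose j : ℝ)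

theorem continuous_scaledEsymm {Y : Type*} [TopologicalSpace Y] {ε β : Y → ℝ}
    (hε : Continuous ε) (hβ : Continuous β) (j : ℕ) :
    Continuous fun y => scaledEsymm n (ε y) (β y) j := by
  cases j with
  | zero => exact continuous_const
  | succ j =>
    exact ((hε.mul (hβ.pow _)).mul continuous_const).add ((hβ.pow _).mul continuous_const)

/-- The density of `V^p_k` at a point with one large curvature `1 / ε`, divided by its order of
growth; `g` is the reciprocal of the support height. -/
noncomputable def scaledDensity (n : ℕ) (p : ℝ) (k : ℕ) (ε g β : ℝ) : ℝ :=
  ∑ m ∈ Finset.range (k + 1), Ring.choose ((n : ℝ) * (1 - p) / (n + p)) (k - m) * g ^ (k - m) *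
    ∑ i ∈ indices n m, Ring.choose ((n : ℝ) / (n + p)) (∑ j, i j) *
      (Nat.multinomial Finset.univ i : ℝ) * ε ^ (k - ∑ j, i j) *
      ∏ j : Fin (n - 1), scaledEsymm n ε β ((j : ℕ) + 1) ^ i j

theorem continuous_scaledDensity (n : ℕ) (p : ℝ) (k : ℕ) :
    Continuous fun y : ℝ × ℝ × ℝ => scaledDensity n p k y.1 y.2.1 y.2.2 := by
  refine continuous_finsetSum _ fun m _ => (continuous_const.mul
    ((continuous_fst.comp continuous_snd).pow _)).mul (continuous_finsetSum _ fun i _ =>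
    (continuous_const.mul (continuous_fst.pow _)).mul (continuous_finsetProd _ fun j _ => ?_))
  exact (continuous_scaledEsymm continuous_fst (continuous_snd.comp continuous_snd) _).pow _

/-- The monomial of `i` grows like `(1/ε)^(∑ i_j)` with `∑ i_j ≤ m ≤ k`. The top order occurs only
for `m = k` and `i = (k, 0, …, 0)`, and its coefficient depends on neither `g` nor `β`. -/
theorem scaledDensity_zero (hn : 2 ≤ n) (g β : ℝ) :
    scaledDensity n p k 0 g β = Ring.choose ((n : ℝ) / (n + p)) k := by
  rw [scaledDensity, Finset.sum_range_succ, Finset.sum_eq_zero, zero_add, Nat.sub_self, pow_zero,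
    mul_one, Ring.choose_zero_right, one_mul, sum_indices_eq_single hn]
  · have h1 : ∑ j, (Pi.single ⟨0, by omega⟩ k : Fin (n - 1) → ℕ) j = k := by
      rw [Finset.sum_pi_single']; simp
    have h2 : Nat.multinomial Finset.univ (Pi.single ⟨0, by omega⟩ k : Fin (n - 1) → ℕ) = 1 := by
      rw [Nat.multinomial, h1, Finset.prod_eq_single (⟨0, by omega⟩ : Fin (n - 1)),
        Pi.single_eq_same, Nat.div_self (Nat.factorial_pos k)]
      · intro j _ hj
        rw [Pi.single_eq_of_ne hj, Nat.factorial_zero]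
      · exact fun h => absurd (Finset.mem_univ _) h
    rw [h1, h2, Finset.prod_eq_single (⟨0, by omega⟩ : Fin (n - 1)), Nat.sub_self]
    · simp [scaledEsymm]
    · intro j _ hj
      rw [Pi.single_eq_of_ne hj, pow_zero]
    · exact fun h => absurd (Finset.mem_univ _) h
  · intro i hi hne
    have h1 := sum_le_of_mem_indices hi
    rw [zero_pow (by omega)]
    ring
  · intro m hm
    refine mul_eq_zero_of_right _ (Finset.sum_eq_zero fun i hi => ?_)
    have h1 := sum_le_of_mem_indices hi
    have h2 := Finset.mem_range.1 hm
    rw [zero_pow (by omega)]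
    ring

/-- The symmetric functions of positive degree are affine in the large curvature, so each of them
yields one factor `1/ε`; the missing factors up to `(1/ε)^k` are compensated by `ε^(k - ∑ i_j)`. -/
theorem totalDensity_eq_scaledDensity {ε h β : ℝ} (hε : 0 < ε) (hh : 0 < h) :
    totalDensity n p k h (1 / ε) β = h ^ ((n : ℝ) * (1 - p) / (n + p)) *
      (1 / ε * β ^ (n - 2)) ^ (p / (n + p)) * (1 / ε) ^ k * scaledDensity n p k ε h⁻¹ β := by
  rw [totalDensity, scaledDensity, Finset.mul_sum]
  refine Finset.sum_congr rfl fun m hm => ?_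
  have hmk : m ≤ k := Nat.lt_succ_iff.1 (Finset.mem_range.1 hm)
  have h1 : h ^ ((m : ℝ) - k + n * (1 - p) / (n + p)) =
      h ^ ((n : ℝ) * (1 - p) / (n + p)) * h⁻¹ ^ (k - m) := by
    rw [Real.rpow_add hh, mul_comm, inv_pow, ← Real.rpow_natCast, ← Real.rpow_neg hh.le,
      Nat.cast_sub hmk, neg_sub]
  have h2 : powCoeff n m (n / (n + p)) (esymmTwo n (1 / ε) β) = (1 / ε) ^ k *
      ∑ i ∈ indices n m, Ring.choose ((n : ℝ) / (n + p)) (∑ j, i j) *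
      (Nat.multinomial Finset.univ i : ℝ) * ε ^ (k - ∑ j, i j) *
      ∏ j : Fin (n - 1), scaledEsymm n ε β ((j : ℕ) + 1) ^ i j := by
    rw [powCoeff, Finset.mul_sum]
    refine Finset.sum_congr rfl fun i hi => ?_
    have h3 : ∏ j : Fin (n - 1), esymmTwo n (1 / ε) β ((j : ℕ) + 1) ^ i j =
        (1 / ε) ^ (∑ j, i j) * ∏ j : Fin (n - 1), scaledEsymm n ε β ((j : ℕ) + 1) ^ i j := by
      rw [← Finset.prod_pow_eq_pow_sum, ← Finset.prod_mul_distrib]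
      refine Finset.prod_congr rfl fun j _ => ?_
      rw [← mul_pow, esymmTwo, scaledEsymm]
      congr 1
      field_simp
    have h4 : (1 / ε) ^ k * ε ^ (k - ∑ j, i j) = (1 / ε) ^ (∑ j, i j) := by
      have h5 : ∑ j, i j ≤ k := (sum_le_of_mem_indices hi).trans hmk
      rw [← Nat.add_sub_of_le h5, pow_add, Nat.add_sub_cancel_left, mul_assoc, ← mul_pow,
        one_div_mul_cancel hε.ne', one_pow, mul_one]
    rw [h3, ← h4]
    ring
  rw [density, h1, h2]
  ring

/-- The leading coefficient does not vanish. -/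
theorem choose_leading_ne_zero (hn : 2 ≤ n) (hp : p < -n ∨ 0 ≤ p) (hp0 : p ≠ 0) :
    Ring.choose ((n : ℝ) / (n + p)) k ≠ 0 := by
  have hn0 : (0 : ℝ) < n := by positivity
  refine choose_ne_zero fun j _ => ?_
  -- For `p < -n` the upper entry is negative, and for `p > 0` it lies strictly between `0` and `1`;
  -- it is never a natural number.
  rcases hp with hp | hp
  · have : (n : ℝ) / (n + p) < 0 := div_neg_of_pos_of_neg hn0 (by linarith)
    exact (this.trans_le (Nat.cast_nonneg j)).ne
  · have hp' : 0 < p := lt_of_le_of_ne hp (Ne.symm hp0)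
    have h1 : 0 < (n : ℝ) / (n + p) := by positivity
    have h2 : (n : ℝ) / (n + p) < 1 := by rw [div_lt_one (by positivity)]; linarith
    intro h
    rw [h] at h1 h2
    have h3 : 0 < j := by exact_mod_cast h1
    have h4 : j < 1 := by exact_mod_cast h2
    omega

/-- The density of `V^p_k` has a definite sign and a definite size where one curvature is large. -/
def HasLargeDensity (n : ℕ) (p : ℝ) (k : ℕ) (σ : ℝ) : Prop :=
  ∃ C > 0, ∀ᶠ r in 𝓝[>] (0 : ℝ), ∀ h ∈ Set.Icc (1 : ℝ) 2, ∀ β ∈ Set.Icc (0 : ℝ) 1,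
    0 ≤ σ * totalDensity n p k h (1 / r) β ∧
      (3 / 5 ≤ β → C / r ≤ σ * totalDensity n p k h (1 / r) β)

/-- At `ε = 0` the scaled density is constant. By continuity, uniformly over the compact range of
`(h⁻¹, β)`, it keeps its sign and half its size for small `ε`. The prefactor is at least of order
`1/r` once `β` is bounded below. -/
theorem hasLargeDensity (hn : 2 ≤ n) (hp : p < -n ∨ 0 ≤ p) (hk : 1 ≤ k) {σ : ℝ}
    (hσ : 0 < σ * Ring.choose ((n : ℝ) / (n + p)) k) : HasLargeDensity n p k σ := by
  set L := σ * Ring.choose ((n : ℝ) / (n + p)) k with hL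
  set b := (n : ℝ) * (1 - p) / (n + p) with hb
  set q := p / (n + p) with hq
  have hq0 : 0 ≤ q := exponent_nonneg hp
  have hev : ∀ᶠ ε in 𝓝 (0 : ℝ), ∀ y ∈ Set.Icc (1 / 2 : ℝ) 1 ×ˢ Set.Icc (0 : ℝ) 1,
      L / 2 < σ * scaledDensity n p k ε y.1 y.2 := by
    refine (isCompact_Icc.prod isCompact_Icc).eventually_forall_of_forall_eventually
      (P := fun ε (y : ℝ × ℝ) => L / 2 < σ * scaledDensity n p k ε y.1 y.2) fun y _ => ?_
    refine (continuous_const.mul (continuous_scaledDensity n p k)).continuousAt.eventually_const_lt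
      (u := L / 2) ?_
    change L / 2 < σ * scaledDensity n p k 0 y.1 y.2
    rw [scaledDensity_zero hn, ← hL]
    linarith
  refine ⟨(2 : ℝ) ^ (-|b|) * ((3 / 5 : ℝ) ^ (n - 2)) ^ q * (L / 2), by positivity, ?_⟩
  filter_upwards [nhdsWithin_le_nhds hev, self_mem_nhdsWithin,
    nhdsWithin_le_nhds (gt_mem_nhds one_pos)] with r hr hr0 hr1 h hh β hβ
  have hr0' : 0 < r := hr0
  have hh0 : 0 < h := by linarith [hh.1]
  have h1 : L / 2 < σ * scaledDensity n p k r h⁻¹ β :=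
    hr (h⁻¹, β) ⟨⟨by rw [one_div]; exact inv_anti₀ hh0 hh.2, inv_le_one_of_one_le₀ hh.1⟩, hβ⟩
  have h2 : (2 : ℝ) ^ (-|b|) ≤ h ^ b :=
    (Real.rpow_le_rpow_of_nonpos hh0 hh.2 (neg_nonpos.2 (abs_nonneg b))).trans
      (Real.rpow_le_rpow_of_exponent_le hh.1 (neg_abs_le b))
  have hα : 1 ≤ 1 / r := by rw [le_div_iff₀ hr0', one_mul]; exact hr1.le
  have h3 : 1 / r ≤ (1 / r) ^ k := le_self_pow₀ hα (by omega)
  have heq : σ * totalDensity n p k h (1 / r) β = h ^ b * (1 / r * β ^ (n - 2)) ^ q * (1 / r) ^ k *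
      (σ * scaledDensity n p k r h⁻¹ β) := by
    rw [totalDensity_eq_scaledDensity hr0' hh0]
    ring
  have hβ0 : 0 ≤ 1 / r * β ^ (n - 2) := mul_nonneg (by positivity) (pow_nonneg hβ.1 _)
  have hpos : 0 ≤ σ * scaledDensity n p k r h⁻¹ β := by linarith
  rw [heq]
  refine ⟨by positivity, fun h35 => ?_⟩
  have h4 : ((3 / 5 : ℝ) ^ (n - 2)) ^ q ≤ (1 / r * β ^ (n - 2)) ^ q := by
    refine Real.rpow_le_rpow (by positivity) ?_ hq0
    have h5 : (3 / 5 : ℝ) ^ (n - 2) ≤ β ^ (n - 2) := pow_le_pow_left₀ (by norm_num) h35 _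
    exact h5.trans (le_mul_of_one_le_left (pow_nonneg hβ.1 _) hα)
  calc _ = 2 ^ (-|b|) * ((3 / 5 : ℝ) ^ (n - 2)) ^ q * (1 / r) * (L / 2) := by ring
    _ ≤ _ := by gcongr

theorem powCoeff_one_esymmTwo (hn : 2 ≤ n) (m : ℕ) (α β : ℝ) :
    powCoeff n m 1 (esymmTwo n α β) = esymmTwo n α β m := by
  rw [powCoeff_one]
  rcases m with _ | m
  · rw [if_pos rfl, esymmTwo]
  · rw [if_neg (Nat.succ_ne_zero m)]
    split_ifs with h
    · rfl
    · rw [esymmTwo, Nat.choose_eq_zero_of_lt (by omega), Nat.choose_eq_zero_of_lt (by omega)]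
      simp

theorem sum_choose_one_mul (hk : 1 ≤ k) (f : ℕ → ℝ) :
    ∑ m ∈ Finset.range (k + 1), Ring.choose (1 : ℝ) (k - m) * f m = f k + f (k - 1) := by
  obtain ⟨k, rfl⟩ : ∃ j, k = j + 1 := ⟨k - 1, by omega⟩
  rw [Finset.sum_range_succ, Finset.sum_range_succ, Finset.sum_eq_zero, zero_add, Nat.sub_self,
    Ring.choose_zero_right, Nat.add_sub_cancel_left, Ring.choose_one_right, one_mul, one_mul,
    add_comm, Nat.add_sub_cancel]
  intro m hm
  rw [choose_one_eq_zero (by have := Finset.mem_range.1 hm; omega), zero_mul]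

/-- At `p = 0` the exponents `n/(n+p)` and `n(1-p)/(n+p)` are both `1` and the Gauss curvature
factor disappears. Nonnegativity of the result replaces the analysis of the leading coefficient. -/
theorem totalDensity_zero (hn : 2 ≤ n) (hk : 1 ≤ k) (h α β : ℝ) :
    totalDensity n 0 k h α β = h * esymmTwo n α β k + esymmTwo n α β (k - 1) := by
  have hn0 : (n : ℝ) ≠ 0 := by positivity
  simp only [totalDensity, density, sub_zero, mul_one, add_zero, div_self hn0, zero_div,
    Real.rpow_zero, powCoeff_one_esymmTwo hn]
  rw [sum_choose_one_mul hk, sub_self, zero_add, Real.rpow_one, Nat.cast_sub hk, Nat.cast_one,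
    sub_sub_cancel_left, neg_add_cancel, Real.rpow_zero, one_mul]

theorem esymmTwo_nonneg {α β : ℝ} (hα : 0 ≤ α) (hβ : 0 ≤ β) (j : ℕ) : 0 ≤ esymmTwo n α β j := by
  cases j with
  | zero => exact zero_le_one
  | succ j => rw [esymmTwo]; positivity

theorem le_esymmTwo {α β : ℝ} (hα : 0 ≤ α) (hβ : 0 ≤ β) {j : ℕ} (hj : j ≤ n - 2) :
    α * β ^ j ≤ esymmTwo n α β (j + 1) := by
  have h1 : (1 : ℝ) ≤ ((n - 2).choose j : ℝ) := by exact_mod_cast Nat.choose_pos hj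
  have h2 : 0 ≤ α * β ^ j := by positivity
  have h3 : 0 ≤ β ^ (j + 1) * ((n - 2).choose (j + 1) : ℝ) := by positivity
  rw [esymmTwo]
  nlinarith

/-- For `k ≤ n - 1` the `k`-th symmetric function contains the large curvature. For `k = n` the
symmetric function of degree `n - 1` takes its place. -/
theorem hasLargeDensity_zero (hn : 2 ≤ n) (hk : 1 ≤ k) (hkn : k ≤ n) :
    HasLargeDensity n 0 k 1 := by
  refine ⟨(3 / 5) ^ n, by positivity, ?_⟩
  filter_upwards [self_mem_nhdsWithin] with r hr0 h hh β hβ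
  have hr0' : 0 < r := hr0
  have hα : 0 ≤ 1 / r := by positivity
  have hh1 := hh.1
  have h1 := esymmTwo_nonneg (n := n) hα hβ.1 k
  have h2 := esymmTwo_nonneg (n := n) hα hβ.1 (k - 1)
  rw [one_mul, totalDensity_zero hn hk]
  refine ⟨by positivity, fun h35 => ?_⟩
  have h3 : ∀ j ≤ n, (3 / 5 : ℝ) ^ n / r ≤ 1 / r * β ^ j := by
    intro j hj
    have h4 : (3 / 5 : ℝ) ^ n ≤ β ^ j :=
      (pow_le_pow_left₀ (by norm_num) h35 n).trans (pow_le_pow_of_le_one hβ.1 hβ.2 hj)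
    rw [div_mul_eq_mul_div, one_mul]
    gcongr
  obtain ⟨j, rfl⟩ : ∃ j, k = j + 1 := ⟨k - 1, by omega⟩
  rw [Nat.add_sub_cancel] at h2 ⊢
  by_cases hj : j ≤ n - 2
  · have h4 := le_esymmTwo (n := n) hα hβ.1 hj
    have h5 := h3 j (by omega)
    nlinarith
  · obtain ⟨i, rfl⟩ : ∃ i, j = i + 1 := ⟨j - 1, by omega⟩
    have h4 := le_esymmTwo (n := n) hα hβ.1 (j := i) (by omega)
    have h5 := h3 i (by omega)
    have h6 : 0 ≤ h * esymmTwo n (1 / r) β (i + 1 + 1) := by positivity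
    linarith

end DensityEstimates
end LpSteiner

namespace LpSteiner

/-! ### The contribution of the rim. -/

section RimMeasure

variable {n : ℕ}

/-- The second coordinate direction. -/
noncomputable def axis (n : ℕ) (hn : 2 ≤ n) : Euc n := EuclideanSpace.single ⟨1, by omega⟩ 1

theorem norm_axis (hn : 2 ≤ n) : ‖axis n hn‖ = 1 := by
  simp [axis]

theorem inner_axis (hn : 2 ≤ n) (x : Euc n) :
    inner ℝ x (axis n hn) = dropCoord n x ⟨0, by omega⟩ := by
  rw [axis, EuclideanSpace.inner_single_right]
  simp [dropCoord]

/-- Rim points with sine between `1/2` and `4/5` have cosine at least `3/5`. Their shadow contains a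
box with axial side `3r/10` and `n - 2` further sides `1/(2n)`. -/
theorem measure_rim_ge (hn : 2 ≤ n) {r : ℝ} (hr : 0 < r) (hr1 : r ≤ 1 / 2) :
    ENNReal.ofReal (3 / 10 * r * (1 / (2 * n)) ^ (n - 2)) ≤
      μHE[n - 1] {x | x ∈ rim (axis n hn) r ∧ 3 / 5 ≤ rimCos (axis n hn) r x} := by
  have hn0 : (0 : ℝ) < n := by positivity
  set i₀ : Fin (n - 1) := ⟨0, by omega⟩ with hi₀
  refine le_trans (le_of_eq ?_) (volume_box_le_of_subset_image
    (fun j => if j = i₀ then 1 - r / 2 else 0)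
    (fun j => if j = i₀ then 1 - r / 5 else 1 / (2 * n)) fun y hy => ?_)
  · rw [← prod_ite_eq i₀, ENNReal.ofReal_prod_of_nonneg]
    · refine Finset.prod_congr rfl fun j _ => ?_
      split_ifs <;> congr 1 <;> ring
    · intro j _
      split_ifs <;> positivity
  · have hy0 := hy i₀
    rw [if_pos rfl, if_pos rfl] at hy0
    set z := y i₀ with hz
    set d := (z - (1 - r)) / r with hd
    have hd1 : 1 / 2 ≤ d := by rw [hd, le_div_iff₀ hr]; linarith
    have hd2 : d ≤ 4 / 5 := by rw [hd, div_le_iff₀ hr]; linarith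
    set c := √(1 - d ^ 2) with hc
    have hc2 : c ^ 2 = 1 - d ^ 2 := Real.sq_sqrt (by nlinarith)
    have hc0 : 0 ≤ c := Real.sqrt_nonneg _
    have hc35 : 3 / 5 ≤ c := Real.le_sqrt_of_sq_le (by nlinarith)
    have hrest : ‖y‖ ^ 2 - z ^ 2 ≤ 1 / 4 := by
      rw [EuclideanSpace.norm_sq_eq, ← Finset.add_sum_erase _ _ (Finset.mem_univ i₀),
        Real.norm_eq_abs, sq_abs, ← hz, add_sub_cancel_left]
      calc ∑ j ∈ Finset.univ.erase i₀, ‖y j‖ ^ 2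
          ≤ ∑ j ∈ Finset.univ.erase i₀, (1 / (2 * n) : ℝ) ^ 2 := by
            refine Finset.sum_le_sum fun j hj => ?_
            have h1 := hy j
            rw [if_neg (Finset.ne_of_mem_erase hj), if_neg (Finset.ne_of_mem_erase hj)] at h1
            rw [Real.norm_of_nonneg h1.1]
            exact pow_le_pow_left₀ h1.1 h1.2 2
        _ ≤ n * (1 / (2 * n) : ℝ) ^ 2 := by
            rw [Finset.sum_const, nsmul_eq_mul]
            refine mul_le_mul_of_nonneg_right ?_ (by positivity)
            refine Nat.cast_le.2 ((Finset.card_erase_le).trans ?_)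
            rw [Finset.card_univ, Fintype.card_fin]
            omega
        _ = 1 / 4 * (1 / n) := by field_simp; norm_num
        _ ≤ 1 / 4 := by
            have : (1 : ℝ) / n ≤ 1 := by
              rw [div_le_one hn0]
              exact_mod_cast (by omega : 1 ≤ n)
            linarith
    set S := (1 - r) + r * c with hS
    have hS0 : 1 / 2 ≤ S := by nlinarith
    -- The free coordinate is chosen to make the distance from the axis equal to `S`. This is
    -- possible because the other transverse coordinates use up at most `1/4 ≤ S²`.
    obtain ⟨x, hxy, -, hx⟩ := exists_dropCoord (by omega : 1 ≤ n) y (√(S ^ 2 - (‖y‖ ^ 2 - z ^ 2)))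
    rw [Real.sq_sqrt (by nlinarith)] at hx
    have hxz : inner ℝ x (axis n hn) = z := by rw [inner_axis, hxy]
    have hperp : ‖perp (axis n hn) x‖ = S := by
      have h1 := norm_sq_eq_perp (norm_axis hn) x
      rw [hx, hxz] at h1
      refine (sq_eq_sq₀ (norm_nonneg _) (by linarith)).1 ?_
      linarith
    have hzr : z - (1 - r) = r * d := by rw [hd]; field_simp
    have hz0 : |z| = z := abs_of_pos (by linarith)
    refine ⟨x, ⟨⟨?_, ?_, ?_⟩, ?_⟩, hxy⟩
    · rw [hxz, hz0]; linarith
    · rw [hperp, hS]; nlinarith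
    · rw [hperp, hxz, hz0, hzr, hS]
      linear_combination r ^ 2 * hc2
    · rw [rimCos, hperp, hS, add_sub_cancel_left, mul_div_cancel_left₀ _ hr.ne']
      exact hc35

theorem integrableOn_integrandV_rim {e : Euc n} (hn : 2 ≤ n) (he : ‖e‖ = 1) {r : ℝ} (hr : 0 < r)
    (hr1 : r < 1) {p : ℝ} (hp : p < -n ∨ 0 ≤ p) (k : ℕ) :
    IntegrableOn (integrandV p k (rounding (cylinder e he) r)) (rim e r) μHE[n - 1] :=
  integrableOn_integrandV fun m _ => integrableOn_rim hn he hr hr1 hp m k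

/-- Density at least `C/r` meets area at least a multiple of `r`, and the fixed sign excludes
cancellation on the rest of the rim. -/
theorem HasLargeDensity.exists_le_setIntegral_rim (hn : 2 ≤ n) {p : ℝ} (hp : p < -n ∨ 0 ≤ p)
    {k : ℕ} {σ : ℝ} (h : HasLargeDensity n p k σ) : ∃ C > 0, ∀ᶠ r in 𝓝[>] (0 : ℝ), C ≤
      σ * ∫ x in rim (axis n hn) r,
        integrandV p k (rounding (cylinder (axis n hn) (norm_axis hn)) r) x ∂μHE[n - 1] := by
  obtain ⟨C, hC, hev⟩ := h
  have hn0 : (0 : ℝ) < n := by positivity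
  refine ⟨C * (3 / 10 * (1 / (2 * n)) ^ (n - 2)), by positivity, ?_⟩
  filter_upwards [hev, self_mem_nhdsWithin,
    nhdsWithin_le_nhds (Iic_mem_nhds (by norm_num : (0 : ℝ) < 1 / 2))] with r hr hr0 hr2
  have hr0' : 0 < r := hr0
  have hr2' : r ≤ 1 / 2 := hr2
  have hr1 : r < 1 := by linarith
  have he := norm_axis hn
  set e := axis n hn
  set K := rounding (cylinder e he) r
  set R : Set (Euc n) := {x | x ∈ rim e r ∧ 3 / 5 ≤ rimCos e r x} with hR
  have hcont : Continuous (rimCos e r) :=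
    ((continuous_perp e).norm.sub continuous_const).div_const _
  have hRm : MeasurableSet R :=
    (measurableSet_rim e r).inter (isClosed_le continuous_const hcont).measurableSet
  have hRr : R ⊆ rim e r := fun x hx => hx.1
  have hpt : ∀ x ∈ rim e r, 0 ≤ σ * integrandV p k K x ∧
      (3 / 5 ≤ rimCos e r x → C / r ≤ σ * integrandV p k K x) := by
    intro x hx
    have h1 := rim_curvature_mem hr0' hr1 hx
    have h2 := hr _ (rim_height_mem hr0' hr1 hx) _ ⟨(rimCos_pos hr0' hx).le.trans h1.1, h1.2⟩
    rw [integrandV_rim hn he hr0' hr1 hx]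
    exact ⟨h2.1, fun h35 => h2.2 (h35.trans h1.1)⟩
  have hint : IntegrableOn (fun x => σ * integrandV p k K x) (rim e r) μHE[n - 1] :=
    (integrableOn_integrandV_rim hn he hr0' hr1 hp k).const_mul σ
  have hfin : μHE[n - 1] R ≠ ⊤ :=
    measure_frontier_ne_top hn (zero_mem_interior_rounding (zero_mem_cylinder he) hr0')
      (hRr.trans (rim_subset_frontier he hr0' hr1))
  have hmeas : 3 / 10 * r * (1 / (2 * n)) ^ (n - 2) ≤ (μHE[n - 1] : Measure (Euc n)).real R := by
    rw [Measure.real, ← ENNReal.ofReal_le_iff_le_toReal hfin]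
    exact measure_rim_ge hn hr0' hr2'
  rw [← integral_const_mul]
  calc C * (3 / 10 * (1 / (2 * n)) ^ (n - 2))
      = C / r * (3 / 10 * r * (1 / (2 * n)) ^ (n - 2)) := by field_simp
    _ ≤ C / r * (μHE[n - 1] : Measure (Euc n)).real R := by gcongr
    _ ≤ ∫ x in R, σ * integrandV p k K x ∂μHE[n - 1] :=
        setIntegral_ge_of_const_le_real hRm hfin (fun x hx => (hpt x hx.1).2 hx.2)
          (hint.mono_set hRr)
    _ ≤ ∫ x in rim e r, σ * integrandV p k K x ∂μHE[n - 1] :=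
        setIntegral_mono_set hint ((ae_restrict_iff' (measurableSet_rim e r)).2
          (Eventually.of_forall fun x hx => (hpt x hx).1)) hRr.eventuallyLE

end RimMeasure
end LpSteiner

namespace LpSteiner

/-! ### Failure of semicontinuity. -/

section Semicontinuity

variable {n : ℕ}

theorem measureReal_homothety (d : ℕ) (z : Euc n) {r : ℝ} (hr : 0 < r) (s : Set (Euc n)) :
    (μHE[d] : Measure (Euc n)).real ((fun ξ => z + r • ξ) '' s) =
      r ^ d * (μHE[d] : Measure (Euc n)).real s := by
  have h := setIntegral_homothety d z hr s fun _ => 1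
  rwa [setIntegral_const, setIntegral_const, smul_eq_mul, smul_eq_mul, mul_one, mul_one] at h

variable {e : Euc n}

/-- The full lateral boundary scaled by `s` is covered by the image of `lateral e s` under the
radial contraction with factor `s`, which is 1-Lipschitz. -/
theorem measureReal_lateral_ge (hn : 2 ≤ n) (he : ‖e‖ = 1) {s : ℝ} (hs : 0 < s) (hs1 : s ≤ 1) :
    s ^ (n - 1) * (μHE[n - 1] : Measure (Euc n)).real (lateral e 1) ≤
      (μHE[n - 1] : Measure (Euc n)).real (lateral e s) := by
  have hlip : LipschitzWith 1 fun x : Euc n => s • perp e x + (inner ℝ x e : ℝ) • e := by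
    refine LipschitzWith.of_dist_le_mul fun x y => ?_
    rw [NNReal.coe_one, one_mul, dist_eq_norm, dist_eq_norm]
    have h1 : s • perp e x + (inner ℝ x e : ℝ) • e - (s • perp e y + (inner ℝ y e : ℝ) • e) =
        s • perp e (x - y) + (inner ℝ (x - y) e : ℝ) • e := by
      rw [perp_sub, inner_sub_left]
      module
    rw [h1]
    refine le_of_sq_le_sq ?_ (norm_nonneg _)
    rw [norm_sq_perp_add he, norm_sq_eq_perp he (x - y)]
    have h2 : s ^ 2 ≤ 1 := pow_le_one₀ hs.le hs1
    nlinarith [sq_nonneg ‖perp e (x - y)‖]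
  have hsub : (fun ξ => (0 : Euc n) + s • ξ) '' lateral e 1 ⊆
      (fun x : Euc n => s • perp e x + (inner ℝ x e : ℝ) • e) '' lateral e s := by
    rintro _ ⟨x, hx, rfl⟩
    refine ⟨perp e x + (s * inner ℝ x e) • e, ⟨?_, ?_⟩, ?_⟩
    · rw [inner_add_left, inner_perp he, real_inner_smul_left, inner_self_of_norm_one he, zero_add,
        mul_one, abs_mul, abs_of_pos hs]
      exact mul_lt_of_lt_one_right hs hx.1
    · rw [perp_add, perp_smul, perp_self he, smul_zero, add_zero,
        perp_of_inner_eq_zero (inner_perp he x)]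
      exact hx.2
    · simp only
      rw [perp_add, perp_smul, perp_self he, smul_zero, add_zero,
        perp_of_inner_eq_zero (inner_perp he x), inner_add_left, inner_perp he,
        real_inner_smul_left, inner_self_of_norm_one he, zero_add, zero_add, mul_one]
      conv_rhs => rw [← perp_add_smul e x]
      module
  rw [← measureReal_homothety (n - 1) 0 hs]
  have hfin : μHE[n - 1] (lateral e s) ≠ ⊤ :=
    ne_top_of_le_ne_top (measure_frontier_ne_top hn (zero_mem_interior_cylinder he)
      fun x hx => (isCylindrical_cylinder he).lateral_subset hx)
      (measure_mono fun x hx => ⟨hx.1.trans_le hs1, hx.2⟩)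
  exact ENNReal.toReal_mono hfin ((measure_mono hsub).trans
    (hlip.euclideanHausdorffMeasure_image_le _ _))

theorem measureReal_unitFace_ge (hn : 2 ≤ n) (he : ‖e‖ = 1) {r : ℝ} (hr : 0 < r) (hr1 : r < 1)
    {u : Euc n} (hu : u = e ∨ u = -e) :
    (1 - r) ^ (n - 1) *
      (μHE[n - 1] : Measure (Euc n)).real (unitFace (cylinder e he) u) ≤
      (μHE[n - 1] : Measure (Euc n)).real (unitFace (rounding (cylinder e he) r) u) := by
  have hK := isCylindrical_rounding he hr hr1
  have hu1 : ‖u‖ = 1 := by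
    rcases hu with rfl | rfl
    · exact he
    · rw [norm_neg]; exact he
  rw [← measureReal_homothety (n - 1) (r • u) (sub_pos.2 hr1)]
  refine ENNReal.toReal_mono (measure_frontier_ne_top hn hK.zero_mem (hK.unitFace_subset hu))
    (measure_mono ?_)
  rintro _ ⟨x, hx, rfl⟩
  refine ⟨mem_rounding.2 ⟨x, hx.1, u, hu1.le, add_comm _ _⟩, ?_⟩
  rw [inner_add_left, real_inner_smul_left, real_inner_smul_left, hx.2,
    inner_self_of_norm_one hu1]
  ring

theorem totalDensity_zero_left {p : ℝ} (hn : 2 ≤ n) (hp : p < -n ∨ 0 ≤ p) (hp0 : p ≠ 0) (k : ℕ)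
    (h β : ℝ) : totalDensity n p k h 0 β = 0 := by
  refine Finset.sum_eq_zero fun m _ => ?_
  rw [density, zero_mul, Real.zero_rpow (exponent_ne_zero hn hp hp0), mul_zero, zero_mul, mul_zero]

theorem tendsto_one_div_add_two : Tendsto (fun l : ℕ => 1 / ((l : ℝ) + 2)) atTop (𝓝[>] 0) := by
  refine tendsto_nhdsWithin_iff.2 ⟨?_, Eventually.of_forall fun l => ?_⟩
  · have h := (tendsto_one_div_add_atTop_nhds_zero_nat (𝕜 := ℝ)).comp (tendsto_add_atTop_nat 1)
    refine h.congr fun l => ?_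
    simp only [Function.comp_apply]
    push_cast
    ring
  · exact Set.mem_Ioi.2 (by positivity)

theorem one_div_add_two_lt_one (l : ℕ) : 1 / ((l : ℝ) + 2) < 1 := by
  rw [div_lt_one (by positivity)]
  have : (0 : ℝ) ≤ l := l.cast_nonneg
  linarith

/-- `V` is zero at the cylinder but bounded away from zero, with the sign of `binom(n/(n+p), k)`, on
its roundings. One such rounding is in turn a limit of polytopes, where `V` is zero. The two jumps
go in opposite directions. -/
theorem not_semicontinuousOn_of_ne_zero {p : ℝ} (hn : 2 ≤ n) (hp : p < -n ∨ 0 ≤ p) (hp0 : p ≠ 0)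
    {k : ℕ} (hk : 1 ≤ k) : ¬ LowerSemicontinuousOn (V p k) (domainV n p k) ∧
      ¬ UpperSemicontinuousOn (V p k) (domainV n p k) := by
  have he := norm_axis hn
  set e := axis n hn with hedef
  have hVr : ∀ r : ℝ, 0 < r → r < 1 → rounding (cylinder e he) r ∈ domainV n p k ∧
      V p k (rounding (cylinder e he) r) =
        ∫ x in rim e r, integrandV p k (rounding (cylinder e he) r) x ∂μHE[n - 1] := by
    intro r hr hr1
    have h := V_rounding_cylinder hn he hr hr1 hp k
    simpa only [totalDensity_zero_left hn hp hp0, zero_mul, zero_add] using h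
  have hVc : cylinder e he ∈ domainV n p k ∧ V p k (cylinder e he) = 0 := by
    have h := V_cylinder hn he hp k
    simpa only [totalDensity_zero_left hn hp hp0, zero_mul, zero_add] using h
  have hseq : Tendsto (fun l : ℕ => rounding (cylinder e he) (1 / ((l : ℝ) + 2))) atTop
      (𝓝 (cylinder e he)) := tendsto_rounding (tendsto_nhdsWithin_iff.1 tendsto_one_div_add_two).1
  have hseqD : ∀ᶠ l : ℕ in atTop, rounding (cylinder e he) (1 / ((l : ℝ) + 2)) ∈ domainV n p k :=
    Eventually.of_forall fun l => (hVr _ (by positivity) (one_div_add_two_lt_one l)).1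
  have hpoly : ∀ P : ConvexBody (Euc n), IsPolytope P → (0 : Euc n) ∈ interior (P : Set (Euc n)) →
      P ∈ domainV n p k ∧ V p k P = 0 := fun P hP h0 =>
    ⟨hP.mem_domainV hn hp k h0, by rw [hP.V_eq hn hp hk h0, if_neg (fun h => hp0 h.1)]⟩
  have hbound : ∀ σ : ℝ, 0 < σ * Ring.choose ((n : ℝ) / (n + p)) k → ∃ C > 0,
      ∀ᶠ l : ℕ in atTop, C ≤ σ * V p k (rounding (cylinder e he) (1 / ((l : ℝ) + 2))) := by
    intro σ hσ
    obtain ⟨C, hC, h⟩ := (hasLargeDensity hn hp hk hσ).exists_le_setIntegral_rim hn hp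
    refine ⟨C, hC, (tendsto_one_div_add_two.eventually h).mono fun l hl => ?_⟩
    rw [(hVr _ (by positivity) (one_div_add_two_lt_one l)).2]
    exact hl
  rcases lt_or_gt_of_ne (choose_leading_ne_zero (k := k) hn hp hp0) with hneg | hpos
  · obtain ⟨C, hC, hev⟩ := hbound (-1) (by linarith)
    obtain ⟨l, hl⟩ := hev.exists
    have hl1 := one_div_add_two_lt_one l
    have hl0 : 0 < 1 / ((l : ℝ) + 2) := by positivity
    obtain ⟨P, hP, hPt⟩ := exists_polytope_seq
      (zero_mem_interior_rounding (zero_mem_cylinder he) hl0)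
    constructor
    · refine not_lowerSemicontinuousOn_of_seq hVc.1 hseq hseqD (c := -C) (by linarith [hVc.2])
        (hev.mono fun l hl => by linarith)
    · exact not_upperSemicontinuousOn_of_seq (hVr _ hl0 hl1).1 hPt
        (Eventually.of_forall fun j => (hpoly _ (hP j).1 (hP j).2.1).1) (c := 0) (by linarith)
        (Eventually.of_forall fun j => (hpoly _ (hP j).1 (hP j).2.1).2.ge)
  · obtain ⟨C, hC, hev⟩ := hbound 1 (by linarith)
    obtain ⟨l, hl⟩ := hev.exists
    have hl1 := one_div_add_two_lt_one l
    have hl0 : 0 < 1 / ((l : ℝ) + 2) := by positivity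
    obtain ⟨P, hP, hPt⟩ := exists_polytope_seq
      (zero_mem_interior_rounding (zero_mem_cylinder he) hl0)
    constructor
    · exact not_lowerSemicontinuousOn_of_seq (hVr _ hl0 hl1).1 hPt
        (Eventually.of_forall fun j => (hpoly _ (hP j).1 (hP j).2.1).1) (c := 0) (by linarith)
        (Eventually.of_forall fun j => (hpoly _ (hP j).1 (hP j).2.1).2.le)
    · refine not_upperSemicontinuousOn_of_seq hVc.1 hseq hseqD (c := C) (by linarith [hVc.2])
        (hev.mono fun l hl => by linarith)

/-- Under rounding, the lateral and flat parts retain at least the fraction `(1 - r)^(n-1)` of their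
nonnegative contribution, while the rim adds at least a fixed `C > 0`. -/
theorem not_upperSemicontinuousOn_zero (hn : 2 ≤ n) {k : ℕ} (hk : 1 ≤ k) (hkn : k ≤ n) :
    ¬ UpperSemicontinuousOn (V 0 k) (domainV n 0 k) := by
  have hp : (0 : ℝ) < -n ∨ (0 : ℝ) ≤ 0 := Or.inr le_rfl
  have he := norm_axis hn
  set e := axis n hn with hedef
  obtain ⟨C, hC, hev⟩ := (hasLargeDensity_zero hn hk hkn).exists_le_setIntegral_rim hn hp
  have hVc := V_cylinder hn he hp k
  have hθ : ∀ β : ℝ, 0 ≤ β → 0 ≤ totalDensity n 0 k 1 0 β := by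
    intro β hβ
    rw [totalDensity_zero hn hk]
    have h1 := esymmTwo_nonneg (n := n) le_rfl hβ k
    have h2 := esymmTwo_nonneg (n := n) le_rfl hβ (k - 1)
    linarith
  have hseq : Tendsto (fun l : ℕ => rounding (cylinder e he) (1 / ((l : ℝ) + 2))) atTop
      (𝓝 (cylinder e he)) := tendsto_rounding (tendsto_nhdsWithin_iff.1 tendsto_one_div_add_two).1
  have hlow : ∀ᶠ l : ℕ in atTop, (1 - 1 / ((l : ℝ) + 2)) ^ (n - 1) * V 0 k (cylinder e he) + C ≤
      V 0 k (rounding (cylinder e he) (1 / ((l : ℝ) + 2))) := by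
    filter_upwards [tendsto_one_div_add_two.eventually hev] with l hl
    have hl1 := one_div_add_two_lt_one l
    have hl0 : 0 < 1 / ((l : ℝ) + 2) := by positivity
    rw [one_mul] at hl
    have h1 := measureReal_lateral_ge hn he (sub_pos.2 hl1) (by linarith)
    have h2 := measureReal_unitFace_ge hn he hl0 hl1 (Or.inl rfl)
    have h3 := measureReal_unitFace_ge hn he hl0 hl1 (Or.inr rfl)
    rw [hVc.2, (V_rounding_cylinder hn he hl0 hl1 hp k).2, mul_add, mul_add]
    refine add_le_add (add_le_add (add_le_add ?_ ?_) ?_) hl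
    · rw [mul_left_comm]; exact mul_le_mul_of_nonneg_left h1 (hθ 1 zero_le_one)
    · rw [mul_left_comm]; exact mul_le_mul_of_nonneg_left h2 (hθ 0 le_rfl)
    · rw [mul_left_comm]; exact mul_le_mul_of_nonneg_left h3 (hθ 0 le_rfl)
  have hlim : Tendsto (fun l : ℕ => (1 - 1 / ((l : ℝ) + 2)) ^ (n - 1) * V 0 k (cylinder e he) + C)
      atTop (𝓝 (V 0 k (cylinder e he) + C)) := by
    have h := ((((tendsto_nhdsWithin_iff.1 tendsto_one_div_add_two).1.const_sub 1).pow
      (n - 1)).mul_const (V 0 k (cylinder e he))).add_const C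
    simpa using h
  refine not_upperSemicontinuousOn_of_seq hVc.1 hseq (Eventually.of_forall fun l =>
    (V_rounding_cylinder hn he (by positivity) (one_div_add_two_lt_one l) hp k).1)
    (c := V 0 k (cylinder e he) + C / 2) (by linarith) ?_
  filter_upwards [hlow, hlim.eventually_const_lt
    (show V 0 k (cylinder e he) + C / 2 < V 0 k (cylinder e he) + C by linarith)] with l h1 h2
  linarith

open scoped Pointwise in
theorem measureReal_frontier_smul_unitBall {t : ℝ} (ht : 0 < t) :
    (μHE[n - 1] : Measure (Euc n)).real (frontier ((t • unitBall n : ConvexBody (Euc n)) : Set (Euc n)))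
      = t ^ (n - 1) * (μHE[n - 1] : Measure (Euc n)).real (Metric.sphere 0 1) := by
  rw [← measureReal_homothety (n - 1) 0 ht]
  congr 1
  have h : ((t • unitBall n : ConvexBody (Euc n)) : Set (Euc n)) = Metric.closedBall 0 t := by
    rw [ConvexBody.coe_smul]
    change t • Metric.closedBall (0 : Euc n) 1 = _
    rw [smul_unitClosedBall, Real.norm_of_nonneg ht.le]
  rw [h, frontier_closedBall _ ht.ne']
  ext x
  simp only [mem_sphere_zero_iff_norm, Set.mem_image, zero_add]
  constructor
  · intro hx
    refine ⟨t⁻¹ • x, ?_, smul_inv_smul₀ ht.ne' x⟩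
    rw [norm_smul, norm_inv, Real.norm_of_nonneg ht.le, hx, inv_mul_cancel₀ ht.ne']
  · rintro ⟨y, hy, rfl⟩
    rw [norm_smul, hy, Real.norm_of_nonneg ht.le, mul_one]

theorem measureReal_sphere_pos (hn : 1 ≤ n) :
    0 < (μHE[n - 1] : Measure (Euc n)).real (Metric.sphere 0 1) :=
  ENNReal.toReal_pos ((measure_positiveSphere_pos hn).trans_le
    (measure_mono fun _ hx => mem_sphere_zero_iff_norm.2 hx.1)).ne' (measure_sphere_lt_top hn).ne

/-- At the ball `V` is `binom(n, k)` times the area `A`. Polytopes give `0` for `k ≥ 2`. For `k = 1`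
they give their surface area, which monotonicity keeps eventually below `3/2 A`, and `3/2 < n`. -/
theorem not_lowerSemicontinuousOn_zero (hn : 2 ≤ n) {k : ℕ} (hk : 1 ≤ k) (hkn : k ≤ n) :
    ¬ LowerSemicontinuousOn (V 0 k) (domainV n 0 k) := by
  have hp : (0 : ℝ) < -n ∨ (0 : ℝ) ≤ 0 := Or.inr le_rfl
  have hn0 : (n : ℝ) ≠ 0 := by positivity
  obtain ⟨P, hP, hPt⟩ := exists_polytope_seq (zero_mem_interior_unitBall (n := n))
  set A := (μHE[n - 1] : Measure (Euc n)).real (Metric.sphere (0 : Euc n) 1) with hA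
  have hA0 : 0 < A := measureReal_sphere_pos (by omega)
  have hVB : V 0 k (unitBall n) = (n.choose k : ℝ) * A := by
    rw [V_unitBall hn, sub_zero, add_zero, mul_div_cancel_right₀ _ hn0, choose_natCast_real]
  have hPD : ∀ᶠ l in atTop, P l ∈ domainV n 0 k :=
    Eventually.of_forall fun l => (hP l).1.mem_domainV hn hp k (hP l).2.1
  have hBD := unitBall_mem_domainV hn 0 k
  by_cases hk1 : k = 1
  · subst hk1
    rw [Nat.choose_one_right] at hVB
    have hn2 : (2 : ℝ) ≤ n := by exact_mod_cast hn
    refine not_lowerSemicontinuousOn_of_seq hBD hPt hPD (c := 3 / 2 * A) (by nlinarith) ?_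
    have hlim : Tendsto (fun l : ℕ => (1 + 1 / ((l : ℝ) + 1)) ^ (n - 1)) atTop (𝓝 1) := by
      have h := ((tendsto_one_div_add_atTop_nhds_zero_nat (𝕜 := ℝ)).const_add 1).pow (n - 1)
      simpa using h
    filter_upwards [hlim.eventually_lt_const (show (1 : ℝ) < 3 / 2 by norm_num)] with l hl
    have ht : (0 : ℝ) < 1 + 1 / ((l : ℝ) + 1) := by positivity
    rw [(hP l).1.V_eq hn hp le_rfl (hP l).2.1, if_pos ⟨rfl, rfl⟩]
    have h1 := measure_frontier_mono ⟨0, (hP l).2.1⟩ (hP l).2.2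
    have h2 : μHE[n - 1] (frontier (((1 + 1 / ((l : ℝ) + 1)) • unitBall n : ConvexBody (Euc n)) :
        Set (Euc n))) ≠ ⊤ :=
      (measure_frontier_lt_top (by omega) ⟨0, interior_mono (hP l).2.2 (hP l).2.1⟩).ne
    refine (ENNReal.toReal_mono h2 h1).trans ?_
    change (μHE[n - 1] : Measure (Euc n)).real _ ≤ _
    rw [measureReal_frontier_smul_unitBall ht]
    exact mul_le_mul_of_nonneg_right hl.le hA0.le
  · refine not_lowerSemicontinuousOn_of_seq hBD hPt hPD (c := 0) ?_ ?_
    · rw [hVB]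
      have : (0 : ℝ) < (n.choose k : ℝ) := by exact_mod_cast Nat.choose_pos hkn
      positivity
    · refine Eventually.of_forall fun l => ?_
      rw [(hP l).1.V_eq hn hp hk (hP l).2.1, if_neg (fun h => hk1 h.2)]

/-- Only `m = k` and `m = k - 1` enter, and both exceed the number `n - 1` of curvatures. The
integrands vanish identically, so integrability plays no role. -/
theorem V_zero_eq_zero (hn : 2 ≤ n) {k : ℕ} (hkn : n < k) (K : ConvexBody (Euc n)) :
    V 0 k K = 0 := by
  have hn0 : (n : ℝ) ≠ 0 := by positivity
  have hW : ∀ m, n ≤ m → W 0 m k K = 0 := by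
    intro m hm
    rw [W]
    refine integral_eq_zero_of_ae (Eventually.of_forall fun x => ?_)
    simp only [Pi.zero_apply]
    rw [integrandW_eq, add_zero, div_self hn0, powCoeff_one, if_neg (by omega), if_neg (by omega),
      mul_zero]
  rw [V]
  simp only [sub_zero, mul_one, add_zero, div_self hn0]
  rw [sum_choose_one_mul (by omega) fun m => W 0 m k K, hW k hkn.le, hW (k - 1) (by omega),
    add_zero]

end Semicontinuity
end LpSteiner

namespace LpSteiner

/-! ### Limits along the rounded cubes. -/

section RoundedCubes

variable {n : ℕ} {p : ℝ} {k : ℕ}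

theorem tendsto_roundedCube (n : ℕ) : Tendsto (roundedCube n) atTop (𝓝 (cube n)) :=
  tendsto_rounding tendsto_one_div_atTop_nhds_zero_nat

theorem V_roundedCube_eventuallyEq (hn : 2 ≤ n) (hp : p < -n ∨ 0 ≤ p) (hp0 : p ≠ 0) (k : ℕ) :
    powerSum k (n * (n - 1) / (n + p)) (cubeCoeff n p k)
      (fun m l => sphereIntegral n ((m : ℝ) - k + n * (1 - p) / (n + p)) (1 / l)) =ᶠ[atTop]
      fun l => V p k (roundedCube n l) := by
  filter_upwards [eventually_ge_atTop 2] with l hl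
  rw [V_roundedCube hn hp hp0 k hl]

theorem exists_tendsto_V_roundedCube (hn : 2 ≤ n) (hp : p < -n ∨ 0 ≤ p) (hp0 : p ≠ 0) (k : ℕ) :
    ∃ L : EReal, Tendsto (fun l => (V p k (roundedCube n l) : EReal)) atTop (𝓝 L) ∧
      Tendsto (fun l => (cubeAsymptotics n p k l : EReal)) atTop (𝓝 L) := by
  obtain ⟨L, hL⟩ := exists_tendsto_powerSum k ((n : ℝ) * (n - 1) / (n + p)) (cubeCoeff n p k)
    fun m => sphereIntegral_zero_pos (by omega : 1 ≤ n) ((m : ℝ) - k + n * (1 - p) / (n + p))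
  refine ⟨L, (hL _ fun m => tendsto_sphereIntegral (by omega) _).congr'
    ((V_roundedCube_eventuallyEq hn hp hp0 k).mono fun l hl => congrArg _ hl), ?_⟩
  simp only [cubeAsymptotics_eq]
  exact hL _ fun m => tendsto_const_nhds

theorem cubeCoeff_self (hn : 2 ≤ n) (p : ℝ) (k : ℕ) :
    cubeCoeff n p k k = 2 ^ n * Ring.choose ((n : ℝ) * (n - 1) / (n + p)) k := by
  rw [cubeCoeff, Nat.sub_self, Ring.choose_zero_right, mul_one, F_eq_choose (by omega)]

/-- For `p < -n` the number `n(n-1)/(n+p)` is negative, so the term `m = k` dominates with a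
positive power of `l`, and its binomial coefficient has sign `(-1)^k`. -/
theorem neg_one_pow_mul_cubeCoeff_pos (hn : 2 ≤ n) (hp : p < -n) (k : ℕ) :
    (n : ℝ) * (n - 1) / (n + p) < k ∧ 0 < (-1) ^ k * (cubeCoeff n p k k *
      sphereIntegral n ((k : ℝ) - k + n * (1 - p) / (n + p)) 0) := by
  have hn2 : (2 : ℝ) ≤ n := by exact_mod_cast hn
  have hs : (n : ℝ) * (n - 1) / (n + p) < 0 :=
    div_neg_of_pos_of_neg (mul_pos (by linarith) (by linarith)) (by linarith)
  refine ⟨hs.trans_le k.cast_nonneg, ?_⟩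
  have h1 := neg_one_pow_mul_choose_pos hs k
  have h2 := sphereIntegral_zero_pos (by omega : 1 ≤ n) ((k : ℝ) - k + n * (1 - p) / (n + p))
  rw [cubeCoeff_self hn]
  have h3 : (0 : ℝ) < 2 ^ n := by positivity
  have h4 := mul_pos (mul_pos h3 h1) h2
  linarith

theorem tendsto_V_roundedCube_atBot (hn : 2 ≤ n) (hp : p < -n) (hk : Odd k) :
    Tendsto (fun l => V p k (roundedCube n l)) atTop atBot := by
  have hp0 : p ≠ 0 := by
    have : (0 : ℝ) ≤ n := n.cast_nonneg
    linarith
  obtain ⟨hs, hpos⟩ := neg_one_pow_mul_cubeCoeff_pos hn hp k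
  rw [hk.neg_one_pow] at hpos
  exact (tendsto_powerSum_atBot le_rfl (fun m h1 h2 => absurd h2 (not_le.2 h1))
    (fun m => tendsto_sphereIntegral (by omega) _) hs (by linarith)).congr'
    (V_roundedCube_eventuallyEq hn (Or.inl hp) hp0 k)

theorem tendsto_V_roundedCube_atTop (hn : 2 ≤ n) (hp : p < -n) (hk : Even k) :
    Tendsto (fun l => V p k (roundedCube n l)) atTop atTop := by
  have hp0 : p ≠ 0 := by
    have : (0 : ℝ) ≤ n := n.cast_nonneg
    linarith
  obtain ⟨hs, hpos⟩ := neg_one_pow_mul_cubeCoeff_pos hn hp k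
  rw [hk.neg_one_pow] at hpos
  exact (tendsto_powerSum_atTop le_rfl (fun m h1 h2 => absurd h2 (not_le.2 h1))
    (fun m => tendsto_sphereIntegral (by omega) _) hs (by linarith)).congr'
    (V_roundedCube_eventuallyEq hn (Or.inl hp) hp0 k)

theorem tendsto_V_roundedCube_critical (hn : 2 ≤ n) (hp : 0 < p)
    (hk : (k : ℝ) = n * (n - 1) / (n + p)) :
    Tendsto (fun l => V p k (roundedCube n l)) atTop
        (𝓝 (2 ^ n * F n p k * ∫ ξ in positiveSphere n,
          (∑ i, ξ i) ^ ((n : ℝ) * (1 - p) / (n + p)) ∂μHE[n - 1])) ∧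
      0 < 2 ^ n * F n p k * ∫ ξ in positiveSphere n,
          (∑ i, ξ i) ^ ((n : ℝ) * (1 - p) / (n + p)) ∂μHE[n - 1] := by
  -- In the critical case the upper entry of the binomial coefficient is `k` itself.
  have hF : F n p k = 1 := by
    rw [F_eq_choose (by omega), ← hk, choose_natCast_real, Nat.choose_self, Nat.cast_one]
  have h := tendsto_powerSum_of_eq (A := cubeCoeff n p k) (le_refl k)
    (fun m h1 h2 => absurd h2 (not_le.2 h1))
    (fun m => tendsto_sphereIntegral (by omega : 1 ≤ n)
      ((m : ℝ) - k + n * (1 - p) / (n + p))) hk.symm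
  have h1 := h.congr' (V_roundedCube_eventuallyEq hn (Or.inr hp.le) hp.ne' k)
  rw [sub_self, zero_add, cubeCoeff, Nat.sub_self, Ring.choose_zero_right, mul_one] at h1
  rw [← sphereIntegral_zero]
  refine ⟨h1, ?_⟩
  have h2 := sphereIntegral_zero_pos (by omega : 1 ≤ n) ((n : ℝ) * (1 - p) / (n + p))
  rw [hF]
  positivity

end RoundedCubes
end LpSteiner


theorem mainTheorem10 (n : ℕ) (hn : 2 ≤ n) (p : ℝ) (hp : p < -n ∨ 0 ≤ p) (k : ℕ) (hk : 1 ≤ k) :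
    -- neither lower nor upper semicontinuous, outside the range where the functional vanishes
    ((p ≠ 0 ∨ k ≤ n) →
      ¬ LowerSemicontinuousOn (LpSteiner.V p k) (LpSteiner.domainV n p k) ∧
      ¬ UpperSemicontinuousOn (LpSteiner.V p k) (LpSteiner.domainV n p k)) ∧
    (p = 0 → n < k →
      ∀ K : ConvexBody (EuclideanSpace ℝ (Fin n)), LpSteiner.V p k K = 0) ∧
    -- polytopes, and the ball as a limit of polytopes
    (∀ P : ConvexBody (EuclideanSpace ℝ (Fin n)), LpSteiner.IsPolytope P →
      0 ∈ interior (P : Set (EuclideanSpace ℝ (Fin n))) →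
      P ∈ LpSteiner.domainV n p k ∧
      LpSteiner.V p k P =
        if p = 0 ∧ k = 1 then
          (μHE[n - 1] : Measure (EuclideanSpace ℝ (Fin n))).real
            (frontier (P : Set (EuclideanSpace ℝ (Fin n))))
        else 0) ∧
    (∃ P : ℕ → ConvexBody (EuclideanSpace ℝ (Fin n)),
      (∀ l, LpSteiner.IsPolytope (P l) ∧
        0 ∈ interior (P l : Set (EuclideanSpace ℝ (Fin n)))) ∧
      Tendsto P atTop (𝓝 (LpSteiner.unitBall n))) ∧
    (LpSteiner.unitBall n ∈ LpSteiner.domainV n p k ∧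
      LpSteiner.V p k (LpSteiner.unitBall n) =
        Ring.choose ((n : ℝ) * (n - p) / (n + p)) k *
          (μHE[n - 1] : Measure (EuclideanSpace ℝ (Fin n))).real (Metric.sphere 0 1)) ∧
    -- the rounded cubes
    Tendsto (LpSteiner.roundedCube n) atTop (𝓝 (LpSteiner.cube n)) ∧
    (p ≠ 0 →
      (∀ l, 1 ≤ l → LpSteiner.roundedCube n l ∈ LpSteiner.domainV n p k) ∧
      (∃ L : EReal,
        Tendsto (fun l => (LpSteiner.V p k (LpSteiner.roundedCube n l) : EReal)) atTop (𝓝 L) ∧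
        Tendsto (fun l => (LpSteiner.cubeAsymptotics n p k l : EReal)) atTop (𝓝 L))) ∧
    (p < -n → Odd k →
      Tendsto (fun l => LpSteiner.V p k (LpSteiner.roundedCube n l)) atTop atBot) ∧
    (p < -n → Even k →
      Tendsto (fun l => LpSteiner.V p k (LpSteiner.roundedCube n l)) atTop atTop) ∧
    (0 < p → (k : ℝ) = n * (n - 1) / (n + p) →
      Tendsto (fun l => LpSteiner.V p k (LpSteiner.roundedCube n l)) atTop
        (𝓝 (2 ^ n * LpSteiner.F n p k *
          ∫ ξ in LpSteiner.positiveSphere n,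
            (∑ i, ξ i) ^ ((n : ℝ) * (1 - p) / (n + p)) ∂μHE[n - 1])) ∧
      0 < 2 ^ n * LpSteiner.F n p k *
          ∫ ξ in LpSteiner.positiveSphere n,
            (∑ i, ξ i) ^ ((n : ℝ) * (1 - p) / (n + p)) ∂μHE[n - 1]) := by
  refine ⟨fun h => ?_, ?_, fun P hP h0 => ⟨hP.mem_domainV hn hp k h0, hP.V_eq hn hp hk h0⟩, ?_,
    ⟨LpSteiner.unitBall_mem_domainV hn p k, LpSteiner.V_unitBall hn p k⟩,
    LpSteiner.tendsto_roundedCube n, fun hp0 =>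
      ⟨fun l hl => LpSteiner.roundedCube_mem_domainV hn hp hp0 k hl,
        LpSteiner.exists_tendsto_V_roundedCube hn hp hp0 k⟩,
    LpSteiner.tendsto_V_roundedCube_atBot hn, LpSteiner.tendsto_V_roundedCube_atTop hn,
    LpSteiner.tendsto_V_roundedCube_critical hn⟩
  · by_cases hp0 : p = 0
    · subst hp0
      have hkn : k ≤ n := h.resolve_left (fun h => h rfl)
      exact ⟨LpSteiner.not_lowerSemicontinuousOn_zero hn hk hkn,
        LpSteiner.not_upperSemicontinuousOn_zero hn hk hkn⟩
    · exact LpSteiner.not_semicontinuousOn_of_ne_zero hn hp hp0 hk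
  · rintro rfl hnk K
    exact LpSteiner.V_zero_eq_zero hn hnk K
  · obtain ⟨P, hP, hPt⟩ :=
      LpSteiner.exists_polytope_seq (LpSteiner.zero_mem_interior_unitBall (n := n))
    exact ⟨P, fun l => ⟨(hP l).1, (hP l).2.1⟩, hPt⟩
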